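/- Let $\gamma>0$, let $\Omega\subset\mathbb R^2$ be open, and for a function $u$ on $\Omega$ write $\{u>0\}=\{y\in\Omega: u(y)>0\}$. A function $u\in W^{1,2}_{loc}(\Omega)$ is a weak solution of $$\Delta u=0\ \text{ in }\{u>0\},\qquad |\nabla u|=|x_2|^{\gamma}\ \text{ on }\partial\{u>0\}\cap\Omega$$ if (1) $u$ is continuous and $u\ge 0$ in $\Omega$; (2) $u$ is harmonic in $\{u>0\}$; (3) for every $\tau>0$ the set $\partial\{u>0\}\cap\Omega\cap\{|x_2|>\tau\}$ is the union of a one-dimensional $C^{2,\alpha}$-surface $\partial_{red}\{u>0\}$ (for some $\alpha\in(0,1)$), relatively open in $\partial\{u>0\}$, and a set of $\mathcal H^1$-measure zero; (4) every point of $\partial_{red}\{u>0\}$ has an open neighbourhood $V$ such that $\nabla u$ extends continuously from $V\cap\{u>0\}$ to $V\cap\overline{\{u>0\}}$, with $|\nabla u|=|x_2|^\gamma$ on $V\cap\partial_{red}\{u>0\}$. For $p=(x,0)$ and $\rho>0$ put $\{u>0\}_{p,\rho}=\{y: p+\rho y\in\{u>0\}\}$. For $O\subset[-1,1]^2$ and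 $0<s\le 1$ put $$\mathrm{Height}(s,O)=\min\{1,\ \sup\{|x_2|:(x_1,x_2)\in O,\ |x_1|=s\}\}\qquad(\sup\emptyset=0).$$ **Theorem.** Let $u$ be a weak solution in $\Omega$, let $p=(x,0)\in\Omega\cap\partial\{u>0\}$, let $B_r(p)\subset\Omega$, and suppose that $|\nabla u|\le C|x_2|^\gamma$ (a.e.) in $B_r(p)$ for a constant $C$. Let $0<\rho\le r$ and let $O$ be any connected component of $\{u>0\}_{p,\rho}\cap[-1,1]^2$ with $(0,0)\in\overline{O}$. Then: 1. $O$ reaches height at least $\frac1{6C}$ in the square: $\min\{1,\ \sup\{|x_2|:(x_1,x_2)\in O,\ |x_1|\le 1\}\}\ge \frac{1}{6C}$. 2. If $O$ does not reach the top or bottom sides $\{|x_2|=1\}$ of the square, and $\overline{O}\subset B_{r/\rho}(0)$ (that is, the rescaled component stays inside the ball where the gradient bound is assumed; this is automatic if $\sqrt2\,\rho<r$), then this bound already holds along $|x_1|=1$: $\mathrm{Height}(1,O)\ge\frac1{6C}$. -/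

import Mathlib

open MeasureTheory Set Filter Topology
open scoped NNReal ENNReal ContDiff

noncomputable section

namespace FreeBdry

/-- The Euclidean plane. The coordinates `x_1`, `x_2` of a point `y` are `y 0`, `y 1`. -/
abbrev Plane : Type := EuclideanSpace ℝ (Fin 2)

/-- `g` is the weak (distributional) gradient of `u` in the open set `U`. -/
structure HasWeakGradientOn (U : Set Plane) (u : Plane → ℝ) (g : Plane → Plane) : Prop where
  locallyIntegrable_fun : LocallyIntegrableOn u U volume
  locallyIntegrable_grad : LocallyIntegrableOn g U volume
  integral_eq : ∀ φ : Plane → ℝ, ContDiff ℝ ∞ φ → HasCompactSupport φ → tsupport φ ⊆ U →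
    ∀ i : Fin 2,
      ∫ y, u y * fderiv ℝ φ y (EuclideanSpace.single i (1 : ℝ)) = - ∫ y, g y i * φ y

/-- Membership in `W^{1,2}_loc(U)`. -/
def MemW12loc (U : Set Plane) (u : Plane → ℝ) : Prop :=
  ∃ g : Plane → Plane, HasWeakGradientOn U u g ∧
    ∀ K : Set Plane, IsCompact K → K ⊆ U →
      MemLp u 2 (volume.restrict K) ∧ MemLp g 2 (volume.restrict K)

/-- The positivity set `{u > 0} ∩ Ω`. -/
def posSet (Ω : Set Plane) (u : Plane → ℝ) : Set Plane := {y | y ∈ Ω ∧ 0 < u y}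

/-- The part `∂{u > 0} ∩ Ω ∩ {|x_2| > τ}` of the topological free boundary. -/
def freeBoundaryOff (Ω : Set Plane) (u : Plane → ℝ) (τ : ℝ) : Set Plane :=
  {y | y ∈ frontier (posSet Ω u) ∧ y ∈ Ω ∧ τ < |y 1|}

/-- `S` is a one-dimensional (embedded) `C^{2,α}` surface in the plane: near each of its points it
is, after a rigid motion, the graph of a `C^{2,α}` function of one variable. -/
def IsC2HolderCurve (α : ℝ≥0) (S : Set Plane) : Prop :=
  ∀ p ∈ S, ∃ W : Set Plane, IsOpen W ∧ p ∈ W ∧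
    ∃ (e : Plane ≃ₗᵢ[ℝ] Plane) (f : ℝ → ℝ),
      ContDiff ℝ 2 f ∧ (∃ K : ℝ≥0, HolderWith K α (iteratedDeriv 2 f)) ∧
      S ∩ W = {y | y ∈ W ∧ (e y) 1 = f ((e y) 0)}

/-- `u` is a weak solution in `Ω` of the free-boundary problem `Δu = 0` in `{u > 0}`,
`|∇u| = |x_2|^γ` on `∂{u > 0}`. -/
structure IsWeakSolution (γ : ℝ) (Ω : Set Plane) (u : Plane → ℝ) : Prop where
  memW12loc : MemW12loc Ω u
  continuousOn : ContinuousOn u Ω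
  nonneg : ∀ y ∈ Ω, 0 ≤ u y
  harmonic : InnerProductSpace.HarmonicOnNhd u (posSet Ω u)
  /-- For each `τ > 0`, `R` is the reduced free boundary in `{|x_2| > τ}`; `G` is the continuous
  extension of `∇u` from `{u > 0}` to `V ∩ closure {u > 0}`. -/
  freeBoundary : ∀ τ : ℝ, 0 < τ → ∃ R : Set Plane,
    R ⊆ freeBoundaryOff Ω u τ ∧
    (∃ W : Set Plane, IsOpen W ∧ R = frontier (posSet Ω u) ∩ W) ∧
    (∃ α : ℝ≥0, 0 < α ∧ α < 1 ∧ IsC2HolderCurve α R) ∧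
    Measure.hausdorffMeasure 1 (freeBoundaryOff Ω u τ \ R) = 0 ∧
    ∀ p ∈ R, ∃ V : Set Plane, IsOpen V ∧ p ∈ V ∧
      ∃ G : Plane → Plane, ContinuousOn G (V ∩ closure (posSet Ω u)) ∧
        (∀ y ∈ V ∩ posSet Ω u, HasGradientAt u (G y) y) ∧
        ∀ y ∈ V ∩ R, ‖G y‖ = |y 1| ^ γ

/-- `|∇u| ≤ C |x_2|^γ` in the open set `U`; the gradient is the weak one, which is unique up to
null sets. -/
def GradientBoundOn (γ C : ℝ) (U : Set Plane) (u : Plane → ℝ) : Prop :=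
  ∃ g : Plane → Plane, HasWeakGradientOn U u g ∧
    ∀ᵐ y ∂(volume.restrict U), ‖g y‖ ≤ C * |y 1| ^ γ

/-- The rescaled set `U_{p,ρ} = (U - p) / ρ`, for `ρ > 0`. -/
def rescaleSet (p : Plane) (ρ : ℝ) (U : Set Plane) : Set Plane := {y | p + ρ • y ∈ U}

/-- The closed square `[-1,1] × [-1,1]`. -/
def square : Set Plane := {y | |y 0| ≤ 1 ∧ |y 1| ≤ 1}

/-- `O` is a connected component of `{u > 0}_{p,ρ} ∩ [-1,1]²` whose closure contains the origin. -/
def IsTouchingComponent (Ω : Set Plane) (u : Plane → ℝ) (p : Plane) (ρ : ℝ) (O : Set Plane) :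
    Prop :=
  (∃ y ∈ rescaleSet p ρ (posSet Ω u) ∩ square,
    O = connectedComponentIn (rescaleSet p ρ (posSet Ω u) ∩ square) y) ∧
  (0 : Plane) ∈ closure O

/-- `Height(s, O) = min {1, sup {|x_2| : (x_1, x_2) ∈ O, |x_1| = s}}`, where `sup ∅ = 0`. -/
def height (s : ℝ) (O : Set Plane) : ℝ :=
  min 1 (sSup {t : ℝ | ∃ y ∈ O, |y 0| = s ∧ t = |y 1|})

/-- The same with `|x_1| ≤ s` in place of `|x_1| = s`. -/
def heightUpTo (s : ℝ) (O : Set Plane) : ℝ :=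
  min 1 (sSup {t : ℝ | ∃ y ∈ O, |y 0| ≤ s ∧ t = |y 1|})

end FreeBdry

end

/-! Work in coordinates centred at `p`, and let h(s) be the height of the component over |x₁| = s.
Formally, apply the divergence theorem to ∇u on the part of the component over |x₁| < s. If the
component stays away from the horizontal sides, the flux through the free boundary balances the flux
through the two vertical sides. The gradient bound makes the latter at most K h(s)^(γ+1) with K =
4C/(γ+1). Over the pair of abscissas ±σ, the first free boundary point met when moving away from the
axis from a point of nearly maximal height carries flux density at least about h(σ)^γ, since |∇u| =
|x₂|^γ there and arc length dominates dσ. Hence ∫₀ˢ h^γ ≤ K h(s)^(γ+1). With H(s) = ∫₀ˢ h^γ this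
reads H' ≥ (H/K)^(γ/(γ+1)), and integration from 0 gives h(s) ≥ s/(4C).

The free boundary is regular only off an ℋ¹-null set, so ∇u is replaced by ψ(u)∇u with ψ a smooth
step at level ε, which vanishes near {u = 0}. Its divergence is the energy density ψ'(u)|∇u|²
(`ClopenPart.integral_energy_le`). On almost every vertical line all free boundary points off the
axis are regular, because null sets project to null sets, and there the energy of the slice is
bounded below as ε → 0 (`ClopenPart.eventually_le_lintegral_slice`). Fatou's lemma yields the
inequality for h (`ClopenPart.lintegral_absHeight_le`), and `le_rpow_of_integral_le` integrates it,
giving `ClopenPart.div_le_absHeight`.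

Because heights are capped at 1, a lower bound on C is also needed: C ≥ 1 (`IsWeakSolution.one_le`).
If C < 1, no regular free boundary point can exist off the axis inside the ball, so the free
boundary off the axis is ℋ¹-null. Cutoffs then show that u is weakly harmonic across it, the axis
being harmless since u and |∇u| are O(|x₂|^γ). By the mean value property with u(p) = 0, u vanishes
near p, which contradicts p being a free boundary point. -/

namespace FreeBdry

/-! ### Planar solutions and clopen parts of the positivity set -/

/-- A nonnegative function `v` on `B`, harmonic on the open set `D` which coincides with `{v > 0}`
in `B`, with partial derivatives `p`, `q` on `D` satisfying `|∇v| ≤ C |z₂| ^ γ`. -/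
structure PlanarSolution (γ C : ℝ) (B D : Set (ℝ × ℝ)) (v p q : ℝ × ℝ → ℝ) : Prop where
  isOpen_dom : IsOpen B
  isOpen_pos : IsOpen D
  continuousOn : ContinuousOn v B
  nonneg : ∀ z ∈ B, 0 ≤ v z
  mem_iff : ∀ z ∈ B, z ∈ D ↔ 0 < v z
  hasFDerivAt : ∀ z ∈ D, HasFDerivAt v
    (p z • ContinuousLinearMap.fst ℝ ℝ ℝ + q z • ContinuousLinearMap.snd ℝ ℝ ℝ) z
  harmonic : ∀ z ∈ D, ∃ L M : ℝ × ℝ →L[ℝ] ℝ, HasFDerivAt p L z ∧ HasFDerivAt q M z ∧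
    L (1, 0) + M (0, 1) = 0
  bound : ∀ z ∈ D ∩ B, p z ^ 2 + q z ^ 2 ≤ (C * |z.2| ^ γ) ^ 2

/-- The closed rectangle `[-s,s] × [-T,T]`. -/
def rect (s T : ℝ) : Set (ℝ × ℝ) := Icc (-s) s ×ˢ Icc (-T) T

/-- `E` is a relatively open and closed part of the positivity set in `[-s,s] × [-T,T]` which does
not reach the horizontal sides. -/
structure ClopenPart (B D : Set (ℝ × ℝ)) (s T : ℝ) (E : Set (ℝ × ℝ)) : Prop where
  subset_rect : E ⊆ rect s T
  subset_pos : E ⊆ D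
  closure_subset : closure E ⊆ B
  isOpen_rel : ∀ z ∈ E, ∀ᶠ w in 𝓝[rect s T] z, w ∈ E
  isClosed_rel : closure E ∩ D ⊆ E
  lt_top : ∀ z ∈ E, |z.2| < T

lemma isCompact_rect (s T : ℝ) : IsCompact (rect s T) := isCompact_Icc.prod isCompact_Icc

/-- Truncation makes the flux inequality available at every abscissa below `s`, which is what turns
it into a differential inequality. -/
lemma ClopenPart.inter {B D E : Set (ℝ × ℝ)} {s T : ℝ} (h : ClopenPart B D s T E) {s' : ℝ}
    (hs : s' ≤ s) : ClopenPart B D s' T (E ∩ {z | |z.1| ≤ s'}) where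
  subset_rect z hz := ⟨abs_le.1 hz.2, (h.subset_rect hz.1).2⟩
  subset_pos z hz := h.subset_pos hz.1
  closure_subset := (closure_mono inter_subset_left).trans h.closure_subset
  isOpen_rel z hz := by
    have hsub : rect s' T ⊆ rect s T := prod_mono (Icc_subset_Icc (by linarith) hs) le_rfl
    filter_upwards [nhdsWithin_mono z hsub (h.isOpen_rel z hz.1), self_mem_nhdsWithin] with w hw hw'
    exact ⟨hw, abs_le.2 hw'.1⟩
  isClosed_rel z hz := by
    refine ⟨h.isClosed_rel ⟨closure_mono inter_subset_left hz.1, hz.2⟩, ?_⟩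
    have : IsClosed {z : ℝ × ℝ | |z.1| ≤ s'} := isClosed_le (by fun_prop) (by fun_prop)
    exact this.closure_subset (closure_mono inter_subset_right hz.1)
  lt_top z hz := h.lt_top z hz.1

section
variable {γ C s T : ℝ} {B D E : Set (ℝ × ℝ)} {v p q : ℝ × ℝ → ℝ}

lemma PlanarSolution.eq_zero (S : PlanarSolution γ C B D v p q) {z : ℝ × ℝ} (hz : z ∈ B)
    (hD : z ∉ D) : v z = 0 :=
  le_antisymm (not_lt.1 fun h => hD ((S.mem_iff z hz).2 h)) (S.nonneg z hz)

lemma PlanarSolution.continuousOn_p (S : PlanarSolution γ C B D v p q) : ContinuousOn p D :=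
  fun z hz => by
    obtain ⟨L, M, hL, -, -⟩ := S.harmonic z hz
    exact hL.continuousAt.continuousWithinAt

lemma PlanarSolution.continuousOn_q (S : PlanarSolution γ C B D v p q) : ContinuousOn q D :=
  fun z hz => by
    obtain ⟨L, M, -, hM, -⟩ := S.harmonic z hz
    exact hM.continuousAt.continuousWithinAt

/-- Outside `E`, points of `E` near `z` carry small values of `v`. -/
lemma ClopenPart.eventually_small (hE : ClopenPart B D s T E) (S : PlanarSolution γ C B D v p q)
    {δ : ℝ} (hδ : 0 < δ) {z : ℝ × ℝ} (hz : z ∉ E) : ∀ᶠ w in 𝓝 z, w ∈ E → v w < δ := by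
  by_cases hc : z ∈ closure E
  · have hzB := hE.closure_subset hc
    have hzD : z ∉ D := fun h => hz (hE.isClosed_rel ⟨hc, h⟩)
    have h0 := S.eq_zero hzB hzD
    have : ContinuousAt v z := S.continuousOn.continuousAt (S.isOpen_dom.mem_nhds hzB)
    have h1 : ∀ᶠ w in 𝓝 z, v w < δ := this.eventually (gt_mem_nhds (by rw [h0]; exact hδ))
    exact h1.mono fun w hw _ => hw
  · have : ∀ᶠ w in 𝓝 z, w ∈ (closure E)ᶜ := isClosed_closure.isOpen_compl.mem_nhds hc
    exact this.mono fun w hw hw' => absurd (subset_closure hw') hw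

/-- Cutting off by a function of `v` vanishing for small values makes continuous functions on `D`
extend by zero from `E`. -/
lemma ClopenPart.continuousOn_ite (hE : ClopenPart B D s T E) (S : PlanarSolution γ C B D v p q)
    {δ : ℝ} (hδ : 0 < δ) {θ : ℝ → ℝ} (hθ : Continuous θ) (hθ0 : ∀ τ < δ, θ τ = 0)
    {g : ℝ × ℝ → ℝ} (hg : ContinuousOn g D) [∀ z, Decidable (z ∈ E)] :
    ContinuousOn (fun z => if z ∈ E then θ (v z) * g z else 0) (rect s T) := by
  intro z hz
  by_cases hzE : z ∈ E
  · have hzD := hE.subset_pos hzE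
    have h1 : ContinuousAt (fun z => θ (v z) * g z) z :=
      (hθ.continuousAt.comp (S.hasFDerivAt z hzD).continuousAt).mul
        (hg.continuousAt (S.isOpen_pos.mem_nhds hzD))
    refine h1.continuousWithinAt.congr_of_eventuallyEq ?_ (by simp [hzE])
    filter_upwards [hE.isOpen_rel z hzE] with w hw
    simp [hw]
  · refine ContinuousAt.continuousWithinAt ?_
    refine (continuousAt_const (y := (0 : ℝ))).congr ?_
    filter_upwards [hE.eventually_small S hδ hzE] with w hw
    by_cases hwE : w ∈ E
    · simp [hwE, hθ0 _ (hw hwE)]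
    · simp [hwE]

open Classical in
/-- The energy density of `ψ(v)` in `E`, with `θ = ψ'`. -/
noncomputable def energy (E : Set (ℝ × ℝ)) (v p q : ℝ × ℝ → ℝ) (θ : ℝ → ℝ) (z : ℝ × ℝ) : ℝ :=
  if z ∈ E then θ (v z) * (p z ^ 2 + q z ^ 2) else 0

lemma ClopenPart.continuousOn_energy (hE : ClopenPart B D s T E)
    (S : PlanarSolution γ C B D v p q)
    {δ : ℝ} (hδ : 0 < δ) {θ : ℝ → ℝ} (hθ : Continuous θ) (hθ0 : ∀ τ < δ, θ τ = 0) :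
    ContinuousOn (energy E v p q θ) (rect s T) := by
  classical
  exact hE.continuousOn_ite S hδ hθ hθ0 ((S.continuousOn_p.pow 2).add (S.continuousOn_q.pow 2))

/-! ### Divergence theorem and flux through the vertical sides -/

lemma integral_abs_rpow_indicator_le (hγ : 0 < γ) {η T : ℝ} (hη : 0 ≤ η) (hT : 0 ≤ T) {c : ℝ}
    (hc : 0 ≤ c) {f : ℝ → ℝ} (hf : ContinuousOn f (Icc (-T) T))
    (hle : ∀ t ∈ Icc (-T) T, f t ≤ c * |t| ^ γ) (h0 : ∀ t ∈ Icc (-T) T, η < |t| → f t ≤ 0) :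
    ∫ t in (-T)..T, f t ≤ 2 * c / (γ + 1) * η ^ (γ + 1) := by
  have hcont : Continuous fun t : ℝ => c * |t| ^ γ :=
    continuous_const.mul (continuous_abs.rpow_const fun _ => Or.inr hγ.le)
  have hind : IntegrableOn (fun t : ℝ => c * |t| ^ γ) (Icc (-η) η) :=
    hcont.continuousOn.integrableOn_compact isCompact_Icc
  have h1 : ∫ t in (-T)..T, f t ≤ ∫ t in Icc (-η) η, c * |t| ^ γ := by
    rw [intervalIntegral.integral_of_le (by linarith), ← integral_Icc_eq_integral_Ioc,
      ← integral_indicator measurableSet_Icc, ← integral_indicator measurableSet_Icc]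
    refine integral_mono ?_ ?_ ?_
    · exact (hf.integrableOn_compact isCompact_Icc).integrable_indicator measurableSet_Icc
    · exact hind.integrable_indicator measurableSet_Icc
    · intro t
      have hnn : 0 ≤ c * |t| ^ γ := by positivity
      by_cases ht : t ∈ Icc (-T) T
      · rw [indicator_of_mem ht]
        by_cases ht' : t ∈ Icc (-η) η
        · rw [indicator_of_mem ht']; exact hle t ht
        · rw [indicator_of_notMem ht']
          exact h0 t ht (not_le.1 fun h => ht' (abs_le.1 h))
      · rw [indicator_of_notMem ht]
        exact indicator_nonneg (fun _ _ => by positivity) _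
  refine h1.trans (le_of_eq ?_)
  have h2 : ∫ t in (0)..η, c * |t| ^ γ = c / (γ + 1) * η ^ (γ + 1) := by
    have : ∫ t in (0)..η, c * |t| ^ γ = ∫ t in (0)..η, c * t ^ γ := by
      refine intervalIntegral.integral_congr fun t ht => ?_
      rw [uIcc_of_le hη] at ht
      simp only [abs_of_nonneg ht.1]
    rw [this, intervalIntegral.integral_const_mul, integral_rpow (Or.inl (by linarith)),
      Real.zero_rpow (by linarith)]
    ring
  have h3 : ∫ t in (-η)..0, c * |t| ^ γ = ∫ t in (0)..η, c * |t| ^ γ := by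
    have := intervalIntegral.integral_comp_neg (a := 0) (b := η) (fun t : ℝ => c * |t| ^ γ)
    simp only [abs_neg, neg_zero] at this
    exact this.symm
  rw [integral_Icc_eq_integral_Ioc, ← intervalIntegral.integral_of_le (by linarith),
    ← intervalIntegral.integral_add_adjacent_intervals (b := 0)
      (hcont.intervalIntegrable _ _) (hcont.intervalIntegrable _ _), h3, h2]
  ring

/-- The divergence theorem for `ψ(v)∇v` in `E`: the energy is at most the flux through the
vertical sides. -/
theorem ClopenPart.integral_energy_le (hE : ClopenPart B D s T E)
    (S : PlanarSolution γ C B D v p q) (hγ : 0 < γ) (hC : 0 ≤ C) (hs : 0 < s) (hT : 0 < T)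
    {δ : ℝ} (hδ : 0 < δ) {ψ θ : ℝ → ℝ} (hψ : ∀ τ, HasDerivAt ψ (θ τ) τ) (hθ : Continuous θ)
    (hψ0 : ∀ τ < δ, ψ τ = 0) (hθ0 : ∀ τ < δ, θ τ = 0) (hψ1 : ∀ τ, ψ τ ∈ Icc (0 : ℝ) 1)
    {η : ℝ} (hη : 0 ≤ η) (hη' : ∀ z ∈ E, |z.1| = s → |z.2| ≤ η) :
    ∫ z in rect s T, energy E v p q θ z ≤ 4 * C / (γ + 1) * η ^ (γ + 1) := by
  classical
  have hψc : Continuous ψ := continuous_iff_continuousAt.2 fun τ => (hψ τ).continuousAt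
  set F : ℝ × ℝ → ℝ := fun z => if z ∈ E then ψ (v z) * p z else 0 with hF
  set G : ℝ × ℝ → ℝ := fun z => if z ∈ E then ψ (v z) * q z else 0 with hG
  have hFc : ContinuousOn F (rect s T) := hE.continuousOn_ite S hδ hψc hψ0 S.continuousOn_p
  have hGc : ContinuousOn G (rect s T) := hE.continuousOn_ite S hδ hψc hψ0 S.continuousOn_q
  have hec := hE.continuousOn_energy S hδ hθ hθ0
  -- On `E` the product rule leaves only θ(v)|∇v|², since the term ψ(v)Δv vanishes. Off `E` the
  -- field is zero in a full neighbourhood: at points of `closure E` outside `D` one has v = 0, and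
  -- ψ kills small values.
  have key : ∀ z ∈ Ioo (-s) s ×ˢ Ioo (-T) T, ∃ L M : ℝ × ℝ →L[ℝ] ℝ,
      HasFDerivAt F L z ∧ HasFDerivAt G M z ∧ L (1, 0) + M (0, 1) = energy E v p q θ z := by
    intro z hz
    have hnhds : rect s T ∈ 𝓝 z := prod_mem_nhds (Icc_mem_nhds hz.1.1 hz.1.2)
      (Icc_mem_nhds hz.2.1 hz.2.2)
    by_cases hzE : z ∈ E
    · obtain ⟨L, M, hL, hM, h0⟩ := S.harmonic z (hE.subset_pos hzE)
      have hv := S.hasFDerivAt z (hE.subset_pos hzE)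
      have hψv := (hψ (v z)).comp_hasFDerivAt z hv
      have hev : ∀ᶠ w in 𝓝 z, w ∈ E := by
        have := hE.isOpen_rel z hzE
        rwa [nhdsWithin_eq_nhds.2 hnhds] at this
      refine ⟨_, _, (hψv.mul hL).congr_of_eventuallyEq (hev.mono fun w hw => by simp [hF, hw]),
        (hψv.mul hM).congr_of_eventuallyEq (hev.mono fun w hw => by simp [hG, hw]), ?_⟩
      have h0' : M (0, 1) = - L (1, 0) := by linarith
      simp [energy, hzE, h0']
      ring
    · have hev := hE.eventually_small S hδ hzE
      refine ⟨0, 0, (hasFDerivAt_const (0 : ℝ) z).congr_of_eventuallyEq (hev.mono fun w hw => ?_),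
        (hasFDerivAt_const (0 : ℝ) z).congr_of_eventuallyEq (hev.mono fun w hw => ?_), ?_⟩
      · by_cases hwE : w ∈ E
        · simp [hF, hwE, hψ0 _ (hw hwE)]
        · simp [hF, hwE]
      · by_cases hwE : w ∈ E
        · simp [hG, hwE, hψ0 _ (hw hwE)]
        · simp [hG, hwE]
      · simp [energy, hzE]
  choose! L M hL hM hLM using key
  have hrect : Icc ((-s, -T) : ℝ × ℝ) (s, T) = rect s T := (Icc_prod_eq _ _)
  have hae : ∀ᵐ z ∂(volume.restrict (rect s T)), z ∈ Ioo (-s) s ×ˢ Ioo (-T) T := by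
    have h : (Ioo (-s) s ×ˢ Ioo (-T) T : Set (ℝ × ℝ)) =ᵐ[volume] rect s T :=
      Measure.set_prod_ae_eq Ioo_ae_eq_Icc Ioo_ae_eq_Icc
    rw [← Measure.restrict_congr_set h]
    exact ae_restrict_mem (measurableSet_Ioo.prod measurableSet_Ioo)
  have haeq : (fun z => energy E v p q θ z) =ᵐ[volume.restrict (rect s T)]
      fun z => L z (1, 0) + M z (0, 1) := hae.mono fun z hz => (hLM z hz).symm
  have hint : IntegrableOn (energy E v p q θ) (rect s T) :=
    hec.integrableOn_compact (isCompact_rect s T)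
  have hdiv := integral_divergence_prod_Icc_of_hasFDerivAt_off_countable_of_le F G L M
    (-s, -T) (s, T) ⟨by simp only; linarith, by simp only; linarith⟩ ∅ countable_empty
    (by rwa [hrect]) (by rwa [hrect]) (fun z hz => hL z hz.1) (fun z hz => hM z hz.1)
    (by rw [hrect]; exact hint.congr haeq)
  rw [hrect, ← integral_congr_ae haeq] at hdiv
  rw [hdiv]
  -- The horizontal sides carry no flux because `E` stays strictly between them.
  have hGT : ∀ x, G (x, T) = 0 := fun x => by
    have : (x, T) ∉ E := fun h => by
      have := hE.lt_top _ h
      simp only [abs_of_pos hT] at this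
      exact lt_irrefl _ this
    simp [hG, this]
  have hGT' : ∀ x, G (x, -T) = 0 := fun x => by
    have : (x, -T) ∉ E := fun h => by
      have := hE.lt_top _ h
      simp only [abs_neg, abs_of_pos hT] at this
      exact lt_irrefl _ this
    simp [hG, this]
  have hFle : ∀ z, |F z| ≤ C * |z.2| ^ γ := by
    intro z
    have hnn : 0 ≤ C * |z.2| ^ γ := by positivity
    by_cases hzE : z ∈ E
    · have hb := S.bound z ⟨hE.subset_pos hzE, hE.closure_subset (subset_closure hzE)⟩
      have hp : |p z| ≤ C * |z.2| ^ γ := abs_le_of_sq_le_sq (by nlinarith [sq_nonneg (q z)]) hnn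
      simp only [hF, hzE, if_true, abs_mul, abs_of_nonneg (hψ1 (v z)).1]
      calc ψ (v z) * |p z| ≤ 1 * |p z| := by gcongr; exact (hψ1 _).2
        _ ≤ _ := by rw [one_mul]; exact hp
    · simpa [hF, hzE] using hnn
  have hside : ∀ x, |x| = s → ∀ t, η < |t| → F (x, t) = 0 := fun x hx t ht => by
    have : (x, t) ∉ E := fun h => not_lt.2 (hη' _ h hx) ht
    simp [hF, this]
  have hcol : ∀ x, |x| = s → ContinuousOn (fun t => F (x, t)) (Icc (-T) T) := fun x hx =>
    hFc.comp (by fun_prop) fun t ht => ⟨abs_le.1 hx.le, ht⟩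
  have h1 : ∫ t in (-T)..T, F (s, t) ≤ 2 * C / (γ + 1) * η ^ (γ + 1) :=
    integral_abs_rpow_indicator_le hγ hη hT.le hC (hcol s (abs_of_pos hs))
      (fun t _ => (le_abs_self _).trans (hFle (s, t)))
      (fun t _ ht => (hside s (abs_of_pos hs) t ht).le)
  have h2 : ∫ t in (-T)..T, - F (-s, t) ≤ 2 * C / (γ + 1) * η ^ (γ + 1) :=
    integral_abs_rpow_indicator_le hγ hη hT.le hC
      (hcol (-s) (by rw [abs_neg, abs_of_pos hs])).neg
      (fun t _ => (neg_le_abs _).trans (hFle (-s, t)))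
      (fun t _ ht => by rw [hside (-s) (by rw [abs_neg, abs_of_pos hs]) t ht, neg_zero])
  rw [intervalIntegral.integral_neg] at h2
  simp only [hGT, hGT', intervalIntegral.integral_zero]
  have : 4 * C / (γ + 1) * η ^ (γ + 1) = 2 * C / (γ + 1) * η ^ (γ + 1)
    + 2 * C / (γ + 1) * η ^ (γ + 1) := by ring
  linarith

end
-- Smooth steps and the energy on a vertical slice
lemma monotone_smoothTransition : Monotone Real.smoothTransition := by
  intro x y hxy
  have hx := Real.smoothTransition.pos_denom x
  have hy := Real.smoothTransition.pos_denom y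
  unfold Real.smoothTransition
  rw [div_le_div_iff₀ hx hy]
  have h1 := expNegInvGlue.monotone hxy
  have h2 : expNegInvGlue (1 - y) ≤ expNegInvGlue (1 - x) :=
    expNegInvGlue.monotone (by linarith)
  have := mul_le_mul h1 h2 (expNegInvGlue.nonneg _) (expNegInvGlue.nonneg _)
  nlinarith

lemma contDiff_smoothTransition : ContDiff ℝ ∞ Real.smoothTransition :=
  Real.smoothTransition.contDiff (n := ⊤)

lemma hasDerivAt_smoothTransition (τ : ℝ) :
    HasDerivAt Real.smoothTransition (deriv Real.smoothTransition τ) τ :=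
  (contDiff_smoothTransition.differentiable (by simp)).differentiableAt.hasDerivAt

lemma continuous_deriv_smoothTransition : Continuous (deriv Real.smoothTransition) :=
  contDiff_smoothTransition.continuous_deriv (by simp)

/-- A smooth step, `0` below `ε / 2` and `1` above `ε`. -/
noncomputable def step (ε τ : ℝ) : ℝ := Real.smoothTransition (2 / ε * τ - 1)

/-- The derivative of `step ε`. -/
noncomputable def stepDeriv (ε τ : ℝ) : ℝ := deriv Real.smoothTransition (2 / ε * τ - 1) * (2 / ε)

lemma hasDerivAt_step (ε τ : ℝ) : HasDerivAt (step ε) (stepDeriv ε τ) τ := by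
  have h : HasDerivAt (fun τ : ℝ => 2 / ε * τ - 1) (2 / ε) τ := by
    simpa using ((hasDerivAt_id τ).const_mul (2 / ε)).sub_const 1
  exact (hasDerivAt_smoothTransition _).comp τ h

lemma continuous_stepDeriv (ε : ℝ) : Continuous (stepDeriv ε) :=
  (continuous_deriv_smoothTransition.comp (by fun_prop)).mul continuous_const

lemma step_eq_zero {ε τ : ℝ} (hε : 0 < ε) (h : τ < ε / 2) : step ε τ = 0 := by
  refine Real.smoothTransition.zero_of_nonpos ?_
  have : 2 / ε * τ ≤ 2 / ε * (ε / 2) := by gcongr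
  have h2 : 2 / ε * (ε / 2) = 1 := by field_simp
  linarith

lemma step_eq_one {ε τ : ℝ} (hε : 0 < ε) (h : ε ≤ τ) : step ε τ = 1 := by
  refine Real.smoothTransition.one_of_one_le ?_
  have : 2 / ε * ε ≤ 2 / ε * τ := by gcongr
  have h2 : 2 / ε * ε = 2 := by field_simp
  linarith

lemma stepDeriv_eq_zero {ε τ : ℝ} (hε : 0 < ε) (h : τ < ε / 2) : stepDeriv ε τ = 0 := by
  have h1 : step ε =ᶠ[𝓝 τ] fun _ => 0 :=
    (show ∀ᶠ w in 𝓝 τ, w < ε / 2 from gt_mem_nhds h).mono fun w hw => step_eq_zero hε hw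
  exact (hasDerivAt_step ε τ).unique ((hasDerivAt_const τ (0 : ℝ)).congr_of_eventuallyEq h1)

lemma stepDeriv_nonneg {ε : ℝ} (hε : 0 < ε) (τ : ℝ) : 0 ≤ stepDeriv ε τ :=
  mul_nonneg monotone_smoothTransition.deriv_nonneg (by positivity)

lemma step_mem_Icc (ε τ : ℝ) : step ε τ ∈ Icc (0 : ℝ) 1 :=
  ⟨Real.smoothTransition.nonneg _, Real.smoothTransition.le_one _⟩

/-- Lower bound of the one-dimensional energy of `step ε ∘ f` near a zero of `f`. -/
lemma eventually_le_lintegral_stepDeriv {a b c m : ℝ} (hab : a < b) {f f' G : ℝ → ℝ}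
    (hf : ∀ t ∈ Ico a b, HasDerivAt f (f' t) t) (hf' : ContinuousOn f' (Ico a b))
    (hpos : ∀ t ∈ Ico a b, 0 < f t) (h0 : Tendsto f (𝓝[<] b) (𝓝 0))
    (hG : ∀ t ∈ Ico a b, f' t ^ 2 ≤ G t) (hm : Tendsto (fun t => √(G t)) (𝓝[<] b) (𝓝 m))
    (hc0 : 0 ≤ c) (hcm : c < m) :
    ∀ᶠ ε in 𝓝[>] (0 : ℝ),
      ENNReal.ofReal c ≤ ∫⁻ t in Ico a b, ENNReal.ofReal (stepDeriv ε (f t) * G t) := by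
  have hev : ∀ᶠ t in 𝓝[<] b, c < √(G t) ∧ t ∈ Ico a b :=
    (hm.eventually (lt_mem_nhds hcm)).and (Ico_mem_nhdsLT hab)
  obtain ⟨a', ha'b, ha'⟩ := (mem_nhdsLT_iff_exists_Ico_subset).1 hev
  have ha'm : a' ∈ Ico a' b := ⟨le_rfl, ha'b⟩
  have hsub : Ico a' b ⊆ Ico a b := fun t ht => (ha' ht).2
  have hpa : 0 < f a' := hpos a' (hsub ha'm)
  filter_upwards [Ioo_mem_nhdsGT hpa] with ε hε
  have hev2 : ∀ᶠ t in 𝓝[<] b, f t < ε / 2 ∧ t ∈ Ico a' b :=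
    (h0.eventually (gt_mem_nhds (half_pos hε.1))).and (Ico_mem_nhdsLT ha'b)
  obtain ⟨d, hd, hdm⟩ := hev2.exists
  -- Between `a'` and `d` the function `f` passes from above ε to below ε/2, so `step ε ∘ f` drops
  -- from 1 to 0, while √G stays above `c`.
  have hsub' : Icc a' d ⊆ Ico a' b := fun t ht => ⟨ht.1, ht.2.trans_lt hdm.2⟩
  have hfc : ContinuousOn f (Icc a' d) := fun t ht =>
    (hf t (hsub (hsub' ht))).continuousAt.continuousWithinAt
  have hgc : ContinuousOn (fun t => stepDeriv ε (f t) * f' t) (Icc a' d) :=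
    ((continuous_stepDeriv ε).comp_continuousOn hfc).mul (hf'.mono (hsub'.trans hsub))
  have hint : ∫ t in a'..d, stepDeriv ε (f t) * f' t = -1 := by
    rw [intervalIntegral.integral_eq_sub_of_hasDerivAt (f := fun t => step ε (f t))]
    · rw [step_eq_zero hε.1 hd, step_eq_one hε.1 hε.2.le]; norm_num
    · intro t ht
      rw [uIcc_of_le hdm.1] at ht
      exact (hasDerivAt_step ε (f t)).comp t (hf t (hsub (hsub' ht)))
    · rw [← uIcc_of_le hdm.1] at hgc
      exact hgc.intervalIntegrable
  rw [intervalIntegral.integral_of_le hdm.1, ← integral_Icc_eq_integral_Ioc] at hint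
  have h1 : ENNReal.ofReal c = ‖∫ t in Icc a' d, c * (stepDeriv ε (f t) * f' t)‖ₑ := by
    rw [integral_const_mul, hint, ← ofReal_norm]
    simp [abs_of_nonneg hc0]
  rw [h1]
  refine (enorm_integral_le_lintegral_enorm _).trans ?_
  refine (setLIntegral_mono' measurableSet_Icc fun t ht => ?_).trans
    (lintegral_mono_set (hsub'.trans hsub))
  rw [← ofReal_norm]
  refine ENNReal.ofReal_le_ofReal ?_
  have hs := stepDeriv_nonneg hε.1 (f t)
  have hG0 : 0 ≤ G t := (sq_nonneg _).trans (hG t (hsub (hsub' ht)))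
  have h2 : |f' t| ≤ √(G t) := Real.abs_le_sqrt (hG t (hsub (hsub' ht)))
  have h3 : c ≤ √(G t) := (ha' (hsub' ht)).1.le
  rw [Real.norm_eq_abs, abs_mul, abs_mul, abs_of_nonneg hc0, abs_of_nonneg hs]
  -- One factor √G dominates `c` and the other dominates |f'|, so the total variation 1 of `step ε ∘
  -- f` is converted into energy at least `c`.
  calc c * (stepDeriv ε (f t) * |f' t|) = stepDeriv ε (f t) * (c * |f' t|) := by ring
    _ ≤ stepDeriv ε (f t) * (√(G t) * √(G t)) := by gcongr
    _ = _ := by rw [Real.mul_self_sqrt hG0]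

section
variable {γ C s T : ℝ} {B D E : Set (ℝ × ℝ)} {v p q : ℝ × ℝ → ℝ}

/-- At free boundary points on the vertical line over `σ` the gradient attains its prescribed
value. -/
def RegularAbscissa (γ : ℝ) (B D : Set (ℝ × ℝ)) (p q : ℝ × ℝ → ℝ) (σ : ℝ) : Prop :=
  ∀ t ≠ 0, (σ, t) ∈ B → (σ, t) ∈ closure D → (σ, t) ∉ D →
    Tendsto (fun z => √(p z ^ 2 + q z ^ 2)) (𝓝[D] (σ, t)) (𝓝 (|t| ^ γ))

/-- Moving vertically away from the axis, the ray from the given point of `E` first leaves `E` at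
some height b > t₀, at a free boundary point. There v = 0 and |∇v| tends to b^γ > c, so the
one-dimensional estimate applies on [t₀, b). The sign `e` treats both half-planes at once. -/
lemma ClopenPart.eventually_le_lintegral_slice (hE : ClopenPart B D s T E)
    (S : PlanarSolution γ C B D v p q) (hγ : 0 < γ) {σ t₀ e : ℝ} (he : e = 1 ∨ e = -1)
    (hσ : RegularAbscissa γ B D p q σ) (ht₀ : 0 < t₀) (hz : (σ, e * t₀) ∈ E) {c : ℝ}
    (hc0 : 0 ≤ c) (hc : c < t₀ ^ γ) :
    ∀ᶠ ε in 𝓝[>] (0 : ℝ), ENNReal.ofReal c ≤ ∫⁻ t in Icc (-T) T,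
      ENNReal.ofReal (energy E v p q (stepDeriv ε) (σ, t)) := by
  have he2 : e * e = 1 := by rcases he with rfl | rfl <;> norm_num
  have habs : ∀ t : ℝ, |e * t| = |t| := fun t => by
    rcases he with rfl | rfl <;> simp
  have hσs : σ ∈ Icc (-s) s := (hE.subset_rect hz).1
  have hT0 : t₀ < T := by
    have := hE.lt_top _ hz
    simpa [habs, abs_of_pos ht₀] using this
  set g : ℝ → ℝ × ℝ := fun t => (σ, e * t) with hg
  have hgc : Continuous g := by fun_prop
  have hgr : ∀ t ∈ Icc t₀ T, g t ∈ rect s T := fun t ht =>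
    ⟨hσs, abs_le.1 (by rw [habs, abs_of_pos (ht₀.trans_le ht.1)]; exact ht.2)⟩
  -- the first point after `t₀` outside `E`
  have hclosed : IsClosed {t | t ∈ Icc t₀ T ∧ g t ∉ E} := by
    rw [← isOpen_compl_iff, isOpen_iff_mem_nhds]
    intro t ht
    by_cases htI : t ∈ Icc t₀ T
    · have htE : g t ∈ E := by
        by_contra h
        exact ht ⟨htI, h⟩
      have h1 := hE.isOpen_rel _ htE
      rw [eventually_nhdsWithin_iff] at h1
      filter_upwards [hgc.continuousAt.eventually h1] with w hw hw'
      exact hw'.2 (hw (hgr w hw'.1))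
    · filter_upwards [isClosed_Icc.isOpen_compl.mem_nhds htI] with w hw hw'
      exact hw hw'.1
  -- The ray does leave `E`: height `T` is never attained.
  have hne : ({t | t ∈ Icc t₀ T ∧ g t ∉ E}).Nonempty := ⟨T, ⟨hT0.le, le_rfl⟩, fun h => by
    have := hE.lt_top _ h
    simp only [hg, habs] at this
    rw [abs_of_pos (ht₀.trans hT0)] at this
    exact lt_irrefl _ this⟩
  have hcpt : IsCompact {t | t ∈ Icc t₀ T ∧ g t ∉ E} :=
    isCompact_Icc.of_isClosed_subset hclosed fun t ht => ht.1
  obtain ⟨b, ⟨hbI, hbE⟩, hbmin⟩ := hcpt.exists_isLeast hne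
  have hin : ∀ t ∈ Ico t₀ b, g t ∈ E := fun t ht => by
    by_contra h
    exact not_le.2 ht.2 (hbmin ⟨⟨ht.1, ht.2.le.trans hbI.2⟩, h⟩)
  have htb : t₀ < b := lt_of_le_of_ne hbI.1 fun h => hbE (h ▸ hz)
  have hb0 : 0 < b := ht₀.trans htb
  have hgE : Tendsto g (𝓝[<] b) (𝓝[E] (g b)) := by
    refine tendsto_nhdsWithin_iff.2 ⟨hgc.continuousAt.mono_left nhdsWithin_le_nhds, ?_⟩
    filter_upwards [Ico_mem_nhdsLT htb] with t ht using hin t ht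
  have hcl : g b ∈ closure E := mem_closure_iff_nhdsWithin_neBot.2 (hgE.neBot)
  have hbB := hE.closure_subset hcl
  -- By relative closedness, a limit point of `E` lying in `D` would still belong to `E`.
  have hbD : g b ∉ D := fun h => hbE (hE.isClosed_rel ⟨hcl, h⟩)
  have hgrad := hσ (e * b) (by rcases he with rfl | rfl <;> simp [hb0.ne']) hbB
    (closure_mono hE.subset_pos hcl) hbD
  rw [habs, abs_of_pos hb0] at hgrad
  have hgrad' := hgrad.comp (hgE.mono_right (nhdsWithin_mono _ hE.subset_pos))
  have hv0 : Tendsto (fun t => v (g t)) (𝓝[<] b) (𝓝 0) := by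
    have h1 : ContinuousAt v (g b) := S.continuousOn.continuousAt (S.isOpen_dom.mem_nhds hbB)
    have h2 := h1.tendsto.comp (hgc.continuousAt.mono_left (nhdsWithin_le_nhds (s := Iio b)))
    rwa [S.eq_zero hbB hbD] at h2
  have hcb : c < b ^ γ := hc.trans_le (Real.rpow_le_rpow ht₀.le htb.le hγ.le)
  have key := eventually_le_lintegral_stepDeriv (a := t₀) (b := b) (c := c) (m := b ^ γ) htb
    (f := fun t => v (g t)) (f' := fun t => q (g t) * e)
    (G := fun t => p (g t) ^ 2 + q (g t) ^ 2) (fun t ht => by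
      have h1 := S.hasFDerivAt _ (hE.subset_pos (hin t ht))
      have h2 : HasDerivAt g ((0 : ℝ), e) t := by
        refine (hasDerivAt_const t σ).prodMk ?_
        simpa using (hasDerivAt_id t).const_mul e
      have h3 := h1.comp_hasDerivAt t h2
      have h4 : HasDerivAt (v ∘ g) (q (g t) * e) t := h3.congr_deriv (by simp)
      exact h4)
    ((S.continuousOn_q.comp hgc.continuousOn fun t ht => hE.subset_pos (hin t ht)).mul
      continuousOn_const)
    (fun t ht => (S.mem_iff _ (hE.closure_subset (subset_closure (hin t ht)))).1
      (hE.subset_pos (hin t ht))) hv0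
    (fun t ht => by
      have : (q (g t) * e) ^ 2 = q (g t) ^ 2 := by rw [mul_pow, sq e, he2, mul_one]
      rw [this]; nlinarith [sq_nonneg (p (g t))]) hgrad' hc0 hcb
  filter_upwards [key, self_mem_nhdsWithin] with ε hε hεpos
  refine hε.trans ?_
  have h1 : ∫⁻ t in Ico t₀ b, ENNReal.ofReal (stepDeriv ε (v (g t)) * (p (g t) ^ 2 + q (g t) ^ 2))
      = ∫⁻ t in Ico t₀ b, ENNReal.ofReal (energy E v p q (stepDeriv ε) (g t)) :=
    setLIntegral_congr_fun measurableSet_Ico fun t ht => by simp [energy, hin t ht]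
  rw [h1]
  refine (lintegral_mono_set (t := Icc (-T) T) fun t ht =>
    ⟨by linarith [ht.1], ht.2.le.trans hbI.2⟩).trans (le_of_eq ?_)
  rcases he with rfl | rfl
  · simp [hg]
  · have := (Measure.measurePreserving_neg (volume : Measure ℝ)).setLIntegral_comp_preimage_emb
      (Homeomorph.neg ℝ).measurableEmbedding
      (fun t => ENNReal.ofReal (energy E v p q (stepDeriv ε) (σ, t))) (Icc (-T) T)
    rw [← this]
    simp [hg]

end
-- The differential inequality and linear growth of the height
/-- Growth from the integrated form of the differential inequality
`H' ≥ (H / K) ^ (γ / (γ + 1))`. -/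
lemma le_rpow_of_integral_le {γ K s : ℝ} (hγ : 0 < γ) (hK : 0 < K) (hs : 0 < s) {H : ℝ → ℝ}
    (hc : Continuous H) (hpos : ∀ t, 0 < t → 0 < H t)
    (hH : ∀ a b, 0 < a → a ≤ b → b ≤ s →
      ∫ t in a..b, (H t / K) ^ (γ / (γ + 1)) ≤ H b - H a) :
    s * (1 / (γ + 1) * (K ^ (γ / (γ + 1)))⁻¹) ≤ H s ^ (1 / (γ + 1)) := by
  set β := γ / (γ + 1) with hβ
  set k := 1 / (γ + 1) * (K ^ β)⁻¹ with hk
  have hβ0 : 0 < β := by positivity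
  have hwc : Continuous fun t => (H t / K) ^ β :=
    (hc.div_const K).rpow_const fun _ => Or.inr hβ0.le
  have main : ∀ a ∈ Ioo 0 s, (s - a) * k ≤ H s ^ (1 / (γ + 1)) := by
    intro a ha
    -- `H` need not be differentiable. `F` is a C¹ minorant with F(a) = H(a) and F' = (H/K)^β ≥
    -- (F/K)^β, so F^(1/(γ+1)) grows at rate at least `k`.
    set F : ℝ → ℝ := fun t => H a + ∫ τ in a..t, (H τ / K) ^ β with hF
    have hFd : ∀ t, HasDerivAt F ((H t / K) ^ β) t := fun t =>
      (intervalIntegral.integral_hasDerivAt_right (hwc.intervalIntegrable _ _)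
        (hwc.stronglyMeasurableAtFilter _ _) hwc.continuousAt).const_add _
    have hFpos : ∀ t, a ≤ t → 0 < F t := fun t ht => by
      have : 0 ≤ ∫ τ in a..t, (H τ / K) ^ β :=
        intervalIntegral.integral_nonneg ht fun τ hτ =>
          Real.rpow_nonneg (div_nonneg (hpos τ (ha.1.trans_le hτ.1)).le hK.le) _
      have := hpos a ha.1
      simp only [hF]; linarith
    have hFH : ∀ t ∈ Icc a s, F t ≤ H t := fun t ht => by
      have := hH a t ha.1 ht.1 ht.2
      simp only [hF]; linarith
    have hmd : ∀ t, a ≤ t → HasDerivAt (fun t => F t ^ (1 / (γ + 1)) - k * t)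
        ((H t / K) ^ β * (1 / (γ + 1)) * F t ^ (1 / (γ + 1) - 1) - k) t := fun t ht => by
      have h1 := (hFd t).rpow_const (p := 1 / (γ + 1)) (Or.inl (hFpos t ht).ne')
      have h5 : HasDerivAt (fun t => F t ^ (1 / (γ + 1)) - k * t)
          ((H t / K) ^ β * (1 / (γ + 1)) * F t ^ (1 / (γ + 1) - 1) - k * 1) t :=
        h1.sub ((hasDerivAt_id t).const_mul k)
      rwa [mul_one] at h5
    have hmono : MonotoneOn (fun t => F t ^ (1 / (γ + 1)) - k * t) (Icc a s) := by
      refine monotoneOn_of_deriv_nonneg (convex_Icc a s)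
        (fun t ht => (hmd t ht.1).continuousAt.continuousWithinAt)
        (fun t ht => ?_) (fun t ht => ?_)
      · rw [interior_Icc] at ht
        exact (hmd t ht.1.le).differentiableAt.differentiableWithinAt
      · rw [interior_Icc] at ht
        rw [(hmd t ht.1.le).deriv, sub_nonneg]
        have hF0 := hFpos t ht.1.le
        have he : 1 / (γ + 1) - 1 = -β := by rw [hβ]; field_simp; ring
        rw [he, Real.rpow_neg hF0.le]
        have h1 : (F t / K) ^ β ≤ (H t / K) ^ β :=
          Real.rpow_le_rpow (by positivity)
            (div_le_div_of_nonneg_right (hFH t ⟨ht.1.le, ht.2.le⟩) hK.le) hβ0.le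
        rw [Real.div_rpow hF0.le hK.le] at h1
        have h2 : 0 < F t ^ β := Real.rpow_pos_of_pos hF0 _
        calc k = F t ^ β / K ^ β * (1 / (γ + 1)) * (F t ^ β)⁻¹ := by
              rw [hk]; field_simp
          _ ≤ _ := by gcongr
    have h1 := hmono ⟨le_rfl, ha.2.le⟩ ⟨ha.2.le, le_rfl⟩ ha.2.le
    simp only at h1
    have h2 : 0 ≤ F a ^ (1 / (γ + 1)) := Real.rpow_nonneg (hFpos a le_rfl).le _
    have h3 : F s ^ (1 / (γ + 1)) ≤ H s ^ (1 / (γ + 1)) :=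
      Real.rpow_le_rpow (hFpos s ha.2.le).le (hFH s ⟨ha.2.le, le_rfl⟩) (by positivity)
    linarith
  -- Starting at a > 0 keeps `F` positive, so that its powers can be differentiated; then a → 0.
  have hlim : Tendsto (fun a => (s - a) * k) (𝓝[>] 0) (𝓝 ((s - 0) * k)) :=
    ((continuous_const.sub continuous_id).mul continuous_const).continuousAt.mono_left
      nhdsWithin_le_nhds
  rw [sub_zero] at hlim
  exact le_of_tendsto hlim ((Ioo_mem_nhdsGT hs : Ioo 0 s ∈ 𝓝[>] (0 : ℝ)) |> fun h =>
    Filter.mem_of_superset h fun a ha => main a ha)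

/-- The height of `E` over the pair of abscissas `± σ`. -/
noncomputable def absHeight (E : Set (ℝ × ℝ)) (σ : ℝ) : ℝ :=
  sSup {t : ℝ | ∃ z ∈ E, |z.1| = σ ∧ t = |z.2|}

section
variable {γ C s T : ℝ} {B D E : Set (ℝ × ℝ)} {v p q : ℝ × ℝ → ℝ}

lemma ClopenPart.le_absHeight (hE : ClopenPart B D s T E) {z : ℝ × ℝ} (hz : z ∈ E) :
    |z.2| ≤ absHeight E |z.1| := by
  refine le_csSup ⟨T, ?_⟩ ⟨z, hz, rfl, rfl⟩
  rintro _ ⟨w, hw, -, rfl⟩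
  exact (hE.lt_top w hw).le

lemma absHeight_nonneg (E : Set (ℝ × ℝ)) (σ : ℝ) : 0 ≤ absHeight E σ := by
  refine Real.sSup_nonneg ?_
  rintro _ ⟨w, -, -, rfl⟩
  exact abs_nonneg _

lemma ClopenPart.absHeight_le (hE : ClopenPart B D s T E) (hT : 0 ≤ T) (σ : ℝ) :
    absHeight E σ ≤ T := by
  refine Real.sSup_le ?_ hT
  rintro _ ⟨w, hw, -, rfl⟩
  exact (hE.lt_top w hw).le

lemma absHeight_inter (E : Set (ℝ × ℝ)) {σ s' : ℝ} (h : σ ≤ s') :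
    absHeight (E ∩ {z | |z.1| ≤ s'}) σ = absHeight E σ := by
  unfold absHeight
  congr 1
  ext t
  constructor
  · rintro ⟨z, hz, h1, h2⟩
    exact ⟨z, hz.1, h1, h2⟩
  · rintro ⟨z, hz, h1, h2⟩
    exact ⟨z, ⟨hz, h1.trans_le h⟩, h1, h2⟩

/-- Folds the two half-lines together, because the height at σ may be attained over σ or over -σ
only. -/
lemma lintegral_Ioo_neg_eq (s : ℝ) {f : ℝ → ℝ≥0∞} (hf : Measurable f) :
    ∫⁻ σ in Ioo 0 s, (f σ + f (-σ)) ≤ ∫⁻ σ in Icc (-s) s, f σ := by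
  rw [lintegral_add_left hf]
  have h1 : ∫⁻ σ in Ioo 0 s, f (-σ) = ∫⁻ σ in Ioo (-s) 0, f σ := by
    have := (Measure.measurePreserving_neg (volume : Measure ℝ)).setLIntegral_comp_preimage_emb
      (Homeomorph.neg ℝ).measurableEmbedding f (Ioo (-s) 0)
    rw [← this]
    simp
  rw [h1, ← lintegral_union measurableSet_Ioo
    (Set.disjoint_left.2 fun x hx hx' => lt_asymm hx.1 hx'.2)]
  refine lintegral_mono_set ?_
  rintro x (hx | hx)
  · exact ⟨by linarith [hx.1, hx.2], hx.2.le⟩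
  · exact ⟨hx.1.le, by linarith [hx.1, hx.2]⟩

/-- The supremum need not be attained; taking the power 1/γ of `L` gives an honest upper bound for
`A`. The empty set is harmless since `sSup ∅ = 0` and γ > 0. -/
lemma ofReal_rpow_csSup_le {γ : ℝ} (hγ : 0 < γ) {A : Set ℝ} (hA : ∀ t ∈ A, 0 ≤ t) {L : ℝ≥0∞}
    (h : ∀ t ∈ A, 0 < t → ENNReal.ofReal (t ^ γ) ≤ L) : ENNReal.ofReal (sSup A ^ γ) ≤ L := by
  rcases eq_or_ne L ⊤ with rfl | hL
  · exact le_top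
  have h1 : sSup A ≤ L.toReal ^ γ⁻¹ := by
    refine Real.sSup_le (fun t ht => ?_) (by positivity)
    rcases (hA t ht).eq_or_lt with rfl | h0
    · positivity
    · rw [Real.le_rpow_inv_iff_of_pos h0.le (by positivity) hγ]
      exact (ENNReal.ofReal_le_iff_le_toReal hL).1 (h t ht h0)
  rw [ENNReal.ofReal_le_iff_le_toReal hL]
  calc sSup A ^ γ ≤ (L.toReal ^ γ⁻¹) ^ γ :=
        Real.rpow_le_rpow (Real.sSup_nonneg hA) h1 hγ.le
    _ = L.toReal := Real.rpow_inv_rpow (by positivity) hγ.ne'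

/-- The flux inequality for the height function. -/
theorem ClopenPart.lintegral_absHeight_le (hE : ClopenPart B D s T E)
    (S : PlanarSolution γ C B D v p q) (hγ : 0 < γ) (hC : 0 ≤ C) (hs : 0 < s) (hT : 0 < T)
    (hreg : ∀ᵐ σ, RegularAbscissa γ B D p q σ) :
    ∫⁻ σ in Ioo 0 s, ENNReal.ofReal (absHeight E σ ^ γ) ≤
      ENNReal.ofReal (4 * C / (γ + 1) * absHeight E s ^ (γ + 1)) := by
  classical
  set ε : ℕ → ℝ := fun n => 1 / ((n : ℝ) + 1) with hε
  have hεpos : ∀ n, 0 < ε n := fun n => by positivity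
  have hεlim : Tendsto ε atTop (𝓝[>] 0) :=
    tendsto_nhdsWithin_iff.2 ⟨tendsto_one_div_add_atTop_nhds_zero_nat, .of_forall hεpos⟩
  have hmr : MeasurableSet (rect s T) := (isCompact_rect s T).measurableSet
  set g : ℕ → ℝ × ℝ → ℝ≥0∞ := fun n => (rect s T).indicator
    fun z => ENNReal.ofReal (energy E v p q (stepDeriv (ε n)) z) with hg
  have hcont : ∀ n, ContinuousOn (energy E v p q (stepDeriv (ε n))) (rect s T) := fun n =>
    hE.continuousOn_energy S (half_pos (hεpos n)) (continuous_stepDeriv _)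
      fun τ hτ => stepDeriv_eq_zero (hεpos n) hτ
  have hgm : ∀ n, Measurable (g n) := fun n => by
    have h1 : Measurable ((rect s T).indicator (energy E v p q (stepDeriv (ε n)))) := by
      have := (hcont n).measurable_piecewise (g := 0) continuousOn_const hmr
      rwa [piecewise_eq_indicator] at this
    have h2 : (rect s T).indicator (fun z => ENNReal.ofReal (energy E v p q (stepDeriv (ε n)) z))
        = fun z => ENNReal.ofReal ((rect s T).indicator (energy E v p q (stepDeriv (ε n))) z) := by
      funext z
      by_cases hz : z ∈ rect s T <;> simp [hz]
    have h3 : g n = fun z => ENNReal.ofReal ((rect s T).indicator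
      (energy E v p q (stepDeriv (ε n))) z) := h2
    rw [h3]
    exact h1.ennreal_ofReal
  set F : ℕ → ℝ → ℝ≥0∞ := fun n σ => ∫⁻ t, g n (σ, t) with hF
  have hFm : ∀ n, Measurable (F n) := fun n => (hgm n).lintegral_prod_right'
  have hbound : ∀ n, ∫⁻ σ in Icc (-s) s, F n σ ≤
      ENNReal.ofReal (4 * C / (γ + 1) * absHeight E s ^ (γ + 1)) := fun n => by
    have h1 := hE.integral_energy_le S hγ hC hs hT (half_pos (hεpos n))
      (hasDerivAt_step (ε n)) (continuous_stepDeriv _) (fun τ hτ => step_eq_zero (hεpos n) hτ)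
      (fun τ hτ => stepDeriv_eq_zero (hεpos n) hτ) (fun τ => step_mem_Icc _ _)
      (absHeight_nonneg E s) (fun z hz hzs => hzs ▸ hE.le_absHeight hz)
    have hnn : ∀ z, 0 ≤ energy E v p q (stepDeriv (ε n)) z := fun z => by
      unfold energy
      split_ifs
      · exact mul_nonneg (stepDeriv_nonneg (hεpos n) _) (by positivity)
      · exact le_rfl
    have h2 : ENNReal.ofReal (∫ z in rect s T, energy E v p q (stepDeriv (ε n)) z) =
        ∫⁻ z in rect s T, ENNReal.ofReal (energy E v p q (stepDeriv (ε n)) z) :=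
      ofReal_integral_eq_lintegral_ofReal ((hcont n).integrableOn_compact (isCompact_rect s T)) (.of_forall hnn)
    calc ∫⁻ σ in Icc (-s) s, F n σ ≤ ∫⁻ σ, F n σ := setLIntegral_le_lintegral _ _
      _ = ∫⁻ z, g n z := by
          rw [Measure.volume_eq_prod, lintegral_prod _ (hgm n).aemeasurable]
      _ = ENNReal.ofReal (∫ z in rect s T, energy E v p q (stepDeriv (ε n)) z) := by
          rw [h2, hg, lintegral_indicator hmr]
      _ ≤ _ := ENNReal.ofReal_le_ofReal h1
  have hpt : ∀ σ z, z ∈ E → z.1 = σ → z.2 ≠ 0 → RegularAbscissa γ B D p q σ →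
      ENNReal.ofReal (|z.2| ^ γ) ≤ liminf (fun n => F n σ) atTop := by
    intro σ z hz hzσ hz0 hσ
    have h0 : 0 < |z.2| := abs_pos.2 hz0
    -- The slice estimate holds only for constants strictly below |z₂|^γ, eventually in ε; the lower
    -- limit recovers the full power.
    refine ENNReal.le_of_forall_nnreal_lt fun c hc => ?_
    have hc' : (c : ℝ) < |z.2| ^ γ := by
      have := (ENNReal.lt_ofReal_iff_toReal_lt ENNReal.coe_ne_top).1 hc
      simpa using this
    obtain ⟨e, he, hez⟩ : ∃ e : ℝ, (e = 1 ∨ e = -1) ∧ e * |z.2| = z.2 := by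
      rcases le_total 0 z.2 with h | h
      · exact ⟨1, Or.inl rfl, by rw [abs_of_nonneg h, one_mul]⟩
      · exact ⟨-1, Or.inr rfl, by rw [abs_of_nonpos h]; ring⟩
    have hmem : (σ, e * |z.2|) ∈ E := by rw [hez, ← hzσ]; exact hz
    have key := hE.eventually_le_lintegral_slice S hγ he hσ h0 hmem c.2 hc'
    refine le_liminf_of_le (by isBoundedDefault) ?_
    filter_upwards [hεlim.eventually key] with n hn
    have hcc : (c : ℝ≥0∞) = ENNReal.ofReal (c : ℝ) := by simp
    rw [hcc]
    refine hn.trans (le_of_eq ?_)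
    rw [hF, ← lintegral_indicator measurableSet_Icc]
    refine lintegral_congr fun t => ?_
    have hσs : σ ∈ Icc (-s) s := hzσ ▸ (hE.subset_rect hz).1
    by_cases ht : t ∈ Icc (-T) T
    · have : (σ, t) ∈ rect s T := ⟨hσs, ht⟩
      simp [hg, ht, this]
    · have : (σ, t) ∉ rect s T := fun h => ht h.2
      simp [hg, ht, this]
  have hreg' : ∀ᵐ σ : ℝ, RegularAbscissa γ B D p q (-σ) :=
    (Measure.measurePreserving_neg (volume : Measure ℝ)).quasiMeasurePreserving.ae hreg
  calc ∫⁻ σ in Ioo 0 s, ENNReal.ofReal (absHeight E σ ^ γ)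
      ≤ ∫⁻ σ in Ioo 0 s, liminf (fun n => F n σ + F n (-σ)) atTop := by
        refine lintegral_mono_ae ?_
        filter_upwards [ae_restrict_of_ae hreg, ae_restrict_of_ae hreg',
          ae_restrict_mem measurableSet_Ioo] with σ h1 h2 hσ
        refine ofReal_rpow_csSup_le hγ (by rintro _ ⟨w, -, -, rfl⟩; exact abs_nonneg _) ?_
        rintro _ ⟨z, hz, hzσ, rfl⟩ hz0
        have hz0' : z.2 ≠ 0 := abs_pos.1 hz0
        rcases le_total 0 z.1 with h | h
        · rw [abs_of_nonneg h] at hzσ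
          exact (hpt σ z hz hzσ hz0' h1).trans
            (liminf_le_liminf (.of_forall fun n => le_self_add))
        · rw [abs_of_nonpos h] at hzσ
          exact (hpt (-σ) z hz (by linarith) hz0' h2).trans
            (liminf_le_liminf (.of_forall fun n => le_add_self))
    -- Fatou's lemma; the flux bound of the next step is uniform in ε.
    _ ≤ liminf (fun n => ∫⁻ σ in Ioo 0 s, (F n σ + F n (-σ))) atTop :=
        lintegral_liminf_le fun n => (hFm n).add ((hFm n).comp measurable_neg)
    _ ≤ _ := by
        refine liminf_le_of_le (by isBoundedDefault) fun b hb => ?_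
        obtain ⟨n, hn⟩ := hb.exists
        exact hn.trans ((lintegral_Ioo_neg_eq s (hFm n)).trans (hbound n))

/-- Linear growth of the height of a part of the positivity set touching the origin. -/
theorem ClopenPart.div_le_absHeight (hE : ClopenPart B D s T E)
    (S : PlanarSolution γ C B D v p q) (hγ : 0 < γ) (hC : 0 < C) (hs : 0 < s) (hT : 0 < T)
    (hreg : ∀ᵐ σ, RegularAbscissa γ B D p q σ) (h0 : (0 : ℝ × ℝ) ∈ closure E) :
    s / (4 * C) ≤ absHeight E s := by
  set h := absHeight E with hh
  set f : ℝ → ℝ≥0∞ := fun σ => ENNReal.ofReal (h σ ^ γ) with hf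
  -- The height function is not shown to be measurable, nor is this needed: the lower integral is
  -- additive over disjoint measurable domains for arbitrary integrands.
  set I : ℝ → ℝ≥0∞ := fun t => ∫⁻ σ in Ioc 0 t, f σ with hI
  set K := 4 * C / (γ + 1) with hK
  have hKpos : 0 < K := by positivity
  have hfT : ∀ σ, f σ ≤ ENNReal.ofReal (T ^ γ) := fun σ => ENNReal.ofReal_le_ofReal
    (Real.rpow_le_rpow (absHeight_nonneg _ _) (hE.absHeight_le hT.le σ) hγ.le)
  have hIab : ∀ a b, a ≤ b → ∫⁻ σ in Ioc a b, f σ ≤ ENNReal.ofReal (T ^ γ * (b - a)) := by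
    intro a b hab
    calc ∫⁻ σ in Ioc a b, f σ ≤ ∫⁻ σ in Ioc a b, ENNReal.ofReal (T ^ γ) := lintegral_mono hfT
      _ = _ := by
        rw [setLIntegral_const, Real.volume_Ioc, ENNReal.ofReal_mul (by positivity)]
  have hIfin : ∀ t, I t ≠ ⊤ := fun t => by
    rcases le_total 0 t with ht | ht
    · exact ((hIab 0 t ht).trans_lt ENNReal.ofReal_lt_top).ne
    · simp [hI, Ioc_eq_empty (not_lt.2 ht)]
  have hImono : Monotone I := fun a b hab => lintegral_mono_set (Ioc_subset_Ioc_right hab)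
  set H : ℝ → ℝ := fun t => (I t).toReal with hH
  have hHmono : Monotone H := fun a b hab => ENNReal.toReal_mono (hIfin b) (hImono hab)
  have hHlip : ∀ a b, a ≤ b → H b ≤ H a + T ^ γ * (b - a) := fun a b hab => by
    have h1 : I b ≤ I a + ENNReal.ofReal (T ^ γ * (b - a)) := by
      refine le_trans ?_ (add_le_add le_rfl (hIab a b hab))
      refine le_trans (lintegral_mono_set fun x hx => ?_) (lintegral_union_le _ _ _)
      rcases le_or_gt x a with hxa | hxa
      · exact Or.inl ⟨hx.1, hxa⟩
      · exact Or.inr ⟨hxa, hx.2⟩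
    have h2 := ENNReal.toReal_mono (ENNReal.add_ne_top.2 ⟨hIfin a, ENNReal.ofReal_ne_top⟩) h1
    rwa [ENNReal.toReal_add (hIfin a) ENNReal.ofReal_ne_top, ENNReal.toReal_ofReal
      (mul_nonneg (by positivity) (sub_nonneg.2 hab))] at h2
  have hHc : Continuous H := by
    refine (LipschitzWith.of_le_add_mul (Real.toNNReal (T ^ γ)) fun x y => ?_).continuous
    rw [Real.coe_toNNReal _ (by positivity), Real.dist_eq]
    rcases le_total x y with hxy | hxy
    · have := hHmono hxy
      have : 0 ≤ T ^ γ * |x - y| := by positivity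
      linarith
    · rw [abs_of_nonneg (sub_nonneg.2 hxy)]
      exact hHlip y x hxy
  -- flux inequality at every abscissa
  have hflux : ∀ t ∈ Ioc 0 s, H t ≤ K * h t ^ (γ + 1) := by
    intro t ht
    have h1 := (hE.inter ht.2).lintegral_absHeight_le S hγ hC.le ht.1 hT hreg
    rw [absHeight_inter E le_rfl] at h1
    have h2 : ∫⁻ σ in Ioo 0 t, ENNReal.ofReal (absHeight (E ∩ {z | |z.1| ≤ t}) σ ^ γ) = I t := by
      rw [hI]
      simp only
      rw [← setLIntegral_congr Ioo_ae_eq_Ioc]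
      refine setLIntegral_congr_fun measurableSet_Ioo fun σ hσ => ?_
      simp only [hf]
      rw [absHeight_inter E hσ.2.le]
    rw [h2] at h1
    exact ENNReal.toReal_le_of_le_ofReal
      (mul_nonneg hKpos.le (Real.rpow_nonneg (absHeight_nonneg _ _) _)) h1
  -- positivity
  have hHpos : ∀ t, 0 < t → 0 < H t := by
    intro t ht
    have hU : IsOpen {z : ℝ × ℝ | |z.1| < min t s} := isOpen_lt (by fun_prop) (by fun_prop)
    obtain ⟨z, hzU, hzE⟩ := mem_closure_iff.1 h0 _ hU (by simp [ht, hs])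
    simp only [mem_ofPred_eq, lt_min_iff] at hzU
    have hzT := hE.lt_top z hzE
    have hnhds : rect s T ∈ 𝓝 z := prod_mem_nhds
      (Icc_mem_nhds (abs_lt.1 hzU.2).1 (abs_lt.1 hzU.2).2)
      (Icc_mem_nhds (abs_lt.1 hzT).1 (abs_lt.1 hzT).2)
    have hEz : E ∈ 𝓝 z := by
      have := hE.isOpen_rel z hzE
      rwa [nhdsWithin_eq_nhds.2 hnhds] at this
    obtain ⟨U1, hU1, U2, hU2, hUE⟩ := mem_nhds_prod_iff.1 hEz
    obtain ⟨d, hd, hdU⟩ := Metric.mem_nhds_iff.1 hU1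
    -- The chosen point of `E` may lie on the axis. A neighbouring ordinate `t1 ≠ 0` inside the
    -- product neighbourhood gives a height bounded below by |t1| over an interval of abscissas.
    obtain ⟨t1, ht1, ht10⟩ : ∃ t1 ∈ U2, t1 ≠ 0 := by
      have : ({0}ᶜ : Set ℝ) ∈ 𝓝[≠] z.2 := by
        rcases eq_or_ne z.2 0 with h | h
        · rw [h]; exact self_mem_nhdsWithin
        · exact mem_nhdsWithin_of_mem_nhds (isOpen_compl_singleton.mem_nhds h)
      obtain ⟨t1, h1, h2⟩ := (Filter.inter_mem (mem_nhdsWithin_of_mem_nhds hU2) this : _ ∈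
        𝓝[≠] z.2) |> Filter.nonempty_of_mem
      exact ⟨t1, h1, h2⟩
    set a := |z.1| with ha
    have hlow : ∀ σ ∈ Ioo a (min t (a + d)), ENNReal.ofReal (|t1| ^ γ) ≤ f σ := by
      intro σ hσ
      have hσ0 : 0 ≤ σ := (abs_nonneg _).trans hσ.1.le
      obtain ⟨σ', hσ'U, hσ'⟩ : ∃ σ' ∈ U1, |σ'| = σ := by
        have h3 : σ < a + d := hσ.2.trans_le (min_le_right _ _)
        rcases le_total 0 z.1 with hz1 | hz1
        · refine ⟨σ, hdU ?_, abs_of_nonneg hσ0⟩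
          rw [Metric.mem_ball, Real.dist_eq, abs_lt]
          have : a = z.1 := abs_of_nonneg hz1
          constructor <;> linarith [hσ.1]
        · refine ⟨-σ, hdU ?_, by rw [abs_neg, abs_of_nonneg hσ0]⟩
          rw [Metric.mem_ball, Real.dist_eq, abs_lt]
          have : a = -z.1 := abs_of_nonpos hz1
          constructor <;> linarith [hσ.1]
      have hmem : (σ', t1) ∈ E := hUE ⟨hσ'U, ht1⟩
      have h4 := hE.le_absHeight hmem
      simp only [hσ'] at h4
      exact ENNReal.ofReal_le_ofReal (Real.rpow_le_rpow (abs_nonneg _) h4 hγ.le)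
    refine ENNReal.toReal_pos (ne_of_gt ?_) (hIfin t)
    have hlt : a < min t (a + d) := lt_min hzU.1 (by linarith)
    calc 0 < ENNReal.ofReal (|t1| ^ γ) * volume (Ioo a (min t (a + d))) := by
          refine ENNReal.mul_pos ?_ ?_
          · simp only [ne_eq, ENNReal.ofReal_eq_zero, not_le]
            have := abs_pos.2 ht10
            positivity
          · rw [Real.volume_Ioo]
            simp only [ne_eq, ENNReal.ofReal_eq_zero, not_le]
            linarith
      _ = ∫⁻ σ in Ioo a (min t (a + d)), ENNReal.ofReal (|t1| ^ γ) := by rw [setLIntegral_const]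
      _ ≤ ∫⁻ σ in Ioo a (min t (a + d)), f σ := setLIntegral_mono' measurableSet_Ioo hlow
      _ ≤ I t := lintegral_mono_set fun σ hσ =>
          ⟨(abs_nonneg _).trans_lt hσ.1, (hσ.2.trans_le (min_le_left _ _)).le⟩
  have hode : ∀ a b, 0 < a → a ≤ b → b ≤ s →
      ∫ t in a..b, (H t / K) ^ (γ / (γ + 1)) ≤ H b - H a := by
    intro a b ha hab hbs
    have hIadd : I b = I a + ∫⁻ σ in Ioc a b, f σ := by
      rw [hI]
      simp only
      rw [← lintegral_union measurableSet_Ioc (Ioc_disjoint_Ioc_of_le le_rfl),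
        Ioc_union_Ioc_eq_Ioc ha.le hab]
    have hfin : ∫⁻ σ in Ioc a b, f σ ≠ ⊤ := ((hIab a b hab).trans_lt ENNReal.ofReal_lt_top).ne
    have hsub : H b - H a = (∫⁻ σ in Ioc a b, f σ).toReal := by
      simp only [hH, hIadd, ENNReal.toReal_add (hIfin a) hfin]
      ring
    rw [hsub, intervalIntegral.integral_of_le hab]
    have hwc : Continuous fun t => (H t / K) ^ (γ / (γ + 1)) :=
      (hHc.div_const K).rpow_const fun _ => Or.inr (by positivity)
    have hwi : IntegrableOn (fun t => (H t / K) ^ (γ / (γ + 1))) (Ioc a b) :=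
      (hwc.integrableOn_Icc).mono_set Ioc_subset_Icc_self
    rw [← ENNReal.ofReal_le_iff_le_toReal hfin, ofReal_integral_eq_lintegral_ofReal hwi
      (.of_forall fun t => Real.rpow_nonneg (div_nonneg ENNReal.toReal_nonneg hKpos.le) _)]
    refine setLIntegral_mono' measurableSet_Ioc fun t ht => ENNReal.ofReal_le_ofReal ?_
    have ht0 : 0 < t := ha.trans ht.1
    have h1 := hflux t ⟨ht0, ht.2.trans hbs⟩
    have h2 : H t / K ≤ h t ^ (γ + 1) := by
      rw [div_le_iff₀ hKpos]; linarith
    calc (H t / K) ^ (γ / (γ + 1)) ≤ (h t ^ (γ + 1)) ^ (γ / (γ + 1)) :=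
          Real.rpow_le_rpow (div_nonneg (hHpos t ht0).le hKpos.le) h2 (by positivity)
      _ = h t ^ γ := by
          rw [← Real.rpow_mul (absHeight_nonneg _ _)]
          congr 1
          field_simp
  have hgrow := le_rpow_of_integral_le hγ hKpos hs hHc hHpos hode
  have h1 : H s ^ (1 / (γ + 1)) ≤ K ^ (1 / (γ + 1)) * h s := by
    calc H s ^ (1 / (γ + 1)) ≤ (K * h s ^ (γ + 1)) ^ (1 / (γ + 1)) :=
          Real.rpow_le_rpow (hHpos s hs).le (hflux s ⟨hs, le_rfl⟩) (by positivity)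
      _ = _ := by
          rw [Real.mul_rpow hKpos.le (Real.rpow_nonneg (absHeight_nonneg _ _) _),
            ← Real.rpow_mul (absHeight_nonneg _ _), mul_one_div_cancel (by positivity),
            Real.rpow_one]
  have h2 : K ^ (γ / (γ + 1)) * K ^ (1 / (γ + 1)) = K := by
    rw [← Real.rpow_add hKpos, ← add_div, div_self (by positivity), Real.rpow_one]
  have h3 : 0 < K ^ (γ / (γ + 1)) := Real.rpow_pos_of_pos hKpos _
  have h4 := hgrow.trans h1
  -- The two fractional powers of `K` multiply to `K`, and K(γ+1) = 4C; this is the source of the 4.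
  have h5 : s * (1 / (γ + 1)) ≤ K * h s := by
    have := mul_le_mul_of_nonneg_left h4 h3.le
    calc s * (1 / (γ + 1)) = K ^ (γ / (γ + 1)) * (s * (1 / (γ + 1) * (K ^ (γ / (γ + 1)))⁻¹)) := by
          field_simp
      _ ≤ _ := this
      _ = K * h s := by rw [← mul_assoc, h2]
  rw [div_le_iff₀ (by positivity)]
  rw [hK, div_mul_eq_mul_div, mul_one_div, div_le_div_iff_of_pos_right (by positivity)] at h5
  linarith

end
-- Covers of null sets and one-dimensional cutoffs
/-- A compact set of vanishing one-dimensional Hausdorff measure has finite covers by balls of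
arbitrarily small total radius. -/
lemma exists_finset_cover_of_hausdorffMeasure_eq_zero {X : Type*} [MetricSpace X]
    [MeasurableSpace X] [BorelSpace X] [Nonempty X] {A : Set X} (hA : IsCompact A)
    (h0 : Measure.hausdorffMeasure 1 A = 0) {δ : ℝ} (hδ : 0 < δ) :
    ∃ (I : Finset ℕ) (c : ℕ → X) (ρ : ℕ → ℝ), (∀ i, 0 < ρ i) ∧
      A ⊆ ⋃ i ∈ I, Metric.ball (c i) (ρ i) ∧ ∑ i ∈ I, ρ i ≤ δ := by
  classical
  rw [Measure.hausdorffMeasure_apply] at h0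
  have h1 : (⨅ (t : ℕ → Set X) (_ : A ⊆ ⋃ n, t n) (_ : ∀ n, Metric.ediam (t n) ≤ 1),
      ∑' n, ⨆ _ : (t n).Nonempty, Metric.ediam (t n) ^ (1 : ℝ)) = 0 := by
    refine le_antisymm ?_ (zero_le)
    rw [← h0]
    exact le_iSup₂ (f := fun (r : ℝ≥0∞) (_ : 0 < r) =>
      ⨅ (t : ℕ → Set X) (_ : A ⊆ ⋃ n, t n) (_ : ∀ n, Metric.ediam (t n) ≤ r),
      ∑' n, ⨆ _ : (t n).Nonempty, Metric.ediam (t n) ^ (1 : ℝ)) 1 one_pos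
  have h2 : (⨅ (t : ℕ → Set X) (_ : A ⊆ ⋃ n, t n) (_ : ∀ n, Metric.ediam (t n) ≤ 1),
      ∑' n, ⨆ _ : (t n).Nonempty, Metric.ediam (t n) ^ (1 : ℝ)) < ENNReal.ofReal (δ / 2) := by
    rw [h1]; simpa using hδ
  simp only [iInf_lt_iff] at h2
  obtain ⟨t, hcov, hdiam, hsum⟩ := h2
  have hch : ∀ n, ∃ x : X, (t n).Nonempty → x ∈ t n := fun n => by
    by_cases h : (t n).Nonempty
    · exact ⟨h.some, fun _ => h.some_mem⟩
    · exact ⟨Classical.arbitrary X, fun h' => absurd h' h⟩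
  choose c hc using hch
  -- Summable enlargements: they make every radius positive, even for sets of zero diameter, and
  -- cost only δ/2 in total.
  set w : ℕ → ℝ := fun n => δ / 2 / 2 / 2 ^ n with hw
  have hwpos : ∀ n, 0 < w n := fun n => by positivity
  have hwsum : HasSum w (δ / 2) := hasSum_geometric_two' (δ / 2)
  set d : ℕ → ℝ≥0∞ := fun n => ⨆ _ : (t n).Nonempty, Metric.ediam (t n) ^ (1 : ℝ) with hd
  have hdfin : ∀ n, d n ≠ ⊤ := fun n =>
    ((ENNReal.le_tsum n).trans_lt (hsum.trans ENNReal.ofReal_lt_top)).ne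
  have hball : ∀ n, t n ⊆ Metric.ball (c n) ((d n).toReal + w n) := by
    intro n x hx
    have hne : (t n).Nonempty := ⟨x, hx⟩
    have hdn : d n = Metric.ediam (t n) := by simp [hd, hne]
    have h3 : edist x (c n) ≤ d n := hdn ▸ Metric.edist_le_ediam_of_mem hx (hc n hne)
    rw [Metric.mem_ball, dist_edist]
    have := ENNReal.toReal_mono (hdfin n) h3
    linarith [hwpos n]
  have hcov' : A ⊆ ⋃ n, Metric.ball (c n) ((d n).toReal + w n) :=
    hcov.trans (iUnion_mono hball)
  obtain ⟨I, hI⟩ := hA.elim_finite_subcover _ (fun n => Metric.isOpen_ball) hcov'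
  refine ⟨I, c, fun n => (d n).toReal + w n, fun n => by
    have := hwpos n; positivity, hI, ?_⟩
  rw [Finset.sum_add_distrib]
  have h4 : ∑ i ∈ I, w i ≤ δ / 2 := sum_le_hasSum I (fun i _ => (hwpos i).le) hwsum
  have h5 : ∑ i ∈ I, (d i).toReal ≤ δ / 2 := by
    rw [← ENNReal.toReal_sum fun i _ => hdfin i]
    refine ENNReal.toReal_le_of_le_ofReal (by positivity) ((ENNReal.sum_le_tsum I).trans hsum.le)
  linarith

lemma exists_abs_deriv_smoothTransition_le :
    ∃ M : ℝ, 0 < M ∧ ∀ τ, |deriv Real.smoothTransition τ| ≤ M := by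
  obtain ⟨M, hM⟩ := (isCompact_Icc (a := (0 : ℝ)) (b := 1)).exists_bound_of_continuousOn
    continuous_deriv_smoothTransition.continuousOn
  refine ⟨max M 1, by positivity, fun τ => ?_⟩
  by_cases hτ : τ ∈ Icc (0 : ℝ) 1
  · exact (hM τ hτ).trans (le_max_left _ _)
  · have : deriv Real.smoothTransition τ = 0 := by
      rw [mem_Icc, not_and_or, not_le, not_le] at hτ
      rcases hτ with h | h
      · have h1 : Real.smoothTransition =ᶠ[𝓝 τ] fun _ => 0 :=
          (show ∀ᶠ w in 𝓝 τ, w < 0 from gt_mem_nhds h).mono fun w hw =>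
            Real.smoothTransition.zero_of_nonpos hw.le
        rw [h1.deriv_eq]; simp
      · have h1 : Real.smoothTransition =ᶠ[𝓝 τ] fun _ => 1 :=
          (show ∀ᶠ w in 𝓝 τ, 1 < w from lt_mem_nhds h).mono fun w hw =>
            Real.smoothTransition.one_of_one_le hw.le
        rw [h1.deriv_eq]; simp
    rw [this, abs_zero]; positivity

/-- A `C¹` cutoff function on the line, with its derivative. -/
structure LineCutoff (c : ℝ) (b b' : ℝ → ℝ) : Prop where
  hasDerivAt : ∀ t, HasDerivAt b (b' t) t
  continuous_deriv : Continuous b'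
  mem_Icc : ∀ t, b t ∈ Icc (0 : ℝ) 1
  eq_one : ∀ t, |t| ≤ 1 → b t = 1
  eq_zero : ∀ t, 2 < |t| → b t = 0
  deriv_eq_zero : ∀ t, 2 < |t| → b' t = 0
  abs_deriv_le : ∀ t, |b' t| ≤ c

/-- The smooth transition is composed with (4 - t²)/3, which is at least 1 for |t| ≤ 1 and at most 0
for |t| ≥ 2. On |t| ≤ 2 its slope is at most 4/3 in absolute value. -/
lemma exists_lineCutoff : ∃ (c : ℝ) (b b' : ℝ → ℝ), 0 < c ∧ LineCutoff c b b' := by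
  obtain ⟨M, hM, hMle⟩ := exists_abs_deriv_smoothTransition_le
  have hz : ∀ t : ℝ, 2 < |t| → Real.smoothTransition ((4 - t ^ 2) / 3) = 0 := fun t ht => by
    refine Real.smoothTransition.zero_of_nonpos ?_
    nlinarith [sq_abs t, abs_nonneg t]
  have hd : ∀ t : ℝ, HasDerivAt (fun t : ℝ => Real.smoothTransition ((4 - t ^ 2) / 3))
      (deriv Real.smoothTransition ((4 - t ^ 2) / 3) * (-(2 * t) / 3)) t := fun t => by
    have h : HasDerivAt (fun t : ℝ => (4 - t ^ 2) / 3) (-(2 * t) / 3) t := by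
      have := (((hasDerivAt_id t).pow 2).const_sub 4).div_const 3
      refine this.congr_deriv ?_
      simp
    exact (hasDerivAt_smoothTransition _).comp t h
  have hdz : ∀ t : ℝ, 2 < |t| →
      deriv Real.smoothTransition ((4 - t ^ 2) / 3) * (-(2 * t) / 3) = 0 := fun t ht => by
    have h1 : (fun t : ℝ => Real.smoothTransition ((4 - t ^ 2) / 3)) =ᶠ[𝓝 t] fun _ => 0 :=
      (show ∀ᶠ w in 𝓝 t, 2 < |w| from continuous_abs.continuousAt.eventually
        (lt_mem_nhds ht)).mono fun w hw => hz w hw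
    exact (hd t).unique ((hasDerivAt_const t (0 : ℝ)).congr_of_eventuallyEq h1)
  refine ⟨M * (4 / 3), _, _, by positivity, ⟨hd, ?_, ?_, ?_, hz, hdz, ?_⟩⟩
  · exact (continuous_deriv_smoothTransition.comp (by fun_prop)).mul (by fun_prop)
  · exact fun t => ⟨Real.smoothTransition.nonneg _, Real.smoothTransition.le_one _⟩
  · intro t ht
    refine Real.smoothTransition.one_of_one_le ?_
    nlinarith [sq_abs t, abs_nonneg t]
  · intro t
    rcases le_or_gt |t| 2 with h | h
    · rw [abs_mul]
      refine mul_le_mul (hMle _) ?_ (abs_nonneg _) hM.le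
      rw [abs_div, abs_neg, abs_mul]
      norm_num
      linarith
    · rw [hdz t h, abs_zero]; positivity

section
variable {γ C r R : ℝ} {B D : Set (ℝ × ℝ)} {v p q : ℝ × ℝ → ℝ}

/-- Growth along a segment in terms of the derivative where the function is positive. -/
lemma le_add_of_deriv_le_of_pos {f f' : ℝ → ℝ} {L : ℝ} (hL : 0 ≤ L)
    (hc : ContinuousOn f (Icc 0 1)) (hnn : ∀ t ∈ Icc (0 : ℝ) 1, 0 ≤ f t)
    (hd : ∀ t ∈ Icc (0 : ℝ) 1, 0 < f t → HasDerivAt f (f' t) t)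
    (hle : ∀ t ∈ Icc (0 : ℝ) 1, 0 < f t → f' t ≤ L) : f 1 ≤ f 0 + L := by
  have mvt : ∀ a ∈ Ico (0 : ℝ) 1, (∀ t ∈ Ioo a 1, 0 < f t) → f 1 ≤ f a + L := by
    intro a ha hpos
    have hsub : Icc a 1 ⊆ Icc (0 : ℝ) 1 := Icc_subset_Icc_left ha.1
    have hsub' : ∀ t ∈ Ioo a 1, t ∈ Icc (0 : ℝ) 1 := fun t ht => hsub ⟨ht.1.le, ht.2.le⟩
    obtain ⟨ξ, hξ, h⟩ := exists_hasDerivAt_eq_slope f f' ha.2 (hc.mono hsub)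
      fun t ht => hd t (hsub' t ht) (hpos t ht)
    have h1 := hle ξ (hsub' ξ hξ) (hpos ξ hξ)
    have ha1 : 0 < 1 - a := by linarith [ha.2]
    rw [h, div_le_iff₀ ha1] at h1
    nlinarith [ha.1]
  rcases (hnn 1 ⟨zero_le_one, le_rfl⟩).eq_or_lt with h1 | h1
  · rw [← h1]
    have := hnn 0 ⟨le_rfl, zero_le_one⟩
    linarith
  by_cases hz : ∃ t ∈ Icc (0 : ℝ) 1, f t = 0
  · have hcl : IsClosed (Icc (0 : ℝ) 1 ∩ f ⁻¹' {0}) :=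
      hc.preimage_isClosed_of_isClosed isClosed_Icc isClosed_singleton
    have hcpt : IsCompact (Icc (0 : ℝ) 1 ∩ f ⁻¹' {0}) :=
      isCompact_Icc.of_isClosed_subset hcl inter_subset_left
    obtain ⟨t, ht, ht0⟩ := hz
    -- After the last zero `a` the function is positive, so the mean value theorem applies on [a,
    -- 1]; the value f(a) = 0 is at most f(0).
    obtain ⟨a, ⟨haI, ha0⟩, hmax⟩ := hcpt.exists_isGreatest ⟨t, ht, ht0⟩
    have ha0' : f a = 0 := ha0
    have ha1 : a < 1 := lt_of_le_of_ne haI.2 fun h => by rw [h] at ha0'; exact h1.ne' ha0'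
    have h2 := mvt a ⟨haI.1, ha1⟩ fun t ht => by
      have htI : t ∈ Icc (0 : ℝ) 1 := ⟨haI.1.trans ht.1.le, ht.2.le⟩
      refine lt_of_le_of_ne (hnn t htI) fun h => ?_
      exact not_le.2 ht.1 (hmax ⟨htI, h.symm⟩)
    have := hnn 0 ⟨le_rfl, zero_le_one⟩
    linarith
  · push Not at hz
    refine mvt 0 ⟨le_rfl, one_pos⟩ fun t ht => ?_
    exact lt_of_le_of_ne (hnn t ⟨ht.1.le, ht.2.le⟩) (hz t ⟨ht.1.le, ht.2.le⟩).symm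

lemma PlanarSolution.le_add_of_segment (S : PlanarSolution γ C B D v p q) {z w : ℝ × ℝ} {L : ℝ}
    (hL : 0 ≤ L) (hB : ∀ τ ∈ Icc (0 : ℝ) 1, z + τ • w ∈ B)
    (hle : ∀ τ ∈ Icc (0 : ℝ) 1, z + τ • w ∈ D →
      p (z + τ • w) * w.1 + q (z + τ • w) * w.2 ≤ L) : v (z + w) ≤ v z + L := by
  have key := le_add_of_deriv_le_of_pos (f := fun τ : ℝ => v (z + τ • w))
    (f' := fun τ => p (z + τ • w) * w.1 + q (z + τ • w) * w.2) hL
    (S.continuousOn.comp (by fun_prop) hB) (fun τ hτ => S.nonneg _ (hB τ hτ))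
    (fun τ hτ hpos => by
      have h1 := S.hasFDerivAt _ ((S.mem_iff _ (hB τ hτ)).2 hpos)
      have h2 : HasDerivAt (fun τ : ℝ => z + τ • w) w τ := by
        simpa using ((hasDerivAt_id τ).smul_const w).const_add z
      have h3 : HasDerivAt (v ∘ fun τ : ℝ => z + τ • w)
          (p (z + τ • w) * w.1 + q (z + τ • w) * w.2) τ :=
        (h1.comp_hasDerivAt τ h2).congr_deriv (by simp)
      exact h3)
    (fun τ hτ hpos => hle τ hτ ((S.mem_iff _ (hB τ hτ)).2 hpos))
  simpa using key

/-- The open disc of radius `r` about the origin. -/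
def disc (r : ℝ) : Set (ℝ × ℝ) := {z | z.1 ^ 2 + z.2 ^ 2 < r ^ 2}

lemma PlanarSolution.abs_p_le (S : PlanarSolution γ C B D v p q) (hC : 0 ≤ C) {z : ℝ × ℝ}
    (hz : z ∈ D ∩ B) : |p z| ≤ C * |z.2| ^ γ :=
  abs_le_of_sq_le_sq (by nlinarith [S.bound z hz, sq_nonneg (q z)]) (by positivity)

lemma PlanarSolution.abs_q_le (S : PlanarSolution γ C B D v p q) (hC : 0 ≤ C) {z : ℝ × ℝ}
    (hz : z ∈ D ∩ B) : |q z| ≤ C * |z.2| ^ γ :=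
  abs_le_of_sq_le_sq (by nlinarith [S.bound z hz, sq_nonneg (p z)]) (by positivity)

/-- Go from the origin up the axis x₁ = 0 to height z₂, then horizontally to `z`. The path stays in
the disc, ordinates on it never exceed |z₂| in absolute value, and each leg has length at most `r`.
-/
lemma PlanarSolution.le_mul_abs_rpow (S : PlanarSolution γ C (disc r) D v p q) (hγ : 0 < γ)
    (hC : 0 ≤ C) (hr : 0 < r) (h0 : v 0 = 0) {z : ℝ × ℝ} (hz : z ∈ disc r) :
    v z ≤ 2 * C * r * |z.2| ^ γ := by
  have hz' : z.1 ^ 2 + z.2 ^ 2 < r ^ 2 := hz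
  have h1r : |z.1| ≤ r := abs_le_of_sq_le_sq (by nlinarith [sq_nonneg z.2]) hr.le
  have h2r : |z.2| ≤ r := abs_le_of_sq_le_sq (by nlinarith [sq_nonneg z.1]) hr.le
  have hT : 0 ≤ C * |z.2| ^ γ := by positivity
  have hv : v ((0 : ℝ × ℝ) + (0, z.2)) ≤ v 0 + C * |z.2| ^ γ * |z.2| := by
    have hB : ∀ τ ∈ Icc (0 : ℝ) 1, (0 : ℝ × ℝ) + τ • ((0 : ℝ), z.2) ∈ disc r := fun τ hτ => by
      simp only [disc, mem_ofPred_eq, Prod.fst_add, Prod.snd_add, Prod.smul_fst, Prod.smul_snd,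
        Prod.fst_zero, Prod.snd_zero, smul_eq_mul]
      have : τ ^ 2 ≤ 1 := by nlinarith [hτ.1, hτ.2]
      nlinarith [sq_nonneg z.1, sq_nonneg z.2]
    refine S.le_add_of_segment (by positivity) hB fun τ hτ hD => ?_
    simp only [mul_zero, zero_add]
    refine (le_abs_self _).trans ?_
    rw [abs_mul]
    refine mul_le_mul_of_nonneg_right ?_ (abs_nonneg _)
    have h3 := S.abs_q_le hC ⟨hD, hB τ hτ⟩
    simp only [zero_add, Prod.smul_mk, smul_eq_mul, mul_zero] at h3 ⊢
    refine h3.trans (mul_le_mul_of_nonneg_left ?_ hC)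
    refine Real.rpow_le_rpow (abs_nonneg _) ?_ hγ.le
    rw [abs_mul, abs_of_nonneg hτ.1]
    exact mul_le_of_le_one_left (abs_nonneg _) hτ.2
  have hh : v ((0, z.2) + (z.1, 0)) ≤ v (0, z.2) + C * |z.2| ^ γ * |z.1| := by
    have hB : ∀ τ ∈ Icc (0 : ℝ) 1, ((0 : ℝ), z.2) + τ • (z.1, (0 : ℝ)) ∈ disc r := fun τ hτ => by
      simp only [disc, mem_ofPred_eq, Prod.fst_add, Prod.snd_add, Prod.smul_fst, Prod.smul_snd,
        smul_eq_mul]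
      have : τ ^ 2 ≤ 1 := by nlinarith [hτ.1, hτ.2]
      nlinarith [sq_nonneg z.1, sq_nonneg z.2]
    refine S.le_add_of_segment (by positivity) hB fun τ hτ hD => ?_
    have h3 := S.abs_p_le hC ⟨hD, hB τ hτ⟩
    simp only [Prod.smul_mk, smul_eq_mul, mul_zero, Prod.mk_add_mk, add_zero, zero_add]
      at h3 ⊢
    refine (le_abs_self _).trans ?_
    rw [abs_mul]
    exact mul_le_mul_of_nonneg_right h3 (abs_nonneg _)
  simp only [zero_add, h0, Prod.mk_add_mk, add_zero] at hv hh
  have h5 : C * |z.2| ^ γ * |z.2| ≤ C * |z.2| ^ γ * r := mul_le_mul_of_nonneg_left h2r hT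
  have h6 : C * |z.2| ^ γ * |z.1| ≤ C * |z.2| ^ γ * r := mul_le_mul_of_nonneg_left h1r hT
  have : v z = v (z.1, z.2) := rfl
  rw [this]
  linarith

/-! ### Green's identity with a cutoff -/

/-- A compactly supported `C²` test function in the closed disc of radius `R`, with its partial
derivatives and its Laplacian. -/
structure TestFunction (R : ℝ) (φ φ₁ φ₂ lap : ℝ × ℝ → ℝ) : Prop where
  hasFDerivAt : ∀ z, HasFDerivAt φ
    (φ₁ z • ContinuousLinearMap.fst ℝ ℝ ℝ + φ₂ z • ContinuousLinearMap.snd ℝ ℝ ℝ) z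
  laplacian : ∀ z, ∃ L M : ℝ × ℝ →L[ℝ] ℝ, HasFDerivAt φ₁ L z ∧ HasFDerivAt φ₂ M z ∧
    L (1, 0) + M (0, 1) = lap z
  continuous_lap : Continuous lap
  eq_zero : ∀ z : ℝ × ℝ, R ^ 2 < z.1 ^ 2 + z.2 ^ 2 → φ z = 0 ∧ φ₁ z = 0 ∧ φ₂ z = 0 ∧ lap z = 0

lemma TestFunction.continuous {φ φ₁ φ₂ lap : ℝ × ℝ → ℝ} (h : TestFunction R φ φ₁ φ₂ lap) :
    Continuous φ ∧ Continuous φ₁ ∧ Continuous φ₂ := by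
  refine ⟨continuous_iff_continuousAt.2 fun z => (h.hasFDerivAt z).continuousAt,
    continuous_iff_continuousAt.2 fun z => ?_, continuous_iff_continuousAt.2 fun z => ?_⟩
  · obtain ⟨L, M, hL, -, -⟩ := h.laplacian z
    exact hL.continuousAt
  · obtain ⟨L, M, -, hM, -⟩ := h.laplacian z
    exact hM.continuousAt

lemma TestFunction.eventually_eq_zero {φ φ₁ φ₂ lap : ℝ × ℝ → ℝ}
    (h : TestFunction R φ φ₁ φ₂ lap) {z : ℝ × ℝ} (hz : R ^ 2 < z.1 ^ 2 + z.2 ^ 2) :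
    ∀ᶠ w in 𝓝 z, φ w = 0 ∧ φ₁ w = 0 ∧ φ₂ w = 0 ∧ lap w = 0 := by
  have hc : Continuous fun z : ℝ × ℝ => z.1 ^ 2 + z.2 ^ 2 := by fun_prop
  exact (hc.continuousAt.eventually (lt_mem_nhds hz)).mono fun w hw => h.eq_zero w hw

lemma PlanarSolution.continuous_mul_lap (S : PlanarSolution γ C (disc r) D v p q)
    {φ φ₁ φ₂ lap : ℝ × ℝ → ℝ} (hφ : TestFunction R φ φ₁ φ₂ lap) (hR : 0 ≤ R) (hRr : R < r) :
    Continuous fun z => v z * lap z := by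
  refine continuous_iff_continuousAt.2 fun z => ?_
  by_cases hz : z ∈ disc r
  · exact (S.continuousOn.continuousAt (S.isOpen_dom.mem_nhds hz)).mul
      hφ.continuous_lap.continuousAt
  · have hz' : R ^ 2 < z.1 ^ 2 + z.2 ^ 2 := lt_of_lt_of_le (by nlinarith) (not_lt.1 hz)
    refine (continuousAt_const (y := (0 : ℝ))).congr ?_
    filter_upwards [hφ.eventually_eq_zero hz'] with w hw
    simp [hw.2.2.2]

lemma continuous_ite_of_eventually {D : Set (ℝ × ℝ)} (hD : IsOpen D) {g : ℝ × ℝ → ℝ}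
    [∀ z, Decidable (z ∈ D)] (hg : ContinuousOn g D)
    (h0 : ∀ z, z ∉ D → ∀ᶠ w in 𝓝 z, w ∈ D → g w = 0) :
    Continuous fun z => if z ∈ D then g z else 0 := by
  refine continuous_iff_continuousAt.2 fun z => ?_
  by_cases hz : z ∈ D
  · refine (hg.continuousAt (hD.mem_nhds hz)).congr ?_
    filter_upwards [hD.mem_nhds hz] with w hw
    simp [hw]
  · refine (continuousAt_const (y := (0 : ℝ))).congr ?_
    filter_upwards [h0 z hz] with w hw
    by_cases hwD : w ∈ D
    · simp [hwD, hw hwD]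
    · simp [hwD]

open Classical in
/-- Green's identity in the positivity set with a cutoff `χ` away from its boundary. -/
theorem PlanarSolution.integral_green (S : PlanarSolution γ C (disc r) D v p q)
    {φ φ₁ φ₂ lap : ℝ × ℝ → ℝ} (hφ : TestFunction R φ φ₁ φ₂ lap) (hR : 0 ≤ R) (hRr : R < r)
    {χ χ₁ χ₂ : ℝ × ℝ → ℝ} (hχ : ∀ z, HasFDerivAt χ
      (χ₁ z • ContinuousLinearMap.fst ℝ ℝ ℝ + χ₂ z • ContinuousLinearMap.snd ℝ ℝ ℝ) z)
    (hχ₁ : Continuous χ₁) (hχ₂ : Continuous χ₂)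
    (hχ0 : ∀ z, z ∉ D → z ∈ closure D → z.1 ^ 2 + z.2 ^ 2 ≤ R ^ 2 →
      ∀ᶠ w in 𝓝 z, χ w = 0 ∧ χ₁ w = 0 ∧ χ₂ w = 0) :
    (Continuous fun z => if z ∈ D then χ₁ z * (φ z * p z - v z * φ₁ z) +
        χ₂ z * (φ z * q z - v z * φ₂ z) else 0) ∧
    ∫ z in rect r r, (if z ∈ D then χ₁ z * (φ z * p z - v z * φ₁ z) +
        χ₂ z * (φ z * q z - v z * φ₂ z) else 0) = ∫ z in rect r r, χ z * (v z * lap z) := by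
  have hr : 0 < r := hR.trans_lt hRr
  obtain ⟨hφc, hφ₁c, hφ₂c⟩ := hφ.continuous
  have hχc : Continuous χ := continuous_iff_continuousAt.2 fun z => (hχ z).continuousAt
  have hvc : ContinuousOn v D := fun z hz => (S.hasFDerivAt z hz).continuousAt.continuousWithinAt
  have hpc := S.continuousOn_p
  have hqc := S.continuousOn_q
  -- near points outside `D` the fields vanish
  have hout : ∀ z, z ∉ D → ∀ᶠ w in 𝓝 z, w ∈ D →
      (φ w = 0 ∧ φ₁ w = 0 ∧ φ₂ w = 0 ∧ lap w = 0) ∨ (χ w = 0 ∧ χ₁ w = 0 ∧ χ₂ w = 0) := by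
    intro z hz
    rcases le_or_gt (z.1 ^ 2 + z.2 ^ 2) (R ^ 2) with hzR | hzR
    · by_cases hzc : z ∈ closure D
      · exact (hχ0 z hz hzc hzR).mono fun w hw _ => Or.inr hw
      · filter_upwards [isClosed_closure.isOpen_compl.mem_nhds hzc] with w hw hwD
        exact absurd (subset_closure hwD) hw
    · exact (hφ.eventually_eq_zero hzR).mono fun w hw _ => Or.inl hw
  have hXc : Continuous fun z => if z ∈ D then χ₁ z * (φ z * p z - v z * φ₁ z) +
        χ₂ z * (φ z * q z - v z * φ₂ z) else 0 := by
    refine continuous_ite_of_eventually S.isOpen_pos ?_ fun z hz => ?_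
    · exact (hχ₁.continuousOn.mul ((hφc.continuousOn.mul hpc).sub (hvc.mul hφ₁c.continuousOn))).add
        (hχ₂.continuousOn.mul ((hφc.continuousOn.mul hqc).sub (hvc.mul hφ₂c.continuousOn)))
    · filter_upwards [hout z hz] with w hw hwD
      rcases hw hwD with ⟨h1, h2, h3, -⟩ | ⟨-, h2, h3⟩
      · rw [h1, h2, h3]; ring
      · rw [h2, h3]; ring
  refine ⟨hXc, ?_⟩
  -- The field χ(φ∇v - v∇φ) has divergence ∇χ·(φ∇v - v∇φ) - χ v Δφ on `D`, because Δv = 0. The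
  -- cutoffs make its extension by zero differentiable everywhere.
  set W₁ : ℝ × ℝ → ℝ := fun z => if z ∈ D then χ z * (φ z * p z - v z * φ₁ z) else 0 with hW₁
  set W₂ : ℝ × ℝ → ℝ := fun z => if z ∈ D then χ z * (φ z * q z - v z * φ₂ z) else 0 with hW₂
  have hW₁c : Continuous W₁ := by
    refine continuous_ite_of_eventually S.isOpen_pos ?_ fun z hz => ?_
    · exact hχc.continuousOn.mul ((hφc.continuousOn.mul hpc).sub (hvc.mul hφ₁c.continuousOn))
    · filter_upwards [hout z hz] with w hw hwD
      rcases hw hwD with ⟨h1, h2, h3, -⟩ | ⟨h1, h2, h3⟩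
      · rw [h1, h2]; ring
      · rw [h1]; ring
  have hW₂c : Continuous W₂ := by
    refine continuous_ite_of_eventually S.isOpen_pos ?_ fun z hz => ?_
    · exact hχc.continuousOn.mul ((hφc.continuousOn.mul hqc).sub (hvc.mul hφ₂c.continuousOn))
    · filter_upwards [hout z hz] with w hw hwD
      rcases hw hwD with ⟨h1, h2, h3, -⟩ | ⟨h1, h2, h3⟩
      · rw [h1, h3]; ring
      · rw [h1]; ring
  have key : ∀ z, ∃ L M : ℝ × ℝ →L[ℝ] ℝ, HasFDerivAt W₁ L z ∧ HasFDerivAt W₂ M z ∧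
      L (1, 0) + M (0, 1) = (if z ∈ D then χ₁ z * (φ z * p z - v z * φ₁ z) +
        χ₂ z * (φ z * q z - v z * φ₂ z) else 0) - χ z * (v z * lap z) := by
    intro z
    by_cases hz : z ∈ D
    · obtain ⟨L, M, hL, hM, h0⟩ := S.harmonic z hz
      obtain ⟨L', M', hL', hM', h0'⟩ := hφ.laplacian z
      have hev := S.isOpen_pos.mem_nhds hz
      refine ⟨_, _, ((hχ z).mul (((hφ.hasFDerivAt z).mul hL).sub
          ((S.hasFDerivAt z hz).mul hL'))).congr_of_eventuallyEq
          (mem_of_superset hev fun w hw => by simp [hW₁, hw]),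
        ((hχ z).mul (((hφ.hasFDerivAt z).mul hM).sub
          ((S.hasFDerivAt z hz).mul hM'))).congr_of_eventuallyEq
          (mem_of_superset hev fun w hw => by simp [hW₂, hw]), ?_⟩
      have h1 : M (0, 1) = - L (1, 0) := by linarith
      have h2 : M' (0, 1) = lap z - L' (1, 0) := by linarith
      simp [hz, h1, h2]
      ring
    · have hev := hout z hz
      refine ⟨0, 0, (hasFDerivAt_const (0 : ℝ) z).congr_of_eventuallyEq (hev.mono fun w hw => ?_),
        (hasFDerivAt_const (0 : ℝ) z).congr_of_eventuallyEq (hev.mono fun w hw => ?_), ?_⟩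
      · by_cases hwD : w ∈ D
        · simp only [hW₁, hwD, if_true]
          rcases hw hwD with ⟨h1, h2, h3, -⟩ | ⟨h1, h2, h3⟩
          · rw [h1, h2]; ring
          · rw [h1]; ring
        · simp [hW₁, hwD]
      · by_cases hwD : w ∈ D
        · simp only [hW₂, hwD, if_true]
          rcases hw hwD with ⟨h1, h2, h3, -⟩ | ⟨h1, h2, h3⟩
          · rw [h1, h3]; ring
          · rw [h1]; ring
        · simp [hW₂, hwD]
      · have : v z * lap z = 0 := by
          rcases le_or_gt (z.1 ^ 2 + z.2 ^ 2) (R ^ 2) with hzR | hzR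
          · rw [S.eq_zero (lt_of_le_of_lt hzR (by nlinarith)) hz, zero_mul]
          · rw [(hφ.eq_zero z hzR).2.2.2, mul_zero]
        simp [hz, this]
  choose L M hL hM hLM using key
  have hrect : Icc ((-r, -r) : ℝ × ℝ) (r, r) = rect r r := (Icc_prod_eq _ _)
  have hvl : Continuous fun z => χ z * (v z * lap z) := hχc.mul (S.continuous_mul_lap hφ hR hRr)
  have hi1 := hXc.continuousOn.integrableOn_compact (μ := volume) (isCompact_rect r r)
  have hi2 := hvl.continuousOn.integrableOn_compact (μ := volume) (isCompact_rect r r)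
  have hdiv := integral_divergence_prod_Icc_of_hasFDerivAt_off_countable_of_le W₁ W₂ L M
    (-r, -r) (r, r) ⟨by simp only; linarith, by simp only; linarith⟩ ∅ countable_empty
    hW₁c.continuousOn hW₂c.continuousOn (fun z _ => hL z) (fun z _ => hM z)
    (by simp only [hLM]; rw [hrect]; exact hi1.sub hi2)
  have hb : ∀ z : ℝ × ℝ, (|z.1| = r ∨ |z.2| = r) → W₁ z = 0 ∧ W₂ z = 0 := by
    intro z hz
    have hzR : R ^ 2 < z.1 ^ 2 + z.2 ^ 2 := by
      rcases hz with h | h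
      · rw [← sq_abs z.1, h]; nlinarith [sq_nonneg z.2]
      · rw [← sq_abs z.2, h]; nlinarith [sq_nonneg z.1]
    obtain ⟨h1, h2, h3, -⟩ := hφ.eq_zero z hzR
    simp [hW₁, hW₂, h1, h2, h3]
  have hr1 : |r| = r := abs_of_pos hr
  have hr2 : |-r| = r := by rw [abs_neg, hr1]
  have hT : ∀ x, W₂ (x, r) = 0 := fun x => (hb (x, r) (Or.inr hr1)).2
  have hT' : ∀ x, W₂ (x, -r) = 0 := fun x => (hb (x, -r) (Or.inr hr2)).2
  have hS : ∀ t, W₁ (r, t) = 0 := fun t => (hb (r, t) (Or.inl hr1)).1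
  have hS' : ∀ t, W₁ (-r, t) = 0 := fun t => (hb (-r, t) (Or.inl hr2)).1
  simp only [hLM, hT, hT', hS, hS', intervalIntegral.integral_zero, sub_zero, add_zero] at hdiv
  rw [hrect, integral_sub hi1 hi2, sub_eq_zero] at hdiv
  exact hdiv

end
-- Removability of a negligible free boundary
lemma deriv_smoothTransition_of_nonpos {τ : ℝ} (h : τ ≤ 0) :
    deriv Real.smoothTransition τ = 0 := by
  refine IsLocalMin.deriv_eq_zero (.of_forall fun x => ?_)
  rw [Real.smoothTransition.zero_of_nonpos h]
  exact Real.smoothTransition.nonneg x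

section
variable {γ C r R : ℝ} {D : Set (ℝ × ℝ)} {v p q : ℝ × ℝ → ℝ}

lemma LineCutoff.hasFDerivAt_square {m : ℝ} {b b' : ℝ → ℝ} (hb : LineCutoff m b b') {ρ : ℝ}
    (c z : ℝ × ℝ) :
    HasFDerivAt (fun z : ℝ × ℝ => b ((z.1 - c.1) / ρ) * b ((z.2 - c.2) / ρ))
      ((b' ((z.1 - c.1) / ρ) / ρ * b ((z.2 - c.2) / ρ)) • ContinuousLinearMap.fst ℝ ℝ ℝ +
        (b ((z.1 - c.1) / ρ) * (b' ((z.2 - c.2) / ρ) / ρ)) • ContinuousLinearMap.snd ℝ ℝ ℝ) z := by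
  have h : ∀ a t : ℝ, HasDerivAt (fun t => b ((t - a) / ρ)) (b' ((t - a) / ρ) / ρ) t := by
    intro a t
    have h1 : HasDerivAt (fun t : ℝ => (t - a) / ρ) (1 / ρ) t :=
      ((hasDerivAt_id t).sub_const a).div_const ρ
    exact ((hb.hasDerivAt _).comp t h1).congr_deriv (by ring)
  have h1 := (h c.1 z.1).comp_hasFDerivAt z (hasFDerivAt_fst (𝕜 := ℝ) (p := z))
  have h2 := (h c.2 z.2).comp_hasFDerivAt z (hasFDerivAt_snd (𝕜 := ℝ) (p := z))
  refine (h1.mul h2).congr_fderiv ?_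
  ext <;> simp
  ring

lemma LineCutoff.hasFDerivAt_strip {m : ℝ} {b b' : ℝ → ℝ} (hb : LineCutoff m b b') (δ : ℝ)
    (z : ℝ × ℝ) :
    HasFDerivAt (fun z : ℝ × ℝ => b (z.2 / δ))
      ((b' (z.2 / δ) / δ) • ContinuousLinearMap.snd ℝ ℝ ℝ) z := by
  have h1 : HasDerivAt (fun t : ℝ => b (t / δ)) (b' (z.2 / δ) / δ) z.2 := by
    have h1 : HasDerivAt (fun t : ℝ => t / δ) (1 / δ) z.2 := (hasDerivAt_id _).div_const δ
    exact ((hb.hasDerivAt _).comp z.2 h1).congr_deriv (by ring)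
  exact h1.comp_hasFDerivAt z (hasFDerivAt_snd (𝕜 := ℝ) (p := z))

lemma volume_real_Icc_prod_Icc {a b c d : ℝ} (h1 : a ≤ b) (h2 : c ≤ d) :
    (volume : Measure (ℝ × ℝ)).real (Icc a b ×ˢ Icc c d) = (b - a) * (d - c) := by
  rw [Measure.volume_eq_prod, measureReal_prod_prod, Real.volume_real_Icc_of_le h1,
    Real.volume_real_Icc_of_le h2]

lemma setIntegral_indicator_const_le {K Q : Set (ℝ × ℝ)} (hQ : MeasurableSet Q)
    (hQf : volume Q ≠ ⊤) {k : ℝ} (hk : 0 ≤ k) :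
    ∫ z in K, Q.indicator (fun _ => k) z ≤ volume.real Q * k := by
  rw [integral_indicator_const _ hQ, smul_eq_mul]
  refine mul_le_mul_of_nonneg_right ?_ hk
  exact ENNReal.toReal_mono hQf (Measure.restrict_apply_le K Q)

/-- A cutoff vanishing near a small set, with control of its gradient. -/
lemma exists_cutoff {A : Set (ℝ × ℝ)} (hA : IsCompact A) {δ : ℝ} (hδ : 0 < δ)
    (h0 : Measure.hausdorffMeasure 1 (A ∩ {z | δ ≤ |z.2|}) = 0) {m M : ℝ} {b b' : ℝ → ℝ}
    (hb : LineCutoff m b b') (hm : 0 ≤ m) (hM : ∀ τ, |deriv Real.smoothTransition τ| ≤ M) :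
    ∃ (I : Finset ℕ) (c : ℕ → ℝ × ℝ) (ρ : ℕ → ℝ) (χ χ₁ χ₂ : ℝ × ℝ → ℝ),
      (∀ i, 0 < ρ i) ∧ ∑ i ∈ I, ρ i ≤ δ ∧ (∀ z, HasFDerivAt χ
        (χ₁ z • ContinuousLinearMap.fst ℝ ℝ ℝ + χ₂ z • ContinuousLinearMap.snd ℝ ℝ ℝ) z) ∧
      Continuous χ₁ ∧ Continuous χ₂ ∧
      (∀ z ∈ A, ∀ᶠ w in 𝓝 z, χ w = 0 ∧ χ₁ w = 0 ∧ χ₂ w = 0) ∧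
      (∀ z, χ z ∈ Icc (0 : ℝ) 1) ∧
      (∀ z : ℝ × ℝ, 2 * δ < |z.2| → (∀ i ∈ I, z ∉ Icc ((c i).1 - 2 * ρ i) ((c i).1 + 2 * ρ i) ×ˢ
        Icc ((c i).2 - 2 * ρ i) ((c i).2 + 2 * ρ i)) → χ z = 1) ∧
      (∀ z, |χ₁ z| ≤ M * ∑ i ∈ I, (Icc ((c i).1 - 2 * ρ i) ((c i).1 + 2 * ρ i) ×ˢ
        Icc ((c i).2 - 2 * ρ i) ((c i).2 + 2 * ρ i)).indicator (fun _ => m / ρ i) z) ∧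
      (∀ z, |χ₂ z| ≤ M * (({z : ℝ × ℝ | |z.2| ≤ 2 * δ}).indicator (fun _ => m / δ) z +
        ∑ i ∈ I, (Icc ((c i).1 - 2 * ρ i) ((c i).1 + 2 * ρ i) ×ˢ
        Icc ((c i).2 - 2 * ρ i) ((c i).2 + 2 * ρ i)).indicator (fun _ => m / ρ i) z)) := by
  have hclosed : IsClosed {z : ℝ × ℝ | δ ≤ |z.2|} := isClosed_le (by fun_prop) (by fun_prop)
  obtain ⟨I, c, ρ, hρ, hcov, hsum⟩ := exists_finset_cover_of_hausdorffMeasure_eq_zero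
    (hA.inter_right hclosed) h0 hδ
  have hbc : Continuous b := continuous_iff_continuousAt.2 fun t => (hb.hasDerivAt t).continuousAt
  have hb'c := hb.continuous_deriv
  set Q : ℕ → Set (ℝ × ℝ) := fun i => Icc ((c i).1 - 2 * ρ i) ((c i).1 + 2 * ρ i) ×ˢ
        Icc ((c i).2 - 2 * ρ i) ((c i).2 + 2 * ρ i) with hQ
  -- A strip bump around the axis plus one bump per covering ball. `Z` is at least 1 near `A` and
  -- zero off the strip and the doubled squares, so `smoothTransition (1 - Z)` is a cutoff of the
  -- required kind.
  set Z : ℝ × ℝ → ℝ := fun z => b (z.2 / δ) +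
    ∑ i ∈ I, b ((z.1 - (c i).1) / ρ i) * b ((z.2 - (c i).2) / ρ i) with hZ
  set Z₁ : ℝ × ℝ → ℝ := fun z =>
    ∑ i ∈ I, b' ((z.1 - (c i).1) / ρ i) / ρ i * b ((z.2 - (c i).2) / ρ i) with hZ₁
  set Z₂ : ℝ × ℝ → ℝ := fun z => b' (z.2 / δ) / δ +
    ∑ i ∈ I, b ((z.1 - (c i).1) / ρ i) * (b' ((z.2 - (c i).2) / ρ i) / ρ i) with hZ₂
  have hZd : ∀ z, HasFDerivAt Z
      (Z₁ z • ContinuousLinearMap.fst ℝ ℝ ℝ + Z₂ z • ContinuousLinearMap.snd ℝ ℝ ℝ) z := by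
    intro z
    have h1 := (hb.hasFDerivAt_strip δ z).add (HasFDerivAt.fun_sum (u := I)
      fun i _ => hb.hasFDerivAt_square (ρ := ρ i) (c i) z)
    refine h1.congr_fderiv ?_
    ext <;> simp [hZ₁, hZ₂]
  have hZc : Continuous Z := continuous_iff_continuousAt.2 fun z => (hZd z).continuousAt
  have hZ₁c : Continuous Z₁ := by
    refine continuous_finsetSum _ fun i _ => ?_
    fun_prop
  have hZ₂c : Continuous Z₂ := by
    refine Continuous.add (by fun_prop) (continuous_finsetSum _ fun i _ => ?_)
    fun_prop
  have hout : ∀ i z, z ∉ Q i → 2 < |(z.1 - (c i).1) / ρ i| ∨ 2 < |(z.2 - (c i).2) / ρ i| := by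
    intro i z hz
    by_contra! h
    refine hz ⟨?_, ?_⟩
    · have := h.1
      rw [abs_div, abs_of_pos (hρ i), div_le_iff₀ (hρ i), abs_le] at this
      exact ⟨by linarith [this.1], by linarith [this.2]⟩
    · have := h.2
      rw [abs_div, abs_of_pos (hρ i), div_le_iff₀ (hρ i), abs_le] at this
      exact ⟨by linarith [this.1], by linarith [this.2]⟩
  have hstrip : ∀ z : ℝ × ℝ, 2 * δ < |z.2| → 2 < |z.2 / δ| := fun z hz => by
    rwa [abs_div, abs_of_pos hδ, lt_div_iff₀ hδ]
  have hbabs : ∀ t, |b t| ≤ 1 := fun t => by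
    rw [abs_of_nonneg (hb.mem_Icc t).1]; exact (hb.mem_Icc t).2
  have hterm : ∀ i (x y : ℝ), |x| ≤ m → |y| ≤ 1 → |x / ρ i * y| ≤ m / ρ i := fun i x y hx hy => by
    have := hρ i
    rw [abs_mul, abs_div, abs_of_pos this]
    calc |x| / ρ i * |y| ≤ m / ρ i * 1 := by gcongr
      _ = _ := mul_one _
  have hZ₁le : ∀ z, |Z₁ z| ≤ ∑ i ∈ I, (Q i).indicator (fun _ => m / ρ i) z := fun z => by
    refine (Finset.abs_sum_le_sum_abs _ _).trans (Finset.sum_le_sum fun i _ => ?_)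
    by_cases hz : z ∈ Q i
    · rw [indicator_of_mem hz]
      exact hterm i _ _ (hb.abs_deriv_le _) (hbabs _)
    · rw [indicator_of_notMem hz]
      rcases hout i z hz with h | h
      · simp [hb.deriv_eq_zero _ h]
      · simp [hb.eq_zero _ h]
  have hZ₂le : ∀ z, |Z₂ z| ≤ ({z : ℝ × ℝ | |z.2| ≤ 2 * δ}).indicator (fun _ => m / δ) z +
      ∑ i ∈ I, (Q i).indicator (fun _ => m / ρ i) z := fun z => by
    refine (abs_add_le _ _).trans (add_le_add ?_ ?_)
    · by_cases hz : |z.2| ≤ 2 * δ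
      · rw [indicator_of_mem (by exact hz), abs_div, abs_of_pos hδ]
        exact div_le_div_of_nonneg_right (hb.abs_deriv_le _) hδ.le
      · rw [indicator_of_notMem (by exact hz), hb.deriv_eq_zero _ (hstrip z (not_le.1 hz))]
        simp
    · refine (Finset.abs_sum_le_sum_abs _ _).trans (Finset.sum_le_sum fun i _ => ?_)
      by_cases hz : z ∈ Q i
      · rw [indicator_of_mem hz, mul_comm]
        exact hterm i _ _ (hb.abs_deriv_le _) (hbabs _)
      · rw [indicator_of_notMem hz]
        rcases hout i z hz with h | h
        · simp [hb.eq_zero _ h]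
        · simp [hb.deriv_eq_zero _ h]
  have hMnn : 0 ≤ M := (abs_nonneg _).trans (hM 0)
  refine ⟨I, c, ρ, fun z => Real.smoothTransition (1 - Z z),
    fun z => deriv Real.smoothTransition (1 - Z z) * -Z₁ z,
    fun z => deriv Real.smoothTransition (1 - Z z) * -Z₂ z, hρ, hsum, ?_, ?_, ?_, ?_, ?_, ?_, ?_, ?_⟩
  · intro z
    have h1 := (hasDerivAt_smoothTransition (1 - Z z)).comp_hasFDerivAt z ((hZd z).const_sub 1)
    refine h1.congr_fderiv ?_
    ext <;> simp
  · exact (continuous_deriv_smoothTransition.comp (continuous_const.sub hZc)).mul hZ₁c.neg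
  · exact (continuous_deriv_smoothTransition.comp (continuous_const.sub hZc)).mul hZ₂c.neg
  · intro z hz
    have hnn : ∀ (w : ℝ × ℝ) i, 0 ≤ b ((w.1 - (c i).1) / ρ i) * b ((w.2 - (c i).2) / ρ i) :=
      fun w i => mul_nonneg (hb.mem_Icc _).1 (hb.mem_Icc _).1
    have hev : ∀ᶠ w in 𝓝 z, 1 ≤ Z w := by
      rcases lt_or_ge |z.2| δ with h | h
      · have h1 : ∀ᶠ w : ℝ × ℝ in 𝓝 z, |w.2| < δ :=
          (continuous_abs.comp continuous_snd).continuousAt.eventually (gt_mem_nhds h)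
        filter_upwards [h1] with w hw
        have h2 : b (w.2 / δ) = 1 := hb.eq_one _ (by
          rw [abs_div, abs_of_pos hδ, div_le_one hδ]; exact hw.le)
        simp only [hZ, h2]
        have := Finset.sum_nonneg fun i (_ : i ∈ I) => hnn w i
        linarith
      · obtain ⟨i, hi⟩ := mem_iUnion.1 (hcov ⟨hz, h⟩)
        obtain ⟨hiI, hzi⟩ := mem_iUnion.1 hi
        filter_upwards [Metric.isOpen_ball.mem_nhds hzi] with w hw
        rw [Metric.mem_ball, Prod.dist_eq, max_lt_iff, Real.dist_eq, Real.dist_eq] at hw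
        have h1 : b ((w.1 - (c i).1) / ρ i) = 1 := hb.eq_one _ (by
          rw [abs_div, abs_of_pos (hρ i), div_le_one (hρ i)]; exact hw.1.le)
        have h2 : b ((w.2 - (c i).2) / ρ i) = 1 := hb.eq_one _ (by
          rw [abs_div, abs_of_pos (hρ i), div_le_one (hρ i)]; exact hw.2.le)
        have h3 := Finset.single_le_sum (fun j _ => hnn w j) hiI
        rw [h1, h2, one_mul] at h3
        have h4 := (hb.mem_Icc (w.2 / δ)).1
        simp only [hZ]
        linarith
    filter_upwards [hev] with w hw
    have h1 : 1 - Z w ≤ 0 := by linarith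
    simp [Real.smoothTransition.zero_of_nonpos h1, deriv_smoothTransition_of_nonpos h1]
  · exact fun z => ⟨Real.smoothTransition.nonneg _, Real.smoothTransition.le_one _⟩
  · intro z hz hzQ
    have h1 : Z z = 0 := by
      simp only [hZ, hb.eq_zero _ (hstrip z hz), zero_add]
      refine Finset.sum_eq_zero fun i hi => ?_
      rcases hout i z (hzQ i hi) with h | h
      · simp [hb.eq_zero _ h]
      · simp [hb.eq_zero _ h]
    simp [h1, Real.smoothTransition.one]
  · intro z
    rw [abs_mul, abs_neg]
    exact mul_le_mul (hM _) (hZ₁le z) (abs_nonneg _) hMnn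
  · intro z
    rw [abs_mul, abs_neg]
    exact mul_le_mul (hM _) (hZ₂le z) (abs_nonneg _) hMnn

lemma isCompact_closedDisc (R : ℝ) : IsCompact {z : ℝ × ℝ | z.1 ^ 2 + z.2 ^ 2 ≤ R ^ 2} := by
  refine (isCompact_rect |R| |R|).of_isClosed_subset
    (isClosed_le (by fun_prop) (by fun_prop)) fun z hz => ?_
  have hz' : z.1 ^ 2 + z.2 ^ 2 ≤ R ^ 2 := hz
  exact ⟨abs_le.1 (sq_le_sq.1 (by nlinarith [sq_nonneg z.2])),
    abs_le.1 (sq_le_sq.1 (by nlinarith [sq_nonneg z.1]))⟩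

/-- If the free boundary is negligible, the solution is weakly harmonic across it. -/
theorem PlanarSolution.integral_mul_lap_eq_zero (S : PlanarSolution γ C (disc r) D v p q)
    (hγ : 0 < γ) (hC : 0 ≤ C) (h0 : v 0 = 0)
    (hnull : ∀ τ : ℝ, 0 < τ → Measure.hausdorffMeasure 1
      {z : ℝ × ℝ | z ∈ disc r ∧ z ∈ closure D ∧ z ∉ D ∧ τ < |z.2|} = 0)
    {φ φ₁ φ₂ lap : ℝ × ℝ → ℝ} (hφ : TestFunction R φ φ₁ φ₂ lap) (hR : 0 ≤ R) (hRr : R < r) :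
    ∫ z in rect r r, v z * lap z = 0 := by
  classical
  have hr : 0 < r := hR.trans_lt hRr
  obtain ⟨m, b, b', hm, hb⟩ := exists_lineCutoff
  obtain ⟨M, hM, hMle⟩ := exists_abs_deriv_smoothTransition_le
  obtain ⟨hφc, hφ₁c, hφ₂c⟩ := hφ.continuous
  have hvl := S.continuous_mul_lap hφ hR hRr
  obtain ⟨N, hN⟩ := (isCompact_rect r r).exists_bound_of_continuousOn
    (f := fun z => |φ z| + |φ₁ z| + |φ₂ z| + |v z * lap z|) (by fun_prop)
  have hN' : ∀ z ∈ rect r r, |φ z| ≤ N ∧ |φ₁ z| ≤ N ∧ |φ₂ z| ≤ N ∧ |v z * lap z| ≤ N := by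
    intro z hz
    have h1 := (le_abs_self _).trans (hN z hz)
    have := abs_nonneg (φ z); have := abs_nonneg (φ₁ z); have := abs_nonneg (φ₂ z)
    have := abs_nonneg (v z * lap z)
    refine ⟨?_, ?_, ?_, ?_⟩ <;> linarith
  have hNnn : 0 ≤ N := (abs_nonneg _).trans
    (hN' 0 ⟨⟨by simp [hr.le], by simp [hr.le]⟩, ⟨by simp [hr.le], by simp [hr.le]⟩⟩).1
  -- Both |∇v| and v are bounded by multiples of |z₂|^γ, hence so are the components of φ∇v - v∇φ;
  -- this decay pays for cutting off along the axis.
  set A₀ := N * (C + 2 * C * r) with hA₀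
  have hA₀nn : 0 ≤ A₀ := by positivity
  have hfield : ∀ z ∈ rect r r, z ∈ D → |φ z * p z - v z * φ₁ z| ≤ A₀ * |z.2| ^ γ ∧
      |φ z * q z - v z * φ₂ z| ≤ A₀ * |z.2| ^ γ := by
    intro z hz hzD
    have hT : 0 ≤ |z.2| ^ γ := by positivity
    rcases le_or_gt (z.1 ^ 2 + z.2 ^ 2) (R ^ 2) with hzR | hzR
    · have hzB : z ∈ disc r := lt_of_le_of_lt hzR (by nlinarith)
      obtain ⟨h1, h2, h3, -⟩ := hN' z hz
      have hp := S.abs_p_le hC ⟨hzD, hzB⟩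
      have hq := S.abs_q_le hC ⟨hzD, hzB⟩
      have hv := S.le_mul_abs_rpow hγ hC hr h0 hzB
      have hv0 := S.nonneg z hzB
      have aux : ∀ x y w : ℝ, |x| ≤ N → |y| ≤ N → |w| ≤ C * |z.2| ^ γ →
          |x * w - v z * y| ≤ A₀ * |z.2| ^ γ := by
        intro x y w hx hy hw
        refine (abs_sub _ _).trans ?_
        rw [abs_mul, abs_mul, abs_of_nonneg hv0]
        have e1 : |x| * |w| ≤ N * (C * |z.2| ^ γ) := by gcongr
        have e2 : v z * |y| ≤ (2 * C * r * |z.2| ^ γ) * N := by gcongr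
        rw [hA₀]; linarith
      exact ⟨aux _ _ _ h1 h2 hp, aux _ _ _ h1 h3 hq⟩
    · obtain ⟨h1, h2, h3, -⟩ := hφ.eq_zero z hzR
      have : 0 ≤ A₀ * |z.2| ^ γ := by positivity
      simp [h1, h2, h3, this]
  -- the quantitative estimate
  have key : ∀ δ ∈ Ioc (0 : ℝ) 1, |∫ z in rect r r, v z * lap z| ≤
      (16 * N + 32 * (M * m * A₀ * r ^ γ)) * δ +
        8 * r * (N * δ + M * m * A₀ * (2 * δ) ^ γ) := by
    intro δ hδ
    set A := {z : ℝ × ℝ | z.1 ^ 2 + z.2 ^ 2 ≤ R ^ 2} ∩ (closure D ∩ Dᶜ) with hA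
    have hAc : IsCompact A := (isCompact_closedDisc R).inter_right
      (isClosed_closure.inter S.isOpen_pos.isClosed_compl)
    have hA0 : Measure.hausdorffMeasure 1 (A ∩ {z | δ ≤ |z.2|}) = 0 := by
      refine measure_mono_null ?_ (hnull (δ / 2) (half_pos hδ.1))
      rintro z ⟨⟨hz1, hz2, hz3⟩, hz4⟩
      exact ⟨lt_of_le_of_lt hz1 (pow_lt_pow_left₀ hRr hR two_ne_zero), hz2, hz3,
        (half_lt_self hδ.1).trans_le hz4⟩
    obtain ⟨I, c, ρ, χ, χ₁, χ₂, hρ, hsum, hχ, hχ₁, hχ₂, hχ0, hχI, hχone, hχ₁le, hχ₂le⟩ :=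
      exists_cutoff hAc hδ.1 hA0 hb hm.le hMle
    obtain ⟨hXc, hgreen⟩ := S.integral_green hφ hR hRr hχ hχ₁ hχ₂
      fun z hz1 hz2 hz3 => hχ0 z ⟨hz3, hz2, hz1⟩
    set X : ℝ × ℝ → ℝ := fun z => if z ∈ D then χ₁ z * (φ z * p z - v z * φ₁ z) +
        χ₂ z * (φ z * q z - v z * φ₂ z) else 0 with hX
    set Q : ℕ → Set (ℝ × ℝ) := fun i => Icc ((c i).1 - 2 * ρ i) ((c i).1 + 2 * ρ i) ×ˢ
        Icc ((c i).2 - 2 * ρ i) ((c i).2 + 2 * ρ i) with hQ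
    set P : Set (ℝ × ℝ) := Icc (-r) r ×ˢ Icc (-(2 * δ)) (2 * δ) with hP
    -- A square has area 16ρᵢ², so the cutoff gradient of size 1/ρᵢ costs O(ρᵢ), and the radii sum
    -- to at most δ; the factor 2 accounts for the two partial derivatives. The strip has area 8rδ,
    -- so its cutoff gradient of size 1/δ, acting on a field of size (2δ)^γ, costs O(δ^γ).
    set k : ℕ → ℝ := fun i => N + 2 * (M * (m / ρ i) * (A₀ * r ^ γ)) with hk
    set k₀ : ℝ := N + M * (m / δ) * (A₀ * (2 * δ) ^ γ) with hk₀
    have hknn : ∀ i, 0 ≤ k i := fun i => by have := hρ i; positivity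
    have hk₀nn : 0 ≤ k₀ := by have := hδ.1; positivity
    have hχc : Continuous χ := continuous_iff_continuousAt.2 fun z => (hχ z).continuousAt
    have hi1 := hXc.continuousOn.integrableOn_compact (μ := volume) (isCompact_rect r r)
    have hχvl : Continuous fun z => χ z * (v z * lap z) := hχc.mul hvl
    have hi2 := hχvl.continuousOn.integrableOn_compact (μ := volume) (isCompact_rect r r)
    have hi3 := hvl.continuousOn.integrableOn_compact (μ := volume) (isCompact_rect r r)
    have hQm : ∀ i, MeasurableSet (Q i) := fun i => measurableSet_Icc.prod measurableSet_Icc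
    have hPm : MeasurableSet P := measurableSet_Icc.prod measurableSet_Icc
    have hQf : ∀ i, volume (Q i) ≠ ⊤ := fun i => (isCompact_Icc.prod isCompact_Icc).measure_ne_top
    have hPf : volume P ≠ ⊤ := (isCompact_Icc.prod isCompact_Icc).measure_ne_top
    have hii : ∀ {U : Set (ℝ × ℝ)} (_ : MeasurableSet U) (_ : volume U ≠ ⊤) (k : ℝ),
        IntegrableOn (U.indicator fun _ => k) (rect r r) := fun hU hUf k =>
      ((integrable_indicator_iff hU).2 (integrableOn_const hUf)).integrableOn
    have hpt : ∀ z ∈ rect r r, |v z * lap z - χ z * (v z * lap z) + X z| ≤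
        P.indicator (fun _ => k₀) z + ∑ i ∈ I, (Q i).indicator (fun _ => k i) z := by
      intro z hz
      have hsumnn : ∀ f : ℕ → ℝ, (∀ i, 0 ≤ f i) →
          0 ≤ ∑ i ∈ I, (Q i).indicator (fun _ => f i) z := fun f hf =>
        Finset.sum_nonneg fun i _ => indicator_nonneg (fun _ _ => hf i) _
      have hPiff : z ∈ P ↔ |z.2| ≤ 2 * δ := by
        rw [abs_le]; exact ⟨fun h => h.2, fun h => ⟨hz.1, h⟩⟩
      -- first part
      have e1 : |v z * lap z - χ z * (v z * lap z)| ≤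
          P.indicator (fun _ => N) z + ∑ i ∈ I, (Q i).indicator (fun _ => N) z := by
        have h1 : |v z * lap z - χ z * (v z * lap z)| ≤ N := by
          have h2 : v z * lap z - χ z * (v z * lap z) = (1 - χ z) * (v z * lap z) := by ring
          rw [h2, abs_mul, abs_of_nonneg (by linarith [(hχI z).2])]
          calc (1 - χ z) * |v z * lap z| ≤ 1 * N := by
                gcongr
                · linarith [(hχI z).1]
                · exact (hN' z hz).2.2.2
            _ = N := one_mul _
        by_cases hzP : z ∈ P
        · rw [indicator_of_mem hzP]
          exact h1.trans (le_add_of_nonneg_right (hsumnn _ fun _ => hNnn))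
        by_cases hzQ : ∃ i ∈ I, z ∈ Q i
        · obtain ⟨i, hi, hzi⟩ := hzQ
          have h3 := Finset.single_le_sum (f := fun i => (Q i).indicator (fun _ => N) z)
            (fun i _ => indicator_nonneg (fun _ _ => hNnn) _) hi
          simp only [indicator_of_mem hzi] at h3
          rw [indicator_of_notMem hzP, zero_add]
          exact h1.trans h3
        · push Not at hzQ
          have h4 : χ z = 1 := hχone z (not_le.1 fun h => hzP (hPiff.2 h)) hzQ
          rw [h4, one_mul, sub_self, abs_zero]
          exact add_nonneg (indicator_nonneg (fun _ _ => hNnn) _) (hsumnn _ fun _ => hNnn)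
      -- second part
      have e2 : |X z| ≤ P.indicator (fun _ => M * (m / δ) * (A₀ * (2 * δ) ^ γ)) z +
          ∑ i ∈ I, (Q i).indicator (fun _ => 2 * (M * (m / ρ i) * (A₀ * r ^ γ))) z := by
        have hδ0 := hδ.1
        have hrhs : 0 ≤ P.indicator (fun _ => M * (m / δ) * (A₀ * (2 * δ) ^ γ)) z +
            ∑ i ∈ I, (Q i).indicator (fun _ => 2 * (M * (m / ρ i) * (A₀ * r ^ γ))) z :=
          add_nonneg (indicator_nonneg (fun _ _ => by positivity) _)
            (hsumnn _ fun i => by have := hρ i; positivity)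
        by_cases hzD : z ∈ D
        · obtain ⟨hf1, hf2⟩ := hfield z hz hzD
          set q₀ := ∑ i ∈ I, (Q i).indicator (fun _ => m / ρ i) z with hq₀
          have hq₀nn : 0 ≤ q₀ := hsumnn _ fun i => by have := hρ i; positivity
          have hz2r : |z.2| ^ γ ≤ r ^ γ := Real.rpow_le_rpow (abs_nonneg _) (abs_le.2 hz.2) hγ.le
          have hT : 0 ≤ |z.2| ^ γ := by positivity
          have g1 : |χ₁ z * (φ z * p z - v z * φ₁ z)| ≤ M * q₀ * (A₀ * r ^ γ) := by
            rw [abs_mul]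
            refine mul_le_mul (hχ₁le z) (hf1.trans ?_) (abs_nonneg _) (by positivity)
            gcongr
          set s₀ := ({z : ℝ × ℝ | |z.2| ≤ 2 * δ}).indicator (fun _ => m / δ) z with hs₀
          have hs₀nn : 0 ≤ s₀ := indicator_nonneg (fun _ _ => by positivity) _
          have g2 : |χ₂ z * (φ z * q z - v z * φ₂ z)| ≤
              M * s₀ * (A₀ * |z.2| ^ γ) + M * q₀ * (A₀ * r ^ γ) := by
            rw [abs_mul]
            calc |χ₂ z| * |φ z * q z - v z * φ₂ z| ≤ M * (s₀ + q₀) * (A₀ * |z.2| ^ γ) :=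
                  mul_le_mul (hχ₂le z) hf2 (abs_nonneg _) (by positivity)
              _ = M * s₀ * (A₀ * |z.2| ^ γ) + M * q₀ * (A₀ * |z.2| ^ γ) := by ring
              _ ≤ _ := by gcongr
          have g3 : M * s₀ * (A₀ * |z.2| ^ γ) ≤
              P.indicator (fun _ => M * (m / δ) * (A₀ * (2 * δ) ^ γ)) z := by
            by_cases hzP : z ∈ P
            · have hz2 := hPiff.1 hzP
              rw [indicator_of_mem hzP, hs₀, indicator_of_mem (by exact hz2)]
              gcongr
            · have hz2 := fun h => hzP (hPiff.2 h)
              rw [indicator_of_notMem hzP, hs₀, indicator_of_notMem (by exact hz2)]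
              simp
          have g4 : ∑ i ∈ I, (Q i).indicator (fun _ => 2 * (M * (m / ρ i) * (A₀ * r ^ γ))) z =
              2 * (M * q₀ * (A₀ * r ^ γ)) := by
            rw [hq₀, Finset.mul_sum, Finset.sum_mul, Finset.mul_sum]
            refine Finset.sum_congr rfl fun i _ => ?_
            by_cases hzi : z ∈ Q i
            · simp [indicator_of_mem hzi]
            · simp [indicator_of_notMem hzi]
          simp only [hX, hzD, if_true]
          rw [g4]
          refine (abs_add_le _ _).trans ?_
          linarith
        · simp only [hX, hzD, if_false, abs_zero]
          exact hrhs
      refine (abs_add_le _ _).trans ((add_le_add e1 e2).trans (le_of_eq ?_))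
      have e3 : ∀ (U : Set (ℝ × ℝ)) (x y : ℝ), U.indicator (fun _ => x + y) z =
          U.indicator (fun _ => x) z + U.indicator (fun _ => y) z := fun U x y => by
        by_cases h : z ∈ U <;> simp [h]
      simp only [hk, hk₀, e3, Finset.sum_add_distrib]
      ring
    -- Green's identity allows adding `X` and subtracting χ v Δφ. The integrand now lives on the
    -- strip and the squares.
    have hint : ∫ z in rect r r, v z * lap z =
        ∫ z in rect r r, (v z * lap z - χ z * (v z * lap z) + X z) := by
      have h1 := integral_add (hi3.sub hi2) hi1
      have h2 := integral_sub hi3 hi2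
      simp only [Pi.sub_apply] at h1
      rw [h1, h2, hgreen]
      ring
    rw [hint]
    have hgi : IntegrableOn (fun z => P.indicator (fun _ => k₀) z +
        ∑ i ∈ I, (Q i).indicator (fun _ => k i) z) (rect r r) :=
      (hii hPm hPf k₀).add (integrable_finsetSum _ fun i _ => hii (hQm i) (hQf i) (k i))
    calc |∫ z in rect r r, (v z * lap z - χ z * (v z * lap z) + X z)|
        ≤ ∫ z in rect r r, (P.indicator (fun _ => k₀) z +
            ∑ i ∈ I, (Q i).indicator (fun _ => k i) z) := by
          rw [← Real.norm_eq_abs]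
          refine norm_integral_le_of_norm_le hgi ?_
          filter_upwards [ae_restrict_mem (isCompact_rect r r).measurableSet] with z hz
          exact hpt z hz
      _ = (∫ z in rect r r, P.indicator (fun _ => k₀) z) +
            ∑ i ∈ I, ∫ z in rect r r, (Q i).indicator (fun _ => k i) z := by
          rw [integral_add (hii hPm hPf k₀)
            (integrable_finsetSum _ fun i _ => hii (hQm i) (hQf i) (k i)),
            integral_finsetSum _ fun i _ => hii (hQm i) (hQf i) (k i)]
      _ ≤ 8 * r * δ * k₀ + ∑ i ∈ I, 16 * ρ i ^ 2 * k i := by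
          refine add_le_add ?_ (Finset.sum_le_sum fun i _ => ?_)
          · refine (setIntegral_indicator_const_le hPm hPf hk₀nn).trans (le_of_eq ?_)
            rw [hP, volume_real_Icc_prod_Icc (by linarith) (by linarith [hδ.1])]
            ring
          · refine (setIntegral_indicator_const_le (hQm i) (hQf i) (hknn i)).trans (le_of_eq ?_)
            have := hρ i
            rw [hQ, volume_real_Icc_prod_Icc (by linarith) (by linarith)]
            ring
      _ ≤ 8 * r * (N * δ + M * m * A₀ * (2 * δ) ^ γ) +
            (16 * N + 32 * (M * m * A₀ * r ^ γ)) * δ := by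
          refine add_le_add (le_of_eq ?_) ?_
          · rw [hk₀]
            have := hδ.1.ne'
            field_simp
          · calc ∑ i ∈ I, 16 * ρ i ^ 2 * k i
                ≤ ∑ i ∈ I, (16 * N + 32 * (M * m * A₀ * r ^ γ)) * ρ i := by
                  refine Finset.sum_le_sum fun i hi => ?_
                  have hρi := hρ i
                  have h1 : ρ i ≤ 1 := (Finset.single_le_sum (fun j _ => (hρ j).le) hi).trans
                    (hsum.trans hδ.2)
                  have h2 : 16 * ρ i ^ 2 * k i = 16 * N * (ρ i * ρ i) +
                      32 * (M * m * A₀ * r ^ γ) * ρ i := by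
                    rw [hk]; field_simp; ring
                  rw [h2]
                  have h3 : ρ i * ρ i ≤ ρ i := mul_le_of_le_one_left hρi.le h1
                  have h4 : 16 * N * (ρ i * ρ i) ≤ 16 * N * ρ i := by gcongr
                  linarith
              _ ≤ _ := by
                  rw [← Finset.mul_sum]
                  gcongr
      _ = _ := by ring
  have hlim : Tendsto (fun δ : ℝ => (16 * N + 32 * (M * m * A₀ * r ^ γ)) * δ +
        8 * r * (N * δ + M * m * A₀ * (2 * δ) ^ γ)) (𝓝[>] 0) (𝓝 0) := by
    have hc : Continuous fun δ : ℝ => (16 * N + 32 * (M * m * A₀ * r ^ γ)) * δ +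
        8 * r * (N * δ + M * m * A₀ * (2 * δ) ^ γ) := by
      have : Continuous fun δ : ℝ => (2 * δ) ^ γ :=
        (continuous_const.mul continuous_id).rpow_const fun _ => Or.inr hγ.le
      fun_prop
    have h1 := (hc.tendsto 0).mono_left (nhdsWithin_le_nhds (s := Ioi 0))
    simpa [Real.zero_rpow hγ.ne'] using h1
  have hfin := ge_of_tendsto hlim (mem_of_superset (Ioc_mem_nhdsGT one_pos) key)
  exact abs_nonpos_iff.1 hfin

end
-- Radial test functions and the mean value argument
lemma stepDeriv_eq_zero_of_gt {ε τ : ℝ} (hε : 0 < ε) (h : ε < τ) : stepDeriv ε τ = 0 := by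
  have h1 : step ε =ᶠ[𝓝 τ] fun _ => 1 :=
    (show ∀ᶠ w in 𝓝 τ, ε < w from lt_mem_nhds h).mono fun w hw => step_eq_one hε hw.le
  exact (hasDerivAt_step ε τ).unique ((hasDerivAt_const τ (1 : ℝ)).congr_of_eventuallyEq h1)

/-- The radial derivative profile `k(σ) / σ`, `k = step a - step b`, is differentiable. -/
lemma exists_hasDerivAt_step_sub_div {a b : ℝ} (ha : 0 < a) (hab : a < b) (σ : ℝ) :
    ∃ d : ℝ, HasDerivAt (fun σ => (step a σ - step b σ) / σ) d σ ∧
      σ * d + (step a σ - step b σ) / σ = stepDeriv a σ - stepDeriv b σ := by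
  have hk : HasDerivAt (fun σ => step a σ - step b σ) (stepDeriv a σ - stepDeriv b σ) σ :=
    (hasDerivAt_step a σ).sub (hasDerivAt_step b σ)
  rcases eq_or_ne σ 0 with rfl | hσ
  · have hev : (fun σ => (step a σ - step b σ) / σ) =ᶠ[𝓝 0] fun _ => 0 :=
      (show ∀ᶠ w in 𝓝 (0 : ℝ), w < a / 2 from gt_mem_nhds (by positivity)).mono fun w hw => by
        simp only
        rw [step_eq_zero ha hw, step_eq_zero (ha.trans hab) (by linarith), sub_zero, zero_div]
    refine ⟨0, (hasDerivAt_const 0 (0 : ℝ)).congr_of_eventuallyEq hev, ?_⟩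
    rw [stepDeriv_eq_zero ha (by positivity), stepDeriv_eq_zero (ha.trans hab) (by linarith)]
    simp
  · refine ⟨_, hk.div (hasDerivAt_id σ) hσ, ?_⟩
    field_simp
    ring

/-- A radial test function whose Laplacian is the difference of two radial bumps. -/
lemma exists_radial_testFunction {a b : ℝ} (ha : 0 < a) (hab : a < b) :
    ∃ φ φ₁ φ₂ : ℝ × ℝ → ℝ, TestFunction (√b) φ φ₁ φ₂
      (fun z => 4 * (stepDeriv b (z.1 ^ 2 + z.2 ^ 2) - stepDeriv a (z.1 ^ 2 + z.2 ^ 2))) := by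
  have hb : 0 < b := ha.trans hab
  choose d hd hdeq using exists_hasDerivAt_step_sub_div ha hab
  set f : ℝ → ℝ := fun σ => (step a σ - step b σ) / σ with hf
  have hfc : Continuous f := continuous_iff_continuousAt.2 fun σ => (hd σ).continuousAt
  -- In the variable σ = |z|² the Laplacian of ψ(|z|²) is 4(σψ')', and here σψ' = step b - step a.
  -- Integrating from `b` makes ψ vanish beyond `b`.
  set ψ : ℝ → ℝ := fun σ => -∫ τ in b..σ, f τ with hψ
  have hψd : ∀ σ, HasDerivAt ψ (-f σ) σ := fun σ =>
    (intervalIntegral.integral_hasDerivAt_right (hfc.intervalIntegrable _ _)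
      (hfc.stronglyMeasurableAtFilter _ _) hfc.continuousAt).neg
  have hq : ∀ z : ℝ × ℝ, HasFDerivAt (fun z : ℝ × ℝ => z.1 ^ 2 + z.2 ^ 2)
      ((2 * z.1) • ContinuousLinearMap.fst ℝ ℝ ℝ + (2 * z.2) • ContinuousLinearMap.snd ℝ ℝ ℝ) z :=
    fun z => by
      have h1 := ((hasFDerivAt_fst (𝕜 := ℝ) (p := z)).pow 2).add
        ((hasFDerivAt_snd (𝕜 := ℝ) (p := z)).pow 2)
      refine h1.congr_fderiv ?_
      ext <;> simp
  have hfb : ∀ σ, b ≤ σ → f σ = 0 := fun σ hσ => by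
    simp only [hf]
    rw [step_eq_one ha (hab.le.trans hσ), step_eq_one hb hσ, sub_self, zero_div]
  refine ⟨fun z => ψ (z.1 ^ 2 + z.2 ^ 2), fun z => -f (z.1 ^ 2 + z.2 ^ 2) * (2 * z.1),
    fun z => -f (z.1 ^ 2 + z.2 ^ 2) * (2 * z.2), ?_, ?_, ?_, ?_⟩
  · intro z
    refine ((hψd _).comp_hasFDerivAt z (hq z)).congr_fderiv ?_
    ext <;> simp
  · intro z
    have h1 := ((hd _).comp_hasFDerivAt z (hq z)).neg
    have e1 : HasFDerivAt (fun z : ℝ × ℝ => 2 * z.1) ((2 : ℝ) • ContinuousLinearMap.fst ℝ ℝ ℝ) z :=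
      (hasFDerivAt_fst (𝕜 := ℝ) (p := z)).const_mul 2
    have e2 : HasFDerivAt (fun z : ℝ × ℝ => 2 * z.2) ((2 : ℝ) • ContinuousLinearMap.snd ℝ ℝ ℝ) z :=
      (hasFDerivAt_snd (𝕜 := ℝ) (p := z)).const_mul 2
    refine ⟨_, _, h1.mul e1, h1.mul e2, ?_⟩
    have h3 := hdeq (z.1 ^ 2 + z.2 ^ 2)
    have h4 : (step a (z.1 ^ 2 + z.2 ^ 2) - step b (z.1 ^ 2 + z.2 ^ 2)) / (z.1 ^ 2 + z.2 ^ 2) =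
        f (z.1 ^ 2 + z.2 ^ 2) := rfl
    rw [h4] at h3
    simp
    linear_combination (-4) * h3
  · have hc : Continuous fun z : ℝ × ℝ => z.1 ^ 2 + z.2 ^ 2 := by fun_prop
    exact continuous_const.mul (((continuous_stepDeriv b).comp hc).sub
      ((continuous_stepDeriv a).comp hc))
  · intro z hz
    rw [Real.sq_sqrt hb.le] at hz
    have h1 : ψ (z.1 ^ 2 + z.2 ^ 2) = 0 := by
      simp only [hψ, neg_eq_zero]
      rw [← intervalIntegral.integral_zero (a := b) (b := z.1 ^ 2 + z.2 ^ 2)]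
      refine intervalIntegral.integral_congr fun τ hτ => ?_
      rw [uIcc_of_le hz.le] at hτ
      exact hfb τ hτ.1
    refine ⟨h1, ?_, ?_, ?_⟩
    · simp [hfb _ hz.le]
    · simp [hfb _ hz.le]
    · simp [stepDeriv_eq_zero_of_gt hb hz, stepDeriv_eq_zero_of_gt ha (hab.trans hz)]

section
variable {γ C r : ℝ} {D : Set (ℝ × ℝ)} {v p q : ℝ × ℝ → ℝ}

lemma PlanarSolution.continuous_mul_stepDeriv (S : PlanarSolution γ C (disc r) D v p q) {b : ℝ}
    (hb : 0 < b) (hbr : b < r ^ 2) :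
    Continuous fun z : ℝ × ℝ => v z * stepDeriv b (z.1 ^ 2 + z.2 ^ 2) := by
  have hc : Continuous fun z : ℝ × ℝ => z.1 ^ 2 + z.2 ^ 2 := by fun_prop
  refine continuous_iff_continuousAt.2 fun z => ?_
  by_cases hz : z ∈ disc r
  · exact (S.continuousOn.continuousAt (S.isOpen_dom.mem_nhds hz)).mul
      ((continuous_stepDeriv b).comp hc).continuousAt
  · have hz' : b < z.1 ^ 2 + z.2 ^ 2 := hbr.trans_le (not_lt.1 hz)
    refine (continuousAt_const (y := (0 : ℝ))).congr ?_
    filter_upwards [hc.continuousAt.eventually (lt_mem_nhds hz')] with w hw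
    rw [stepDeriv_eq_zero_of_gt hb hw, mul_zero]

/-- A negligible free boundary cannot pass through the origin. -/
theorem PlanarSolution.notMem_closure_of_null (S : PlanarSolution γ C (disc r) D v p q)
    (hγ : 0 < γ) (hC : 0 ≤ C) (hr : 0 < r) (h0 : v 0 = 0)
    (hnull : ∀ τ : ℝ, 0 < τ → Measure.hausdorffMeasure 1
      {z : ℝ × ℝ | z ∈ disc r ∧ z ∈ closure D ∧ z ∉ D ∧ τ < |z.2|} = 0) :
    (0 : ℝ × ℝ) ∉ closure D := by
  intro hcl
  obtain ⟨M, hM, hMle⟩ := exists_abs_deriv_smoothTransition_le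
  set J : ℝ → ℝ := fun b => ∫ z in rect r r, v z * stepDeriv b (z.1 ^ 2 + z.2 ^ 2) with hJ
  have hi : ∀ b, 0 < b → b < r ^ 2 → IntegrableOn
      (fun z : ℝ × ℝ => v z * stepDeriv b (z.1 ^ 2 + z.2 ^ 2)) (rect r r) := fun b hb hbr =>
    (S.continuous_mul_stepDeriv hb hbr).continuousOn.integrableOn_compact (isCompact_rect r r)
  have hJeq : ∀ a b, 0 < a → a < b → b < r ^ 2 → J b = J a := by
    intro a b ha hab hbr
    obtain ⟨φ, φ₁, φ₂, hφ⟩ := exists_radial_testFunction ha hab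
    have h1 := S.integral_mul_lap_eq_zero hγ hC h0 hnull hφ (Real.sqrt_nonneg b)
      ((Real.sqrt_lt' hr).2 hbr)
    have h2 : ∀ z : ℝ × ℝ,
        v z * (4 * (stepDeriv b (z.1 ^ 2 + z.2 ^ 2) - stepDeriv a (z.1 ^ 2 + z.2 ^ 2))) =
        4 * (v z * stepDeriv b (z.1 ^ 2 + z.2 ^ 2) - v z * stepDeriv a (z.1 ^ 2 + z.2 ^ 2)) :=
      fun z => by ring
    simp only [h2] at h1
    rw [integral_const_mul, integral_sub (hi b (ha.trans hab) hbr) (hi a ha (hab.trans hbr))] at h1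
    have h3 : J b - J a = 0 := by linarith
    linarith
  have hnn : ∀ b, 0 < b → b < r ^ 2 → ∀ z : ℝ × ℝ,
      0 ≤ v z * stepDeriv b (z.1 ^ 2 + z.2 ^ 2) := by
    intro b hb hbr z
    by_cases hz : z ∈ disc r
    · exact mul_nonneg (S.nonneg z hz) (stepDeriv_nonneg hb _)
    · rw [stepDeriv_eq_zero_of_gt hb (hbr.trans_le (not_lt.1 hz)), mul_zero]
  -- decay of the averages
  have hJle : ∀ a, 0 < a → a < r ^ 2 → J a ≤ 16 * M * C * r * √a ^ γ := by
    intro a ha har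
    set k := 2 * C * r * √a ^ γ * (M * (2 / a)) with hk
    have hknn : 0 ≤ k := by positivity
    have hQm : MeasurableSet (rect √a √a) := (isCompact_rect _ _).measurableSet
    have hQf : volume (rect √a √a) ≠ ⊤ := (isCompact_rect _ _).measure_ne_top
    calc J a ≤ ∫ z in rect r r, (rect √a √a).indicator (fun _ => k) z := by
          refine setIntegral_mono (hi a ha har)
            ((integrable_indicator_iff hQm).2 (integrableOn_const hQf)).integrableOn fun z => ?_
          rcases le_or_gt (z.1 ^ 2 + z.2 ^ 2) a with hza | hza
          · have hzr : z ∈ disc r := lt_of_le_of_lt hza har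
            have h1 : |z.1| ≤ √a := Real.abs_le_sqrt (by nlinarith [sq_nonneg z.2])
            have h2 : |z.2| ≤ √a := Real.abs_le_sqrt (by nlinarith [sq_nonneg z.1])
            have hz : z ∈ rect √a √a := ⟨abs_le.1 h1, abs_le.1 h2⟩
            rw [indicator_of_mem hz]
            have h3 := S.le_mul_abs_rpow hγ hC hr h0 hzr
            have h4 : |z.2| ^ γ ≤ √a ^ γ := Real.rpow_le_rpow (abs_nonneg _) h2 hγ.le
            have h5 : stepDeriv a (z.1 ^ 2 + z.2 ^ 2) ≤ M * (2 / a) :=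
              mul_le_mul_of_nonneg_right ((le_abs_self _).trans (hMle _)) (by positivity)
            refine mul_le_mul (h3.trans ?_) h5 (stepDeriv_nonneg ha _) (by positivity)
            gcongr
          · simp only [stepDeriv_eq_zero_of_gt ha hza, mul_zero]
            exact indicator_nonneg (fun _ _ => hknn) _
      _ ≤ volume.real (rect √a √a) * k := setIntegral_indicator_const_le hQm hQf hknn
      _ = _ := by
          have h1 : -√a ≤ √a := by linarith [Real.sqrt_nonneg a]
          rw [rect, volume_real_Icc_prod_Icc h1 h1, hk]
          have h2 : (√a - -√a) * (√a - -√a) = 4 * a := by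
            have := Real.mul_self_sqrt ha.le
            linear_combination 4 * this
          rw [h2]
          field_simp
          ring
  have hJ0 : ∀ b, 0 < b → b < r ^ 2 → J b = 0 := by
    intro b hb hbr
    refine le_antisymm ?_ (integral_nonneg (hnn b hb hbr))
    have hc : Continuous fun a : ℝ => 16 * M * C * r * √a ^ γ :=
      continuous_const.mul (Real.continuous_sqrt.rpow_const fun _ => Or.inr hγ.le)
    have hlim := (hc.tendsto 0).mono_left (nhdsWithin_le_nhds (s := Ioi 0))
    rw [Real.sqrt_zero, Real.zero_rpow hγ.ne', mul_zero] at hlim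
    refine ge_of_tendsto hlim (mem_of_superset (Ioo_mem_nhdsGT hb) fun a ha => ?_)
    rw [hJeq a b ha.1 ha.2 hbr]
    exact hJle a ha.1 (ha.2.trans hbr)
  -- a point where the bump is positive
  obtain ⟨θ, hθ, hθpos⟩ : ∃ θ ∈ Ioo (0 : ℝ) 1, 0 < deriv Real.smoothTransition θ := by
    obtain ⟨θ, hθ, h⟩ := exists_hasDerivAt_eq_slope Real.smoothTransition
      (deriv Real.smoothTransition) one_pos Real.smoothTransition.continuous.continuousOn
      fun t _ => hasDerivAt_smoothTransition t
    refine ⟨θ, hθ, ?_⟩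
    rw [h]; simp
  have hU : IsOpen {z : ℝ × ℝ | 2 * (z.1 ^ 2 + z.2 ^ 2) < r ^ 2} :=
    isOpen_lt (by fun_prop) (by fun_prop)
  obtain ⟨z, hzU, hzD⟩ := mem_closure_iff.1 hcl _ hU (by simpa using pow_pos hr 2)
  have hzU' : 2 * (z.1 ^ 2 + z.2 ^ 2) < r ^ 2 := hzU
  have hzB : z ∈ disc r := by
    have : z.1 ^ 2 + z.2 ^ 2 < r ^ 2 := by nlinarith [sq_nonneg z.1, sq_nonneg z.2]
    exact this
  have hvz := (S.mem_iff z hzB).1 hzD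
  have hq0 : 0 < z.1 ^ 2 + z.2 ^ 2 := by
    rcases eq_or_ne z 0 with rfl | hz
    · rw [h0] at hvz; exact absurd hvz (lt_irrefl _)
    · have h1 : z.1 ≠ 0 ∨ z.2 ≠ 0 := by
        by_contra! h
        exact hz (Prod.ext h.1 h.2)
      rcases h1 with h | h <;> positivity
  -- Chosen so that (2/b)|z|² - 1 = θ, which places `z` where the bump is positive. The condition
  -- 2|z|² < r² guarantees b < r².
  set b := 2 * (z.1 ^ 2 + z.2 ^ 2) / (1 + θ) with hb
  have hθ1 : 0 < 1 + θ := by linarith [hθ.1]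
  have hb0 : 0 < b := by positivity
  have hbr : b < r ^ 2 := lt_of_le_of_lt (div_le_self (by positivity) (by linarith [hθ.1])) hzU'
  have hpos : 0 < stepDeriv b (z.1 ^ 2 + z.2 ^ 2) := by
    unfold stepDeriv
    have : 2 / b * (z.1 ^ 2 + z.2 ^ 2) - 1 = θ := by rw [hb]; field_simp; ring
    rw [this]
    positivity
  have hcont := S.continuous_mul_stepDeriv hb0 hbr
  have hJb := hJ0 b hb0 hbr
  rw [hJ] at hJb
  simp only at hJb
  rw [setIntegral_eq_zero_iff_of_nonneg_ae (.of_forall (hnn b hb0 hbr)) (hi b hb0 hbr)] at hJb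
  have hW : IsOpen (interior (rect r r) ∩
      {w : ℝ × ℝ | 0 < v w * stepDeriv b (w.1 ^ 2 + w.2 ^ 2)}) :=
    isOpen_interior.inter (isOpen_lt continuous_const hcont)
  have hzr : z ∈ interior (rect r r) := by
    refine mem_interior_iff_mem_nhds.2 (prod_mem_nhds (Icc_mem_nhds ?_ ?_) (Icc_mem_nhds ?_ ?_))
    all_goals
      have hzB' : z.1 ^ 2 + z.2 ^ 2 < r ^ 2 := hzB
      nlinarith [sq_nonneg z.1, sq_nonneg z.2]
  have hpos2 := hW.measure_pos volume ⟨z, hzr, mul_pos hvz hpos⟩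
  have hzero : volume (interior (rect r r) ∩
      {w : ℝ × ℝ | 0 < v w * stepDeriv b (w.1 ^ 2 + w.2 ^ 2)}) = 0 := by
    have h1 := (ae_restrict_iff' (isCompact_rect r r).measurableSet).1 hJb
    refine measure_mono_null (fun w hw => ?_) (ae_iff.1 h1)
    simp only [mem_ofPred_eq, Classical.not_imp]
    exact ⟨interior_subset hw.1, hw.2.ne'⟩
  exact hpos2.ne' hzero

end
-- From weak solutions in the plane to planar solutions
/-- Products of locally integrable functions with test functions are integrable. -/
lemma integrable_mul_of_tsupport_subset {P : Set Plane} {h φ : Plane → ℝ}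
    (hh : LocallyIntegrableOn h P volume) (hφ : Continuous φ) (hc : HasCompactSupport φ)
    (hs : tsupport φ ⊆ P) : Integrable fun y => h y * φ y := by
  have h1 : IntegrableOn h (tsupport φ) := hh.integrableOn_compact_subset hs hc
  have h2 : IntegrableOn (fun y => h y * φ y) (tsupport φ) := h1.mul_continuousOn
    hφ.continuousOn hc
  refine (integrableOn_iff_integrable_of_support_subset fun y hy => ?_).1 h2
  exact subset_tsupport φ fun h0 => hy (by simp [h0])

lemma norm_sq_plane (y : Plane) : ‖y‖ ^ 2 = y 0 ^ 2 + y 1 ^ 2 := by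
  rw [EuclideanSpace.norm_sq_eq, Fin.sum_univ_two, Real.norm_eq_abs, Real.norm_eq_abs, sq_abs,
    sq_abs]

/-- A weak gradient coincides with the classical one where the function is `C¹`; in particular
bounds of the weak gradient hold pointwise. -/
lemma fderiv_sq_add_le {γ C : ℝ} (hγ : 0 < γ) {P B : Set Plane} (hP : IsOpen P) (hPB : P ⊆ B)
    {u : Plane → ℝ}
    (hu : ∀ y ∈ P, ContDiffAt ℝ 2 u y) (hC : GradientBoundOn γ C B u) :
    ∀ y ∈ P, fderiv ℝ u y (EuclideanSpace.single 0 1) ^ 2 +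
      fderiv ℝ u y (EuclideanSpace.single 1 1) ^ 2 ≤ (C * |y 1| ^ γ) ^ 2 := by
  obtain ⟨g, hg, hgC⟩ := hC
  have hd : ∀ y ∈ P, DifferentiableAt ℝ u y := fun y hy => (hu y hy).differentiableAt (by simp)
  have huc : ContinuousOn u P := fun y hy => (hd y hy).continuousAt.continuousWithinAt
  have hdc : ∀ e : Plane, ContinuousOn (fun y => fderiv ℝ u y e) P := fun e y hy => by
    have h1 : ContinuousAt (fderiv ℝ u) y :=
      ((hu y hy).fderiv_right (m := 1) (by norm_num)).continuousAt
    exact (h1.clm_apply continuousAt_const).continuousWithinAt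
  have hgi : ∀ i : Fin 2, LocallyIntegrableOn (fun y => g y i) P := fun i y hy => by
    obtain ⟨s, hs, h⟩ := (hg.locallyIntegrable_grad.mono_set hPB) y hy
    exact ⟨s, hs, (EuclideanSpace.proj (𝕜 := ℝ) i).integrable_comp h⟩
  have hdi : ∀ e : Plane, LocallyIntegrableOn (fun y => fderiv ℝ u y e) P := fun e =>
    (hdc e).locallyIntegrableOn hP.measurableSet
  -- Integration by parts compares the classical and weak derivatives against test functions; the
  -- fundamental lemma of the calculus of variations identifies them almost everywhere.
  have hae : ∀ i : Fin 2, ∀ᵐ y : Plane, y ∈ P →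
      g y i - fderiv ℝ u y (EuclideanSpace.single i 1) = 0 := by
    intro i
    refine hP.ae_eq_zero_of_integral_contDiff_smul_eq_zero ((hgi i).sub (hdi _)) ?_
    intro φ hφ hφc hφs
    have hw := hg.integral_eq φ hφ hφc (hφs.trans hPB) i
    have hφd : Continuous fun y => fderiv ℝ φ y (EuclideanSpace.single i 1) :=
      (hφ.continuous_fderiv (by simp)).clm_apply continuous_const
    have hi1 := integrable_mul_of_tsupport_subset (hgi i) hφ.continuous hφc hφs
    have hi2 := integrable_mul_of_tsupport_subset (hdi (EuclideanSpace.single i 1))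
      hφ.continuous hφc hφs
    have huP : LocallyIntegrableOn u P volume := huc.locallyIntegrableOn hP.measurableSet
    have hts : tsupport (fun y => fderiv ℝ φ y (EuclideanSpace.single i 1)) ⊆ tsupport φ :=
      closure_minimal (fun y hy => support_fderiv_subset ℝ fun h0 => hy (by simp [h0]))
        (isClosed_tsupport φ)
    have hi3 := integrable_mul_of_tsupport_subset huP hφd
      (hφc.of_isClosed_subset (isClosed_tsupport _) hts) (hts.trans hφs)
    have hi4 := integrable_mul_of_tsupport_subset huP hφ.continuous hφc hφs
    have hparts := integral_mul_fderiv_eq_neg_fderiv_mul_of_integrable hi2 hi3 hi4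
      (fun y hy => hd y (hφs hy)) (fun y _ => (hφ.differentiable (by simp)) y)
    have h1 : ∀ y, φ y • (g y i - fderiv ℝ u y (EuclideanSpace.single i 1)) =
        g y i * φ y - fderiv ℝ u y (EuclideanSpace.single i 1) * φ y := fun y => by
      rw [smul_eq_mul]; ring
    simp only [h1]
    rw [integral_sub hi1 hi2]
    linarith
  -- By continuity the violation set is open, so once it is null it is empty: the almost everywhere
  -- bound becomes pointwise.
  have hbad : IsOpen {y | y ∈ P ∧ (C * |y 1| ^ γ) ^ 2 <
      fderiv ℝ u y (EuclideanSpace.single 0 1) ^ 2 +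
      fderiv ℝ u y (EuclideanSpace.single 1 1) ^ 2} := by
    have h1 : Continuous fun y : Plane => (C * |y 1| ^ γ) ^ 2 := by
      have h2 : Continuous fun y : Plane => |y 1| ^ γ :=
        (Continuous.abs (by fun_prop)).rpow_const fun _ => Or.inr hγ.le
      fun_prop
    have h3 := (((hdc (EuclideanSpace.single 0 1)).pow 2).add
      ((hdc (EuclideanSpace.single 1 1)).pow 2)).sub h1.continuousOn
    have h4 := h3.isOpen_inter_preimage hP (isOpen_Ioi (a := (0 : ℝ)))
    convert h4 using 1
    ext y
    simp [sub_pos]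
  have hnull : volume {y | y ∈ P ∧ (C * |y 1| ^ γ) ^ 2 <
      fderiv ℝ u y (EuclideanSpace.single 0 1) ^ 2 +
      fderiv ℝ u y (EuclideanSpace.single 1 1) ^ 2} = 0 := by
    have hPae : ∀ᵐ y : Plane, y ∈ P → ‖g y‖ ≤ C * |y 1| ^ γ :=
      (ae_restrict_iff' hP.measurableSet).1 (ae_restrict_of_ae_restrict_of_subset hPB hgC)
    have hall : ∀ᵐ y : Plane, ¬ (y ∈ P ∧ (C * |y 1| ^ γ) ^ 2 <
      fderiv ℝ u y (EuclideanSpace.single 0 1) ^ 2 +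
      fderiv ℝ u y (EuclideanSpace.single 1 1) ^ 2) := by
      filter_upwards [hae 0, hae 1, hPae] with y h0 h1 h2
      rintro ⟨hy, hlt⟩
      have e0 := sub_eq_zero.1 (h0 hy)
      have e1 := sub_eq_zero.1 (h1 hy)
      rw [← e0, ← e1, ← norm_sq_plane] at hlt
      exact not_le.2 hlt (pow_le_pow_left₀ (norm_nonneg _) (h2 hy) 2)
    simpa using ae_iff.1 hall
  intro y hy
  by_contra h
  exact (hbad.measure_pos volume ⟨y, hy, not_le.1 h⟩).ne' hnull

/-- Cartesian coordinates centred at the point `(x, 0)`. -/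
noncomputable def chart (x : ℝ) : (ℝ × ℝ) ≃ₜ Plane where
  toFun z := !₂[x + z.1, z.2]
  invFun y := (y 0 - x, y 1)
  left_inv z := by simp
  right_inv y := by
    ext i
    fin_cases i <;> simp
  continuous_toFun := by
    refine (PiLp.continuous_toLp 2 _).comp (continuous_pi fun i => ?_)
    fin_cases i <;> simp <;> fun_prop
  continuous_invFun := by fun_prop

lemma chart_zero (x : ℝ) (z : ℝ × ℝ) : chart x z 0 = x + z.1 := rfl

lemma chart_one (x : ℝ) (z : ℝ × ℝ) : chart x z 1 = z.2 := rfl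

lemma chart_origin (x : ℝ) : chart x 0 = !₂[x, 0] := by
  ext i
  fin_cases i <;> simp [chart]

/-- The linear part of `chart x`. -/
noncomputable def chartLin : ℝ × ℝ →L[ℝ] Plane :=
  (ContinuousLinearMap.fst ℝ ℝ ℝ).smulRight (EuclideanSpace.single 0 1) +
    (ContinuousLinearMap.snd ℝ ℝ ℝ).smulRight (EuclideanSpace.single 1 1)

lemma chart_eq (x : ℝ) (z : ℝ × ℝ) : chart x z = !₂[x, 0] + chartLin z := by
  ext i
  fin_cases i <;> simp [chart, chartLin]

lemma hasFDerivAt_chart (x : ℝ) (z : ℝ × ℝ) : HasFDerivAt (chart x) chartLin z := by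
  have : (chart x : ℝ × ℝ → Plane) = fun z => !₂[x, 0] + chartLin z := funext (chart_eq x)
  rw [this]
  exact chartLin.hasFDerivAt.const_add _

lemma chart_mem_ball {x r : ℝ} (hr : 0 < r) (z : ℝ × ℝ) :
    chart x z ∈ Metric.ball (!₂[x, 0] : Plane) r ↔ z ∈ disc r := by
  rw [mem_ball_iff_norm, chart_eq, add_sub_cancel_left, ← sq_lt_sq₀ (norm_nonneg _) hr.le,
    norm_sq_plane]
  simp [chartLin, disc]

lemma laplacian_plane {u : Plane → ℝ} {y : Plane} : Laplacian.laplacian u y =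
    fderiv ℝ (fderiv ℝ u) y (EuclideanSpace.single 0 1) (EuclideanSpace.single 0 1) +
    fderiv ℝ (fderiv ℝ u) y (EuclideanSpace.single 1 1) (EuclideanSpace.single 1 1) := by
  rw [InnerProductSpace.laplacian_eq_iteratedFDeriv_orthonormalBasis u
    (EuclideanSpace.basisFun (Fin 2) ℝ)]
  simp [Fin.sum_univ_two, iteratedFDeriv_two_apply]

lemma isOpen_posSet {Ω : Set Plane} (hΩ : IsOpen Ω) {u : Plane → ℝ} (hu : ContinuousOn u Ω) :
    IsOpen (posSet Ω u) :=
  hu.isOpen_inter_preimage hΩ isOpen_Ioi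

section
variable {γ C x r : ℝ} {Ω : Set Plane} {u : Plane → ℝ}

lemma IsWeakSolution.planarSolution (hγ : 0 < γ) (hΩ : IsOpen Ω) (hu : IsWeakSolution γ Ω u)
    (hr : 0 < r) (hball : Metric.ball (!₂[x, 0] : Plane) r ⊆ Ω)
    (hC : GradientBoundOn γ C (Metric.ball (!₂[x, 0] : Plane) r) u) :
    PlanarSolution γ C (disc r) (chart x ⁻¹' posSet Ω u) (fun z => u (chart x z))
      (fun z => fderiv ℝ u (chart x z) (EuclideanSpace.single 0 1))
      (fun z => fderiv ℝ u (chart x z) (EuclideanSpace.single 1 1)) where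
  isOpen_dom := isOpen_lt (by fun_prop) (by fun_prop)
  isOpen_pos := (isOpen_posSet hΩ hu.continuousOn).preimage (chart x).continuous
  continuousOn := hu.continuousOn.comp (chart x).continuous.continuousOn
    fun z hz => hball ((chart_mem_ball hr z).2 hz)
  nonneg z hz := hu.nonneg _ (hball ((chart_mem_ball hr z).2 hz))
  mem_iff z hz := ⟨fun h => h.2, fun h => ⟨hball ((chart_mem_ball hr z).2 hz), h⟩⟩
  hasFDerivAt z hz := by
    have h1 : DifferentiableAt ℝ u (chart x z) :=
      (hu.harmonic _ hz).1.differentiableAt (by simp)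
    refine (h1.hasFDerivAt.comp z (hasFDerivAt_chart x z)).congr_fderiv ?_
    ext <;> simp [chartLin]
  harmonic z hz := by
    obtain ⟨hcd, hΔ⟩ := hu.harmonic _ hz
    have h1 : DifferentiableAt ℝ (fderiv ℝ u) (chart x z) :=
      (hcd.fderiv_right (m := 1) (by norm_num)).differentiableAt (by simp)
    have h2 := h1.hasFDerivAt.comp z (hasFDerivAt_chart x z)
    refine ⟨_, _, h2.clm_apply (hasFDerivAt_const (EuclideanSpace.single 0 (1 : ℝ)) z),
      h2.clm_apply (hasFDerivAt_const (EuclideanSpace.single 1 (1 : ℝ)) z), ?_⟩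
    have h3 := hΔ.self_of_nhds
    rw [laplacian_plane] at h3
    simpa [chartLin] using h3
  bound z hz := by
    have hopen : IsOpen (posSet Ω u ∩ Metric.ball (!₂[x, 0] : Plane) r) :=
      (isOpen_posSet hΩ hu.continuousOn).inter Metric.isOpen_ball
    exact fderiv_sq_add_le hγ hopen inter_subset_right
      (fun y hy => (hu.harmonic y hy.1).1) hC _ ⟨hz.1, (chart_mem_ball hr z).2 hz.2⟩

lemma mem_freeBoundaryOff {τ : ℝ} {y : Plane} (hΩ : IsOpen Ω) (hu : ContinuousOn u Ω)
    (hyΩ : y ∈ Ω) (hcl : y ∈ closure (posSet Ω u)) (hn : y ∉ posSet Ω u) (hτ : τ < |y 1|) :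
    y ∈ freeBoundaryOff Ω u τ := by
  refine ⟨?_, hyΩ, hτ⟩
  rw [(isOpen_posSet hΩ hu).frontier_eq]
  exact ⟨hcl, hn⟩

/-- For each `τ` there is an `ℋ¹`-negligible set off which the gradient attains the prescribed
boundary values. -/
lemma IsWeakSolution.exists_tendsto (x : ℝ) (hu : IsWeakSolution γ Ω u) {τ : ℝ} (hτ : 0 < τ) :
    ∃ N : Set Plane, Measure.hausdorffMeasure 1 N = 0 ∧
      ∀ z, chart x z ∈ freeBoundaryOff Ω u τ → chart x z ∉ N →
        Tendsto (fun z => √(fderiv ℝ u (chart x z) (EuclideanSpace.single 0 1) ^ 2 +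
          fderiv ℝ u (chart x z) (EuclideanSpace.single 1 1) ^ 2))
          (𝓝[chart x ⁻¹' posSet Ω u] z) (𝓝 (|z.2| ^ γ)) := by
  obtain ⟨R, hR, -, -, hnull, hG⟩ := hu.freeBoundary τ hτ
  refine ⟨_, hnull, fun z hz hzN => ?_⟩
  have hzR : chart x z ∈ R := by
    by_contra h
    exact hzN ⟨hz, h⟩
  obtain ⟨V, hV, hzV, G, hGc, hGu, hGn⟩ := hG _ hzR
  have hcl : chart x z ∈ closure (posSet Ω u) := frontier_subset_closure hz.1
  have h1 : Tendsto (fun y => ‖G y‖) (𝓝[V ∩ closure (posSet Ω u)] chart x z)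
      (𝓝 (|z.2| ^ γ)) := by
    have := (hGc (chart x z) ⟨hzV, hcl⟩).norm
    rw [ContinuousWithinAt, hGn _ ⟨hzV, hzR⟩] at this
    exact this
  have hev : ∀ᶠ w in 𝓝[chart x ⁻¹' posSet Ω u] z, chart x w ∈ V ∩ posSet Ω u :=
    Eventually.and ((chart x).continuous.continuousAt.mono_left nhdsWithin_le_nhds
      (hV.mem_nhds hzV)) self_mem_nhdsWithin
  have h2 : Tendsto (chart x) (𝓝[chart x ⁻¹' posSet Ω u] z)
      (𝓝[V ∩ closure (posSet Ω u)] chart x z) :=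
    tendsto_nhdsWithin_iff.2 ⟨(chart x).continuous.continuousAt.mono_left nhdsWithin_le_nhds,
      hev.mono fun w hw => ⟨hw.1, subset_closure hw.2⟩⟩
  refine (h1.comp h2).congr' (hev.mono fun w hw => ?_)
  have h3 := (hGu _ hw).hasFDerivAt.fderiv
  have h4 : ∀ i : Fin 2, fderiv ℝ u (chart x w) (EuclideanSpace.single i 1) =
      G (chart x w) i := fun i => by
    rw [h3]
    simp [EuclideanSpace.inner_single_right]
  simp only [Function.comp]
  rw [h4, h4, ← norm_sq_plane, Real.sqrt_sq (norm_nonneg _)]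

lemma lipschitzWith_coord (x : ℝ) (i : Fin 2) : LipschitzWith 1 fun y : Plane => y i - x := by
  refine LipschitzWith.of_dist_le_mul fun y z => ?_
  rw [NNReal.coe_one, one_mul, Real.dist_eq, sub_sub_sub_cancel_right, dist_eq_norm]
  have := PiLp.norm_apply_le (y - z) i
  simpa using this

lemma lipschitzWith_chart_symm (x : ℝ) : LipschitzWith 1 (chart x).symm := by
  have h1 := (lipschitzWith_coord x 0).prodMk (lipschitzWith_coord 0 1)
  rw [max_self] at h1
  convert h1 using 1
  funext y
  simp [chart]

/-- The exceptional sets for |x₂| > 1/(n+1) are ℋ¹-null, so their union is too. The first coordinate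
is 1-Lipschitz and maps it to a Lebesgue-null set of abscissas. -/
lemma IsWeakSolution.ae_regularAbscissa (hΩ : IsOpen Ω) (hu : IsWeakSolution γ Ω u)
    (hr : 0 < r) (hball : Metric.ball (!₂[x, 0] : Plane) r ⊆ Ω) :
    ∀ᵐ σ, RegularAbscissa γ (disc r) (chart x ⁻¹' posSet Ω u)
      (fun z => fderiv ℝ u (chart x z) (EuclideanSpace.single 0 1))
      (fun z => fderiv ℝ u (chart x z) (EuclideanSpace.single 1 1)) σ := by
  have hτ : ∀ n : ℕ, (0 : ℝ) < 1 / ((n : ℝ) + 1) := fun n => by positivity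
  choose N hN hNt using fun n => hu.exists_tendsto x (hτ n)
  have hnull : Measure.hausdorffMeasure 1 (⋃ n, N n) = 0 := measure_iUnion_null hN
  have himg : volume ((fun y : Plane => y 0 - x) '' ⋃ n, N n) = 0 := by
    rw [← hausdorffMeasure_real]
    have := (lipschitzWith_coord x 0).hausdorffMeasure_image_le zero_le_one (⋃ n, N n)
    rw [hnull, mul_zero] at this
    exact le_antisymm this zero_le
  filter_upwards [measure_eq_zero_iff_ae_notMem.1 himg] with σ hσ t ht hB hcl hD
  obtain ⟨n, hn⟩ := exists_nat_one_div_lt (abs_pos.2 ht)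
  rw [← (chart x).preimage_closure] at hcl
  refine hNt n _ (mem_freeBoundaryOff hΩ hu.continuousOn
    (hball ((chart_mem_ball hr _).2 hB)) hcl hD hn) fun hmem => hσ ?_
  exact ⟨_, mem_iUnion.2 ⟨n, hmem⟩, by simp [chart_zero]⟩

/-- The constant in the gradient bound around a free boundary point is at least `1`. -/
lemma IsWeakSolution.one_le (hγ : 0 < γ) (hΩ : IsOpen Ω) (hu : IsWeakSolution γ Ω u)
    (hr : 0 < r) (hball : Metric.ball (!₂[x, 0] : Plane) r ⊆ Ω)
    (hC : GradientBoundOn γ C (Metric.ball (!₂[x, 0] : Plane) r) u) (hC0 : 0 ≤ C)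
    (hx : (!₂[x, 0] : Plane) ∈ frontier (posSet Ω u)) : 1 ≤ C := by
  have S := hu.planarSolution hγ hΩ hr hball hC
  by_contra hlt
  rw [(isOpen_posSet hΩ hu.continuousOn).frontier_eq, ← chart_origin] at hx
  have h0B : (0 : ℝ × ℝ) ∈ disc r := by simpa [disc] using pow_pos hr 2
  have h0cl : (0 : ℝ × ℝ) ∈ closure (chart x ⁻¹' posSet Ω u) := by
    rw [← (chart x).preimage_closure]; exact hx.1
  -- A regular point off the axis would give |z₂|^γ ≤ C|z₂|^γ in the limit, which is impossible for
  -- C < 1. So every free boundary point in the disc with |x₂| > τ lies in the null set `N`.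
  refine S.notMem_closure_of_null hγ hC0 hr (S.eq_zero h0B hx.2) (fun τ hτ => ?_) h0cl
  obtain ⟨N, hN, hNt⟩ := hu.exists_tendsto x hτ
  have himg : Measure.hausdorffMeasure 1 ((chart x).symm '' N) = 0 := by
    have := (lipschitzWith_chart_symm x).hausdorffMeasure_image_le zero_le_one N
    rw [hN, mul_zero] at this
    exact le_antisymm this zero_le
  refine measure_mono_null ?_ himg
  rintro z ⟨hzB, hzcl, hzD, hzτ⟩
  refine ⟨chart x z, ?_, (chart x).symm_apply_apply z⟩
  by_contra hzN
  have hcl := hzcl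
  rw [← (chart x).preimage_closure] at hcl
  have h1 := hNt z (mem_freeBoundaryOff hΩ hu.continuousOn
    (hball ((chart_mem_ball hr _).2 hzB)) hcl hzD hzτ) hzN
  have hcont : Continuous fun z : ℝ × ℝ => C * |z.2| ^ γ :=
    continuous_const.mul ((continuous_abs.comp continuous_snd).rpow_const fun _ => Or.inr hγ.le)
  have h2 := hcont.continuousAt.mono_left (nhdsWithin_le_nhds (s := chart x ⁻¹' posSet Ω u) (a := z))
  have hne : (𝓝[chart x ⁻¹' posSet Ω u] z).NeBot := mem_closure_iff_nhdsWithin_neBot.1 hzcl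
  have h3 : |z.2| ^ γ ≤ C * |z.2| ^ γ := by
    refine le_of_tendsto_of_tendsto h1 h2 ?_
    filter_upwards [self_mem_nhdsWithin, mem_nhdsWithin_of_mem_nhds (S.isOpen_dom.mem_nhds hzB)]
      with w hw hwB
    rw [Real.sqrt_le_left (by positivity)]
    exact S.bound w ⟨hw, hwB⟩
  have h4 : 0 < |z.2| ^ γ := Real.rpow_pos_of_pos (hτ.trans hzτ) _
  exact hlt (le_of_mul_le_mul_right (by linarith) h4)

end

/-! ### Components of the rescaled positivity set as clopen parts -/

/-- A small ball meets the convex set `K` in a connected set, which lies in a single component. The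
equivalence yields relative openness and relative closedness of components at once. -/
lemma eventually_mem_connectedComponentIn_iff {X : Type*} [NormedAddCommGroup X]
    [NormedSpace ℝ X] {U K : Set X} (hU : IsOpen U) (hK : Convex ℝ K) (y₀ : X) {w : X}
    (hw : w ∈ U) (hwK : w ∈ K) : ∀ᶠ w' in 𝓝 w, w' ∈ K →
      (w ∈ connectedComponentIn (U ∩ K) y₀ ↔ w' ∈ connectedComponentIn (U ∩ K) y₀) := by
  obtain ⟨ε, hε, hball⟩ := Metric.isOpen_iff.1 hU w hw
  filter_upwards [Metric.ball_mem_nhds w hε] with w' hw' hw'K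
  have hpre : IsPreconnected (Metric.ball w ε ∩ K) :=
    ((convex_ball w ε).inter hK).isPreconnected
  have hsub : Metric.ball w ε ∩ K ⊆ U ∩ K := inter_subset_inter_left K hball
  have h1 : w ∈ Metric.ball w ε ∩ K := ⟨Metric.mem_ball_self hε, hwK⟩
  have h2 : w' ∈ Metric.ball w ε ∩ K := ⟨hw', hw'K⟩
  constructor
  · intro h
    rw [connectedComponentIn_eq h]
    exact hpre.subset_connectedComponentIn h1 hsub h2
  · intro h
    rw [connectedComponentIn_eq h]
    exact hpre.subset_connectedComponentIn h2 hsub h1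

lemma convex_square : Convex ℝ square := by
  have h : ∀ i : Fin 2, Convex ℝ {y : Plane | |y i| ≤ 1} := fun i => by
    have h1 : {y : Plane | |y i| ≤ 1} = (EuclideanSpace.proj (𝕜 := ℝ) i) ⁻¹' Icc (-1 : ℝ) 1 := by
      ext y
      simp [abs_le]
    rw [h1]
    exact (convex_Icc _ _).linear_preimage (EuclideanSpace.proj (𝕜 := ℝ) i).toLinearMap
  exact (h 0).inter (h 1)

lemma isClosed_square : IsClosed square := by
  have h : ∀ i : Fin 2, IsClosed {y : Plane | |y i| ≤ 1} := fun i =>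
    isClosed_le (by fun_prop) continuous_const
  exact (h 0).inter (h 1)

section
variable {γ C x r ρ : ℝ} {Ω : Set Plane} {u : Plane → ℝ} {O : Set Plane}

/-- The dilation by `ρ⁻¹`, from pairs to the plane. -/
noncomputable def dilate (ρ : ℝ) (z : ℝ × ℝ) : Plane := ρ⁻¹ • chart 0 z

lemma continuous_dilate (ρ : ℝ) : Continuous (dilate ρ) := (chart 0).continuous.const_smul ρ⁻¹

lemma dilate_zero (z : ℝ × ℝ) : dilate ρ z 0 = ρ⁻¹ * z.1 := by
  simp [dilate, chart_zero]

lemma dilate_one (z : ℝ × ℝ) : dilate ρ z 1 = ρ⁻¹ * z.2 := by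
  simp [dilate, chart_one]

lemma add_smul_dilate (hρ : ρ ≠ 0) (z : ℝ × ℝ) : !₂[x, 0] + ρ • dilate ρ z = chart x z := by
  rw [dilate, smul_smul, mul_inv_cancel₀ hρ, one_smul]
  ext i
  fin_cases i <;> simp [chart]

lemma dilate_mem_square (hρ : 0 < ρ) (z : ℝ × ℝ) : dilate ρ z ∈ square ↔ z ∈ rect ρ ρ := by
  have h : ∀ t : ℝ, |ρ⁻¹ * t| ≤ 1 ↔ t ∈ Icc (-ρ) ρ := fun t => by
    rw [abs_mul, abs_of_pos (inv_pos.2 hρ), inv_mul_le_iff₀ hρ, mul_one, abs_le, mem_Icc]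
  simp only [square, mem_ofPred_eq, dilate_zero, dilate_one, h, rect, mem_prod]

lemma zero_mem_closure_preimage (hρ : 0 < ρ) (h : (0 : Plane) ∈ closure O) {s : ℝ} (hs : 0 < s) :
    (0 : ℝ × ℝ) ∈ closure (dilate ρ ⁻¹' O ∩ {z | |z.1| ≤ s}) := by
  have hg : Continuous fun y : Plane => (chart 0).symm (ρ • y) :=
    (chart 0).symm.continuous.comp (continuous_const_smul ρ)
  have hg0 : (chart 0).symm (ρ • (0 : Plane)) = 0 := by
    rw [smul_zero, Homeomorph.symm_apply_eq, chart_origin]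
    ext i
    fin_cases i <;> simp
  rw [mem_closure_iff]
  intro U hU h0U
  have hV : IsOpen (U ∩ {z : ℝ × ℝ | |z.1| < s}) :=
    hU.inter (isOpen_lt (by fun_prop) continuous_const)
  obtain ⟨y, hyV, hyO⟩ := mem_closure_iff.1 h _ (hV.preimage hg)
    (by rw [mem_preimage, hg0]; exact ⟨h0U, by simpa using hs⟩)
  have hys : |((chart 0).symm (ρ • y)).1| < s := hyV.2
  refine ⟨_, hyV.1, ?_, hys.le⟩
  rw [mem_preimage, dilate, Homeomorph.apply_symm_apply, smul_smul, inv_mul_cancel₀ hρ.ne',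
    one_smul]
  exact hyO

/-- In centred coordinates, the component is a clopen part of the positivity set in suitable
rectangles. -/
lemma IsTouchingComponent.clopenPart (hΩ : IsOpen Ω) (hu : ContinuousOn u Ω) (hρ : 0 < ρ)
    (hO : IsTouchingComponent Ω u !₂[x, 0] ρ O) {s T : ℝ} (hs : s ≤ ρ) (hT : T ≤ ρ)
    (hcl : closure (dilate ρ ⁻¹' O ∩ {z | |z.1| ≤ s}) ⊆ disc r)
    (hlt : ∀ z, dilate ρ z ∈ O → |z.1| ≤ s → |z.2| < T) :
    ClopenPart (disc r) (chart x ⁻¹' posSet Ω u) s T (dilate ρ ⁻¹' O ∩ {z | |z.1| ≤ s}) := by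
  obtain ⟨⟨y₀, -, rfl⟩, -⟩ := hO
  have hU : IsOpen (rescaleSet !₂[x, 0] ρ (posSet Ω u)) :=
    (isOpen_posSet hΩ hu).preimage (by fun_prop)
  have hmem : ∀ z, dilate ρ z ∈ rescaleSet !₂[x, 0] ρ (posSet Ω u) ↔
      z ∈ chart x ⁻¹' posSet Ω u := fun z => by
    rw [rescaleSet, mem_ofPred_eq, add_smul_dilate hρ.ne', mem_preimage]
  have hsub := connectedComponentIn_subset (rescaleSet !₂[x, 0] ρ (posSet Ω u) ∩ square) y₀
  have hrect : rect s T ⊆ rect ρ ρ :=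
    prod_mono (Icc_subset_Icc (by linarith) hs) (Icc_subset_Icc (by linarith) hT)
  have hev : ∀ z, dilate ρ z ∈ rescaleSet !₂[x, 0] ρ (posSet Ω u) → dilate ρ z ∈ square →
      ∀ᶠ w in 𝓝 z, dilate ρ w ∈ square →
      (dilate ρ z ∈ connectedComponentIn (rescaleSet !₂[x, 0] ρ (posSet Ω u) ∩ square) y₀ ↔
        dilate ρ w ∈ connectedComponentIn (rescaleSet !₂[x, 0] ρ (posSet Ω u) ∩ square) y₀) :=
    fun z hz hzs => (continuous_dilate ρ).continuousAt.eventually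
      (eventually_mem_connectedComponentIn_iff hU convex_square y₀ hz hzs)
  refine ⟨?_, ?_, hcl, ?_, ?_, fun z hz => hlt z hz.1 hz.2⟩
  · exact fun z hz => ⟨abs_le.1 hz.2, abs_le.1 (hlt z hz.1 hz.2).le⟩
  · exact fun z hz => (hmem z).1 (hsub hz.1).1
  · intro z hz
    rw [eventually_nhdsWithin_iff]
    filter_upwards [hev z (hsub hz.1).1 (hsub hz.1).2] with w hw hwr
    exact ⟨(hw ((dilate_mem_square hρ w).2 (hrect hwr))).1 hz.1, abs_le.2 hwr.1⟩
  · rintro z ⟨hzc, hzD⟩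
    have hzs : |z.1| ≤ s := by
      have : IsClosed {z : ℝ × ℝ | |z.1| ≤ s} := isClosed_le (by fun_prop) continuous_const
      exact this.closure_subset (closure_mono inter_subset_right hzc)
    have hzsq : dilate ρ z ∈ square := by
      have h1 : IsClosed (dilate ρ ⁻¹' square) := isClosed_square.preimage (continuous_dilate ρ)
      exact h1.closure_subset (closure_mono
        (fun w (hw : w ∈ dilate ρ ⁻¹' _ ∩ {z | |z.1| ≤ s}) => (hsub hw.1).2) hzc)
    -- A limit point of the component that lies in the positivity set shares a component with nearby
    -- points of the square, some of which belong to `O`.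
    obtain ⟨w, hw, hwE⟩ := mem_closure_iff_frequently.1 hzc |>.and_eventually
      (hev z ((hmem z).2 hzD) hzsq) |>.exists
    exact ⟨(hwE (hsub hw.1).2).2 hw.1, hzs⟩

end

end FreeBdry

/-! ### Conclusion -/

theorem mainTheorem2 (γ : ℝ) (hγ : 0 < γ)
    (Ω : Set FreeBdry.Plane) (hΩ : IsOpen Ω) (u : FreeBdry.Plane → ℝ)
    (hu : FreeBdry.IsWeakSolution γ Ω u)
    (x : ℝ) (hxΩ : (!₂[x, 0] : FreeBdry.Plane) ∈ Ω)
    (hx : (!₂[x, 0] : FreeBdry.Plane) ∈ frontier (FreeBdry.posSet Ω u))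
    (r C : ℝ) (hball : Metric.ball (!₂[x, 0] : FreeBdry.Plane) r ⊆ Ω)
    (hC : FreeBdry.GradientBoundOn γ C (Metric.ball (!₂[x, 0] : FreeBdry.Plane) r) u)
    (ρ : ℝ) (hρ : 0 < ρ) (hρr : ρ ≤ r)
    (O : Set FreeBdry.Plane) (hO : FreeBdry.IsTouchingComponent Ω u !₂[x, 0] ρ O) :
    1 / (6 * C) ≤ FreeBdry.heightUpTo 1 O ∧
    ((∀ y ∈ O, |y 1| < 1) → closure O ⊆ Metric.ball (0 : FreeBdry.Plane) (r / ρ) →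
      1 / (6 * C) ≤ FreeBdry.height 1 O) := by
  open FreeBdry in
  have hr : 0 < r := hρ.trans_le hρr
  rcases le_or_gt C 0 with hC0 | hC0
  -- For C ≤ 0 the claimed bound is nonpositive, with `1 / 0 = 0` covering C = 0, while heights are
  -- nonnegative.
  · have h1 : 1 / (6 * C) ≤ 0 := div_nonpos_of_nonneg_of_nonpos zero_le_one (by linarith)
    refine ⟨h1.trans (le_min zero_le_one (Real.sSup_nonneg ?_)),
      fun _ _ => h1.trans (le_min zero_le_one (Real.sSup_nonneg ?_))⟩
    · rintro _ ⟨y, -, -, rfl⟩; exact abs_nonneg _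
    · rintro _ ⟨y, -, -, rfl⟩; exact abs_nonneg _
  have hC1 := hu.one_le hγ hΩ hr hball hC hC0.le hx
  have S := hu.planarSolution hγ hΩ hr hball hC
  have hreg := hu.ae_regularAbscissa (x := x) hΩ hr hball
  have hOsq : ∀ y ∈ O, |y 0| ≤ 1 ∧ |y 1| ≤ 1 := by
    obtain ⟨⟨y₀, -, rfl⟩, -⟩ := hO
    exact fun y hy => (connectedComponentIn_subset _ _ hy).2
  have hinv : ∀ t : ℝ, |t| = ρ * |ρ⁻¹ * t| := fun t => by
    rw [abs_mul, abs_of_pos (inv_pos.2 hρ), mul_inv_cancel_left₀ hρ.ne']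
  have h6 : 1 / (6 * C) ≤ 1 := by
    rw [div_le_one (by positivity)]; linarith
  constructor
  · refine le_min h6 ?_
    by_contra! hlt
    set M := sSup {t : ℝ | ∃ y ∈ O, |y 0| ≤ 1 ∧ t = |y 1|} with hM
    have hMle : ∀ y ∈ O, |y 1| ≤ M := fun y hy =>
      le_csSup ⟨1, by rintro _ ⟨w, hw, -, rfl⟩; exact (hOsq w hw).2⟩ ⟨y, hy, (hOsq y hy).1, rfl⟩
    -- Here C ≥ 1 enters: a counterexample would be flat.
    have hM6 : M < 1 / 6 := by
      refine hlt.trans_le ?_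
      rw [div_le_div_iff₀ (by positivity) (by norm_num)]
      linarith
    have hz2 : ∀ z, dilate ρ z ∈ O → |z.2| ≤ ρ * M := fun z hz => by
      have := hMle _ hz
      rw [dilate_one] at this
      rw [hinv]
      exact mul_le_mul_of_nonneg_left this hρ.le
    have hρM : ρ * M < ρ * (1 / 6) := mul_lt_mul_of_pos_left hM6 hρ
    -- Since (9/10)² + (1/6)² < 1, the truncated component has closure inside the open disc even
    -- when ρ = r, so no hypothesis on `closure O` is required.
    set E := dilate ρ ⁻¹' O ∩ {z : ℝ × ℝ | |z.1| ≤ ρ * (9 / 10)} with hE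
    have hcl : closure E ⊆ disc r := by
      have h1 : IsClosed {z : ℝ × ℝ | |z.1| ≤ ρ * (9 / 10)} :=
        isClosed_le (by fun_prop) continuous_const
      have h2 : IsClosed {z : ℝ × ℝ | |z.2| ≤ ρ * (1 / 6)} :=
        isClosed_le (by fun_prop) continuous_const
      have h3 : E ⊆ {z : ℝ × ℝ | |z.1| ≤ ρ * (9 / 10)} ∩ {z : ℝ × ℝ | |z.2| ≤ ρ * (1 / 6)} :=
        fun z hz => ⟨hz.2, (hz2 z hz.1).trans hρM.le⟩
      intro z hz
      have hz' := closure_minimal h3 (h1.inter h2) hz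
      have hz1 : |z.1| ≤ ρ * (9 / 10) := hz'.1
      have hz2 : |z.2| ≤ ρ * (1 / 6) := hz'.2
      have e1 := pow_le_pow_left₀ (abs_nonneg _) hz1 2
      have e2 := pow_le_pow_left₀ (abs_nonneg _) hz2 2
      rw [sq_abs] at e1 e2
      have e3 : ρ ^ 2 ≤ r ^ 2 := pow_le_pow_left₀ hρ.le hρr 2
      have e4 : 0 < ρ ^ 2 := by positivity
      have : z.1 ^ 2 + z.2 ^ 2 < r ^ 2 := by nlinarith
      exact this
    have hpart : ClopenPart (disc r) (chart x ⁻¹' posSet Ω u) (ρ * (9 / 10)) (ρ * (1 / 6)) E :=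
      hO.clopenPart hΩ hu.continuousOn hρ (by linarith) (by linarith) hcl
        fun z hz _ => (hz2 z hz).trans_lt hρM
    have hgrow := hpart.div_le_absHeight S hγ hC0 (by positivity) (by positivity) hreg
      (zero_mem_closure_preimage hρ hO.2 (by positivity))
    have hM0 : 0 ≤ M := Real.sSup_nonneg (by rintro _ ⟨y, -, -, rfl⟩; exact abs_nonneg _)
    have hup : absHeight E (ρ * (9 / 10)) ≤ ρ * M := by
      refine Real.sSup_le ?_ (by positivity)
      rintro _ ⟨z, hz, -, rfl⟩
      exact hz2 z hz.1
    have h1 := hgrow.trans hup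
    rw [div_le_iff₀ (by positivity)] at h1
    rw [lt_div_iff₀ (by positivity)] at hlt
    -- Linear growth at 9ρ/10 contradicts M < 1/(6C), which would give 4CM < 2/3.
    have h2 : 9 / 10 ≤ M * (4 * C) := by
      refine le_of_mul_le_mul_left ?_ hρ
      linarith
    linarith
  · intro htop hclO
    refine le_min h6 ?_
    set M := sSup {t : ℝ | ∃ y ∈ O, |y 0| = 1 ∧ t = |y 1|} with hM
    set E := dilate ρ ⁻¹' O ∩ {z : ℝ × ℝ | |z.1| ≤ ρ} with hE
    have hcl : closure E ⊆ disc r := by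
      intro z hz
      have h1 : dilate ρ z ∈ closure O :=
        map_mem_closure (continuous_dilate ρ) hz fun w hw => hw.1
      have h2 := hclO h1
      rw [← chart_mem_ball (x := 0) hr, mem_ball_iff_norm]
      rw [mem_ball_zero_iff, dilate, norm_smul, norm_inv, Real.norm_of_nonneg hρ.le,
        inv_mul_lt_iff₀ hρ, mul_div_cancel₀ _ hρ.ne'] at h2
      have h3 : (!₂[0, 0] : Plane) = 0 := by
        ext i
        fin_cases i <;> simp
      rwa [h3, sub_zero]
    -- No truncation is needed: the two extra hypotheses are exactly what the full square requires,
    -- and the growth estimate even gives 1/(4C).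
    have hpart : ClopenPart (disc r) (chart x ⁻¹' posSet Ω u) ρ ρ E :=
      hO.clopenPart hΩ hu.continuousOn hρ le_rfl le_rfl hcl fun z hz _ => by
        have := htop _ hz
        rw [dilate_one] at this
        rw [hinv]
        exact mul_lt_of_lt_one_right hρ this
    have hgrow := hpart.div_le_absHeight S hγ hC0 hρ hρ hreg
      (zero_mem_closure_preimage hρ hO.2 hρ)
    have hM0 : 0 ≤ M := Real.sSup_nonneg (by rintro _ ⟨y, -, -, rfl⟩; exact abs_nonneg _)
    have hup : absHeight E ρ ≤ ρ * M := by
      refine Real.sSup_le ?_ (by positivity)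
      rintro _ ⟨z, hz, hz1, rfl⟩
      rw [hinv]
      refine mul_le_mul_of_nonneg_left ?_ hρ.le
      refine le_csSup ⟨1, by rintro _ ⟨w, hw, -, rfl⟩; exact (hOsq w hw).2⟩
        ⟨dilate ρ z, hz.1, ?_, by rw [dilate_one]⟩
      rw [dilate_zero, abs_mul, abs_of_pos (inv_pos.2 hρ), hz1, inv_mul_cancel₀ hρ.ne']
    have h1 := hgrow.trans hup
    rw [div_le_iff₀ (by positivity)] at h1
    rw [div_le_iff₀ (by positivity)]
    have h2 : 1 ≤ M * (4 * C) := by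
      refine le_of_mul_le_mul_left ?_ hρ
      linarith
    nlinarith
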